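/- Let $n\ge 3$, $\lambda>0$, and equip $\mathbb{P}^{n-1}$ and its subvarieties with the Kähler form $\lambda\,\omega_{\mathrm{FS}}$, $\omega_{\mathrm{FS}}=\sqrt{-1}\,\partial\bar\partial\log\|x\|^2$ ($x=(x_1,\dots,x_n)$ homogeneous coordinates). Let $X=\{x_1^2+\dots+x_n^2=0\}\subset\mathbb{P}^{n-1}$. For $2\le k\le n$ let $$\mu_{SO(k)}(x)=\frac{\sqrt{-1}\,\lambda}{\|x\|^2}\bigl(x_i\bar x_j-\bar x_i x_j\bigr)_{1\le i,j\le k}\in\mathfrak{so}(k),$$ and let $(\lambda^{(k)}_i(x))_{1\le i\le k/2}$ be the intersection of the adjoint $SO(k)$-orbit of $\mu_{SO(k)}(x)$ with the positive Weyl chamber of $\mathfrak{so}(k)$, i.e. the block diagonal matrices with blocks $\begin{pmatrix}0&\ell_i\\-\ell_i&0\end{pmatrix}$ (and a final $0$ if $k$ is odd) where $\ell_1\ge\dots\ge\ell_m\ge 0$ if $k=2m+1$ and $\ell_1\ge\dots\ge\ell_{m-1}\ge|\ell_m|$ if $k=2m$. The functions $\lambda_i^{(k)}$, $2\le k\le n-1$,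 $1\le i\le k/2$, form the Gelfand–Cetlin system on $X$. For $3\le k\le n-1$ put $\nu_k(x)=\lambda\sum_{i\le k}|x_i|^2/\|x\|^2$. For $3\le k\le n$ and $t\in\mathbb{C}$ let $X_{k,t}=\{x_1^2+\dots+x_{k-1}^2+t\,x_k^2=0\}\subset\mathbb{P}^{n-1}$, let $\mathfrak{X}_k=\{([x],t)\mid [x]\in X_{k,t}\}\subset\mathbb{P}^{n-1}\times\mathbb{C}$ with projection $f:\mathfrak{X}_k\to\mathbb{C}$, and let $$\Phi_k=(\lambda_1^{(2)},\dots,\lambda_1^{(k-1)},\nu_k,\dots,\nu_{n-1}).$$ The gradient-Hamiltonian vector field of $\mathfrak{X}_k$ is $V=-\nabla(\mathrm{Re} f)/|\nabla(\mathrm{Re} f)|^2$, taken for the product Kähler metric on $\mathfrak{X}_k$. A set of $n-2$ continuous functions on an $(n-2)$-dimensional (possibly singular) variety $X_{k,t}$ is called an integrable system if on an open dense subset of the regular locus the functions are smooth, Poisson-commute and have linearly independent differentials. Then: 1. For $2\le k\le n$, $\mu_{SO(k)}$ is an equivariant moment map of the $SO(k)$-action on $\mathbb{P}^{n-1}$,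 the $\lambda_i^{(k)}$ are well defined on $\mathbb{P}^{n-1}$, and $\lambda_i^{(k)}=0$ for $i\ge2$. So $\Phi_n=(\lambda_1^{(2)},\dots,\lambda_1^{(n-1)})$ is the Gelfand–Cetlin system on $X=X_{n,1}$, the identically zero functions being left out. 2. For $4\le k\le n$, $X_{k,0}=X_{k-1,1}$, and $\Phi_k=\Phi_{k-1}$ there. 3. For $3\le k\le n$ the family $\mathfrak{X}_k\to\mathbb{C}$ is flat (its homogeneous coordinate ring is flat over $\mathbb{C}[t]$), $\Phi_k$ is continuous on $\mathbb{P}^{n-1}$, and for every $t\in\mathbb{C}$ it restricts to an integrable system on $X_{k,t}$. 4. $X_{3,1}=\{x_1^2+x_2^2+x_3^2=0\}$ (which is $X_{4,0}$ if $n\ge4$) is a projectively normal toric variety with torus-invariant Kähler form, and $\Phi_3=(\lambda_1^{(2)},\nu_3,\dots,\nu_{n-1})$ is its moment map. 5. For $3\le k\le n$ there are an open dense subset $U_k\subset X_{k,1}$ and maps $\phi_{k,s}:U_k\to X_{k,1-s}$, $0\le s\le1$, $\phi_{k,0}=\mathrm{id}$, such that every $s\mapsto(\phi_{k,s}(p),1-s)$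 is an integral curve of the gradient-Hamiltonian vector field through regular points of the fibres, every $\phi_{k,s}$ is a symplectomorphism onto an open dense subset of $X_{k,1-s}$ contained in its regular locus, $\phi_{k,1}(U_k)=X_{k,0}^{\mathrm{reg}}$, and $\Phi_k\circ\phi_{k,s}=\Phi_k$. 6. There is an open dense subset $W\subset X$ on which the successive compositions $\psi_{k,s}=\phi_{k,s}\circ\phi_{k+1,1}\circ\dots\circ\phi_{n,1}$ ($k=n,\dots,4$, $0\le s\le 1$) are defined and are symplectomorphisms onto open dense subsets of $X_{k,1-s}$ contained in the regular loci, with $\Phi_k\circ\psi_{k,s}=\Phi_n$; and the total composition $\phi_{4,1}\circ\dots\circ\phi_{n,1}$ (the identity if $n=3$) is a symplectomorphism of $W$ onto the whole regular locus $X_{3,1}^{\mathrm{reg}}$ of the toric variety, carrying $\Phi_n$ to the toric moment map $\Phi_3$. That is, the $\Phi_k$ together with the gradient-Hamiltonian flows give a toric degeneration (in stages) of the Gelfand–Cetlin system on $X$. -/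

import Mathlib

open scoped ContDiff Topology

namespace QuadricGC

noncomputable section

/-! ## Complex projective space and its Fubini-Study Kähler form -/

/-- The Hermitian space `ℂⁿ` of homogeneous coordinates. -/
abbrev E (n : ℕ) := EuclideanSpace ℂ (Fin n)

/-- The complex projective space `ℙⁿ⁻¹` of lines in `ℂⁿ`. -/
abbrev PSpace (n : ℕ) := Projectivization ℂ (E n)

/-- The quotient topology of `ℂⁿ ∖ {0} → ℙⁿ⁻¹`. -/
instance instTopologicalSpacePSpace (n : ℕ) : TopologicalSpace (PSpace n) :=
  TopologicalSpace.coinduced (fun v : { v : E n // v ≠ 0 } => Projectivization.mk' ℂ v)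
    inferInstance

/-- `x` is a vector of homogeneous coordinates of the point `p`. -/
def IsRep {n : ℕ} (p : PSpace n) (x : E n) : Prop :=
  ∃ hx : x ≠ 0, Projectivization.mk ℂ x hx = p

/-- The Kähler form `lam • ω_FS`, `ω_FS = √-1 ∂∂̄ log ‖x‖²`, pulled back to `ℂⁿ ∖ {0}` and
evaluated at `x` on `v, w`.  It only depends on the images of `v, w` in the tangent space
`ℂⁿ / ℂ x` of `ℙⁿ⁻¹` at `[x]`. -/
def fsForm {n : ℕ} (lam : ℝ) (x v w : E n) : ℝ :=
  2 * lam / ‖x‖ ^ 4 *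
    (((‖x‖ : ℂ) ^ 2 * inner ℂ v w - inner ℂ v x * inner ℂ x w).im)

/-- The Riemannian metric `g(v, w) = ω(v, √-1 w)` of the Kähler form `lam • ω_FS`. -/
def fsMetric {n : ℕ} (lam : ℝ) (x v w : E n) : ℝ :=
  fsForm lam x v (Complex.I • w)

/-- The homogeneous lift to `ℂⁿ` of a function on `ℙⁿ⁻¹` (with value `0` at the origin). -/
def lift {n : ℕ} (f : PSpace n → ℝ) (x : E n) : ℝ :=
  open Classical in if hx : x ≠ 0 then f (Projectivization.mk ℂ x hx) else 0

/-! ## Projective hypersurfaces `{P = 0}`, for a homogeneous polynomial `P` -/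

/-- The punctured affine cone of the hypersurface. -/
def cone {n : ℕ} (P : MvPolynomial (Fin n) ℂ) : Set (E n) :=
  {x | x ≠ 0 ∧ MvPolynomial.eval (fun i => x i) P = 0}

/-- The projective hypersurface `{P = 0} ⊂ ℙⁿ⁻¹`. -/
def zeroLocus {n : ℕ} (P : MvPolynomial (Fin n) ℂ) : Set (PSpace n) :=
  {p | ∀ x, IsRep p x → x ∈ cone P}

/-- The complex differential `dP_x(v)`. -/
def dPoly {n : ℕ} (P : MvPolynomial (Fin n) ℂ) (x : E n) : E n →ₗ[ℂ] ℂ where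
  toFun v := ∑ i, MvPolynomial.eval (fun j => x j) (MvPolynomial.pderiv i P) * v i
  map_add' v w := by simp [mul_add, Finset.sum_add_distrib]
  map_smul' c v := by
    simp only [PiLp.smul_apply, smul_eq_mul, RingHom.id_apply, Finset.mul_sum]
    exact Finset.sum_congr rfl fun i _ => by ring

/-- The points of the hypersurface where `dP ≠ 0`; for reduced `P` this is the regular locus. -/
def regLocus {n : ℕ} (P : MvPolynomial (Fin n) ℂ) : Set (PSpace n) :=
  {p | p ∈ zeroLocus P ∧ ∀ x, IsRep p x → dPoly P x ≠ 0}

/-- The tangent space of the hypersurface at a regular point `[x]`, realised as the vectors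
in `x^⊥ ≅ T_{[x]} ℙⁿ⁻¹` that are killed by `dP_x`. -/
def tangent {n : ℕ} (P : MvPolynomial (Fin n) ℂ) (x : E n) : Submodule ℂ (E n) :=
  (ℂ ∙ x)ᗮ ⊓ LinearMap.ker (dPoly P x)

/-- `A` is an open dense subset of `X` for the subspace topology of `X`. -/
def IsOpenDenseIn {n : ℕ} (X A : Set (PSpace n)) : Prop :=
  A ⊆ X ∧ (∃ O : Set (PSpace n), IsOpen O ∧ A = O ∩ X) ∧ X ⊆ closure A

/-! ## Integrable systems -/

/-- `Φ` is a completely integrable system on the hypersurface `{P = 0}` with the Kähler form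
`lam • ω_FS`: the number `N` of functions is the complex dimension, the functions are
continuous, and on an open dense subset of the regular locus they are smooth, their
differentials are linearly independent, and they Poisson-commute.
Here `L i` is the differential of the (lift of the) restriction of `Φ i` to the hypersurface
and `ξ i` is its Hamiltonian vector, `d(Φ i) = ω(·, ξ i)`, so that
`{Φ i, Φ j} = ± ω(ξ i, ξ j)`. -/
structure IsIntegrableSystem {n N : ℕ} (lam : ℝ) (P : MvPolynomial (Fin n) ℂ)
    (Φ : PSpace n → Fin N → ℝ) : Prop where
  dim : ∀ p ∈ regLocus P, ∀ x, IsRep p x → Module.finrank ℂ (tangent P x) = N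
  continuousOn : ContinuousOn Φ (zeroLocus P)
  integrable : ∃ A : Set (PSpace n), IsOpenDenseIn (zeroLocus P) A ∧ A ⊆ regLocus P ∧
    ∀ p ∈ A, ∀ x, IsRep p x →
      (∀ i, ContDiffWithinAt ℝ ∞ (lift fun q => Φ q i) (cone P) x) ∧
      ∃ (L : Fin N → (E n →L[ℝ] ℝ)) (ξ : Fin N → E n),
        (∀ i, HasFDerivWithinAt (lift fun q => Φ q i) (L i) (cone P) x) ∧
        LinearIndependent ℝ (fun i =>
          (L i).toLinearMap.domRestrict ((tangent P x).restrictScalars ℝ)) ∧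
        (∀ i, ξ i ∈ tangent P x ∧ ∀ w ∈ tangent P x, L i w = fsForm lam x w (ξ i)) ∧
        ∀ i j, fsForm lam x (ξ i) (ξ j) = 0

/-! ## Symplectomorphisms -/

/-- `Ψ` is a lift to homogeneous coordinates, smooth at `x`, of the map `f` defined near `[x]`
on the hypersurface `{P = 0}`. -/
def IsSmoothLiftAt {n : ℕ} (P : MvPolynomial (Fin n) ℂ) (f : PSpace n → PSpace n)
    (Ψ : E n → E n) (x : E n) : Prop :=
  ContDiffWithinAt ℝ ∞ Ψ (cone P) x ∧
    ∀ᶠ y in 𝓝[cone P] x, ∀ q, IsRep q y → IsRep (f q) (Ψ y)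

/-- `f` is a symplectomorphism, for the forms induced by `lam • ω_FS`, from the open subset `A`
of the regular locus of `{P = 0}` onto the open subset `B` of the regular locus of `{Q = 0}`:
it is a smooth bijection with smooth inverse that pulls back the symplectic form of the target
to that of the source. -/
structure IsSymplectomorphism {n : ℕ} (lam : ℝ) (P Q : MvPolynomial (Fin n) ℂ)
    (A B : Set (PSpace n)) (f : PSpace n → PSpace n) : Prop where
  source_reg : A ⊆ regLocus P
  target_reg : B ⊆ regLocus Q
  source_open : ∃ O : Set (PSpace n), IsOpen O ∧ A = O ∩ zeroLocus P
  target_open : ∃ O : Set (PSpace n), IsOpen O ∧ B = O ∩ zeroLocus Q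
  bijOn : Set.BijOn f A B
  symplectic : ∀ p ∈ A, ∀ x, IsRep p x → ∃ (Ψ : E n → E n) (D : E n →L[ℝ] E n),
    IsSmoothLiftAt P f Ψ x ∧ HasFDerivWithinAt Ψ D (cone P) x ∧
    ∀ v ∈ tangent P x, ∀ w ∈ tangent P x,
      fsForm lam (Ψ x) (D v) (D w) = fsForm lam x v w
  smooth_inv : ∃ g : PSpace n → PSpace n, Set.InvOn g f A B ∧
    ∀ q ∈ B, ∀ y, IsRep q y → ∃ Ψ : E n → E n, IsSmoothLiftAt Q g Ψ y

/-! ## Toric varieties with their moment maps -/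

/-- The linear action on `ℂⁿ` of the algebraic torus `(ℂˣ)ᴺ` with weights `w` in the orthonormal
basis `b`. -/
def torusAct {n N : ℕ} (b : OrthonormalBasis (Fin n) ℂ (E n)) (w : Fin n → Fin N → ℤ)
    (s : Fin N → ℂˣ) (x : E n) : E n :=
  ∑ i, (((∏ j, s j ^ w i j : ℂˣ) : ℂ) * inner ℂ (b i) x) • b i

/-- The infinitesimal action of the `j`-th factor of the compact torus `(S¹)ᴺ`,
`θ ↦ (1, …, exp (√-1 θ), …, 1)`. -/
def torusGen {n N : ℕ} (b : OrthonormalBasis (Fin n) ℂ (E n)) (w : Fin n → Fin N → ℤ)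
    (j : Fin N) (x : E n) : E n :=
  ∑ i, (Complex.I * (w i j : ℂ) * inner ℂ (b i) x) • b i

/-- The hypersurface `{P = 0}`, with the Kähler form `lam • ω_FS`, is a (projectively normal)
toric variety with torus-invariant Kähler form, and `Φ` is the moment map of the torus action:
an algebraic torus acts through a linear action whose compact torus is unitary, one orbit is
free, open and dense, and `d(Φ j) = ω(·, ξ_j)` for the `j`-th generator `ξ_j` of the compact
torus. -/
structure IsToricMomentMap {n N : ℕ} (lam : ℝ) (P : MvPolynomial (Fin n) ℂ)
    (Φ : PSpace n → Fin N → ℝ) : Prop where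
  isDomain : IsDomain (MvPolynomial (Fin n) ℂ ⧸ Ideal.span {P})
  normal : IsIntegrallyClosed (MvPolynomial (Fin n) ℂ ⧸ Ideal.span {P})
  continuousOn : ContinuousOn Φ (zeroLocus P)
  torus : ∃ (b : OrthonormalBasis (Fin n) ℂ (E n)) (w : Fin n → Fin N → ℤ),
    (∀ s, ∀ x ∈ cone P, torusAct b w s x ∈ cone P) ∧
    (∃ x ∈ cone P,
      (∀ s s' p, IsRep p (torusAct b w s x) → IsRep p (torusAct b w s' x) → s = s') ∧
      IsOpenDenseIn (zeroLocus P) {p | ∃ s, IsRep p (torusAct b w s x)}) ∧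
    ∀ p ∈ regLocus P, ∀ x, IsRep p x → ∀ j, ∃ L : E n →L[ℝ] ℝ,
      HasFDerivWithinAt (lift fun q => Φ q j) L (cone P) x ∧
      ∀ v ∈ tangent P x, L v = fsForm lam x v (torusGen b w j x)

/-! ## The Gelfand-Cetlin functions -/

/-- The `i`-th homogeneous coordinate, with indices starting at `0`. -/
def coord {n : ℕ} (x : E n) (i : ℕ) : ℂ := if h : i < n then x ⟨i, h⟩ else 0

/-- The moment map of the `SO(k)`-action on `(ℙⁿ⁻¹, lam • ω_FS)`, with values in `so(k)`:
`μ(x) = (√-1 lam / ‖x‖²) (x_i x̄_j - x̄_i x_j)_{i,j ≤ k}`, a real skew-symmetric matrix. -/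
def muSO {n : ℕ} (lam : ℝ) (k : ℕ) (p : PSpace n) : Matrix (Fin k) (Fin k) ℝ :=
  Matrix.of fun i j =>
    (Complex.I * lam / (‖p.rep‖ : ℂ) ^ 2 *
      (coord p.rep i * star (coord p.rep j) - star (coord p.rep i) * coord p.rep j)).re

/-- The block diagonal matrix in `so(k)` with diagonal blocks `((0, ℓ_i), (-ℓ_i, 0))`, followed
by a `0` if `k` is odd. -/
def cartanMatrix (k : ℕ) (l : Fin (k / 2) → ℝ) : Matrix (Fin k) (Fin k) ℝ :=
  Matrix.of fun i j =>
    ∑ m : Fin (k / 2),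
      if (i : ℕ) = 2 * m ∧ (j : ℕ) = 2 * m + 1 then l m
      else if (i : ℕ) = 2 * m + 1 ∧ (j : ℕ) = 2 * m then - l m else 0

/-- The positive Weyl chamber of `so(k)`: `ℓ_1 ≥ … ≥ ℓ_m ≥ 0` for `k = 2m + 1`, and
`ℓ_1 ≥ … ≥ ℓ_{m-1} ≥ |ℓ_m|` for `k = 2m`. -/
def InWeylChamber (k : ℕ) (l : Fin (k / 2) → ℝ) : Prop :=
  (∀ i j, i < j → |l j| ≤ l i) ∧ (Odd k → ∀ i, 0 ≤ l i)

/-- `l` is the intersection of the adjoint `SO(k)`-orbit of `A` with the positive Weyl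
chamber. -/
def IsChamberPoint (k : ℕ) (A : Matrix (Fin k) (Fin k) ℝ) (l : Fin (k / 2) → ℝ) : Prop :=
  InWeylChamber k l ∧
    ∃ g ∈ Matrix.specialOrthogonalGroup (Fin k) ℝ, A = g * cartanMatrix k l * g.transpose

/-- The tuple `(λ_1^{(k)}(p), …, λ_{⌊k/2⌋}^{(k)}(p))`. -/
def gcTuple {n : ℕ} (lam : ℝ) (k : ℕ) (p : PSpace n) : Fin (k / 2) → ℝ :=
  Classical.epsilon (IsChamberPoint k (muSO lam k p))

/-- The Gelfand-Cetlin function `λ_i^{(k)}`, for `1 ≤ i ≤ k / 2`. -/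
def gcFun {n : ℕ} (lam : ℝ) (k i : ℕ) (p : PSpace n) : ℝ :=
  if h : i - 1 < k / 2 then gcTuple lam k p ⟨i - 1, h⟩ else 0

/-- The function `ν_k = lam ∑_{i ≤ k} |x_i|² / ‖x‖²`, for `k ≥ 3`. -/
def nu {n : ℕ} (lam : ℝ) (k : ℕ) (p : PSpace n) : ℝ :=
  lam * (∑ i : Fin n, if (i : ℕ) < k then ‖p.rep i‖ ^ 2 else 0) / ‖p.rep‖ ^ 2

/-- `Φ_k = (λ_1^{(2)}, …, λ_1^{(k-1)}, ν_k, …, ν_{n-1})`. -/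
def Phi {n : ℕ} (lam : ℝ) (k : ℕ) (p : PSpace n) (j : Fin (n - 2)) : ℝ :=
  if (j : ℕ) + 2 < k then gcFun lam ((j : ℕ) + 2) 1 p else nu lam ((j : ℕ) + 2) p

/-- The action on `ℂⁿ` of a `k × k` matrix `g` placed in the upper left corner, with the identity
in the lower right corner. -/
def cornerAct {n k : ℕ} (g : Matrix (Fin k) (Fin k) ℝ) (x : E n) : E n :=
  WithLp.toLp 2 fun i =>
    if h : (i : ℕ) < k then ∑ j : Fin k, (g ⟨i, h⟩ j : ℂ) * coord x j else x i

/-- The infinitesimal action on `ℂⁿ` of `A ∈ so(k)`. -/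
def cornerGen {n k : ℕ} (A : Matrix (Fin k) (Fin k) ℝ) (x : E n) : E n :=
  WithLp.toLp 2 fun i =>
    if h : (i : ℕ) < k then ∑ j : Fin k, (A ⟨i, h⟩ j : ℂ) * coord x j else 0

/-- `μ` is an equivariant moment map of the `SO(k)`-action on `(ℙⁿ⁻¹, lam • ω_FS)`, where
`so(k)` is identified with its dual by the invariant inner product `∑_{i<j} A_ij B_ij`. -/
def IsMomentMapSO {n : ℕ} (lam : ℝ) (k : ℕ) (μ : PSpace n → Matrix (Fin k) (Fin k) ℝ) : Prop :=
  (∀ g ∈ Matrix.specialOrthogonalGroup (Fin k) ℝ, ∀ (p q : PSpace n) (x : E n),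
    IsRep p x → IsRep q (cornerAct g x) → μ q = g * μ p * g.transpose) ∧
  ∀ A : Matrix (Fin k) (Fin k) ℝ, A.transpose = -A → ∀ x : E n, x ≠ 0 →
    ∃ L : E n →L[ℝ] ℝ,
      HasFDerivAt (lift fun q => ∑ i, ∑ j, if i < j then A i j * μ q i j else 0) L x ∧
      ∀ v, L v = fsForm lam x v (cornerGen A x)

/-! ## The degeneration in stages -/

/-- The equation `x_1² + … + x_{k-1}² + t x_k²` of the family `𝔛_k`, with coefficients in
`ℂ[t]`. -/
def famPoly (n k : ℕ) : MvPolynomial (Fin n) (Polynomial ℂ) :=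
  ∑ i : Fin n, if (i : ℕ) + 1 < k then MvPolynomial.X i ^ 2
    else if (i : ℕ) + 1 = k then MvPolynomial.C Polynomial.X * MvPolynomial.X i ^ 2 else 0

/-- The equation of the fibre `X_{k,t}`. -/
def quad (n k : ℕ) (t : ℂ) : MvPolynomial (Fin n) ℂ :=
  MvPolynomial.map (Polynomial.evalRingHom t) (famPoly n k)

/-- The tangent space at `([x], t)` of the total space `𝔛_k ⊂ ℙⁿ⁻¹ × ℂ`, inside
`x^⊥ × ℂ ≅ T (ℙⁿ⁻¹ × ℂ)`; the term `τ x_k²` is the derivative of the equation in `t`. -/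
def totalTangent {n : ℕ} (k : ℕ) (x : E n) (t : ℂ) : Set (E n × ℂ) :=
  {V | inner ℂ x V.1 = 0 ∧ dPoly (quad n k t) x V.1 + V.2 * coord x (k - 1) ^ 2 = 0}

/-- The Kähler metric of `ℙⁿ⁻¹ × ℂ`: the one of `lam • ω_FS` plus the standard one. -/
def totalMetric {n : ℕ} (lam : ℝ) (x : E n) (V W : E n × ℂ) : ℝ :=
  fsMetric lam x V.1 W.1 + (star V.2 * W.2).re

/-- `G` is the gradient at `([x], t)` of the real part of the projection `f : 𝔛_k → ℂ`. -/
def IsGradRe {n : ℕ} (lam : ℝ) (k : ℕ) (x : E n) (t : ℂ) (G : E n × ℂ) : Prop :=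
  G ∈ totalTangent k x t ∧ ∀ W ∈ totalTangent k x t, totalMetric lam x G W = W.2.re

/-- `V` is the gradient-Hamiltonian vector `-∇(Re f) / |∇(Re f)|²` at `([x], t)` of
`f : 𝔛_k → ℂ`. -/
def IsGradHam {n : ℕ} (lam : ℝ) (k : ℕ) (x : E n) (t : ℂ) (V : E n × ℂ) : Prop :=
  ∃ G, IsGradRe lam k x t G ∧ G ≠ 0 ∧ V = (-(totalMetric lam x G G)⁻¹) • G

/-- `s ↦ (c s, 1 - s)`, `0 ≤ s ≤ 1`, is an integral curve, through regular points of the fibres,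
of the gradient-Hamiltonian vector field of `𝔛_k`.  The curve `y` is a lift of `c` to
homogeneous coordinates, and the velocity of `c` is the component of `y'` in `y^⊥`. -/
def IsGradHamCurve {n : ℕ} (lam : ℝ) (k : ℕ) (c : ℝ → PSpace n) : Prop :=
  ∃ y y' : ℝ → E n, ∀ s ∈ Set.Icc (0 : ℝ) 1,
    IsRep (c s) (y s) ∧ c s ∈ regLocus (quad n k ((1 - s : ℝ) : ℂ)) ∧
    HasDerivWithinAt y (y' s) (Set.Icc 0 1) s ∧
    IsGradHam lam k (y s) ((1 - s : ℝ) : ℂ)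
      (y' s - (inner ℂ (y s) (y' s) / (‖y s‖ : ℂ) ^ 2) • y s, -1)

/-- `φ` is the gradient-Hamiltonian flow of the family `𝔛_k` along the path from `t = 1` to
`t = 0`, defined on the open dense subset `U` of `X_{k,1}` of the points that it carries to
regular points of `X_{k,0}`.  For every `s` it identifies `U`, with its symplectic form and the
functions `Φ_k`, with an open dense subset of `X_{k,1-s}`, which is the whole regular locus if
`s = 1`. -/
structure IsStageFlow {n : ℕ} (lam : ℝ) (k : ℕ) (U : Set (PSpace n))
    (φ : ℝ → PSpace n → PSpace n) : Prop where
  openDense : IsOpenDenseIn (zeroLocus (quad n k 1)) U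
  start : ∀ p ∈ U, φ 0 p = p
  flow : ∀ p ∈ U, IsGradHamCurve lam k fun s => φ s p
  symplecto : ∀ s ∈ Set.Icc (0 : ℝ) 1,
    IsSymplectomorphism lam (quad n k 1) (quad n k ((1 - s : ℝ) : ℂ)) U (φ s '' U) (φ s)
  image_openDense : ∀ s ∈ Set.Icc (0 : ℝ) 1,
    IsOpenDenseIn (zeroLocus (quad n k ((1 - s : ℝ) : ℂ))) (φ s '' U)
  image_end : φ 1 '' U = regLocus (quad n k 0)
  preserves : ∀ s ∈ Set.Icc (0 : ℝ) 1, ∀ p ∈ U, Phi lam k (φ s p) = Phi lam k p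

/-- The composition of the time-one maps of the first `m` stages `k = n, n - 1, …, n - m + 1`. -/
def composedFlow {n : ℕ} (φ : ℕ → ℝ → PSpace n → PSpace n) : ℕ → PSpace n → PSpace n
  | 0 => id
  | m + 1 => fun p => φ (n - m) 1 (composedFlow φ m p)

end

end QuadricGC

open QuadricGC

/-!
Everything is computed in homogeneous coordinates: forms, differentials and maps of projective
space are lifted to the cones over the quadrics (`IsRep`, `lift`). For `m ≤ n` write
`nsq m x = ∑_{i<m} |x_i|²`, `sqs m x = ∑_{i<m} x_i²` and `disc m x = (nsq m x)² - |sqs m x|²`, so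
that `disc m x = 4 ∑_{i<j<m} (Im (x̄_i x_j))²`, which increases with `m` (`disc_mono`).

**The functions.** Up to a factor, `μ_{SO(k)}(x)` is the wedge product of the real and the
imaginary part of `(x_1, …, x_k)`. Hence it has rank at most two, and the Plücker relation leaves
room for only one nonzero entry in a conjugate point of the Weyl chamber
(`IsChamberPoint.of_wedge`); such a point exists by Gram-Schmidt (`exists_isChamberPoint_wedge`).
Comparing the sums of the squares of the entries gives `λ_1^{(k)} = λ √(disc k x) / ‖x‖²` for
`k ≥ 3` (`gcFun_one`). On `X_{k,0}` the sum `sqs (k-1)` vanishes, so `disc (k-1) = nsq (k-1) ^ 2`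
and `λ_1^{(k-1)} = ν_{k-1}`: this is why `Φ_k = Φ_{k-1}` there (`Phi_succ_eq`).

**The integrable systems.** Each function of `Φ_k` has an explicit Hamiltonian vector `gen k m`,
tangent to every fibre `X_{k,t}` (`bil_gen`) and supported on the first `m` coordinates. The
vectors are mutually orthogonal for the symplectic form (`im_inner_gen_gen`), and their triangular
shape makes them independent at the points with nonzero coordinates and `Im (x̄_1 x_2) ≠ 0`
(`gen_independent`). Such points are dense in every fibre: one condition after the other is reached
by rotating two coordinates into each other (`mem_closure_generic`). The family is flat because its
equation has content one, so that the coordinate ring has no torsion over the principal ideal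
domain `ℂ[t]` (`flat_famPoly`).

**The toric variety.** In suitable coordinates `X_{3,1}` is `z² = uv`, whose coordinate ring is a
direct summand of a polynomial ring (substitute `u = s²`, `v = r²`, `z = sr`), hence integrally
closed (`quad_three_one_normal`). The torus acts diagonally in a unitary basis and is large enough
to realize all diagonal symmetries of the equation up to scalars (`exists_torusChar_eq`); the
infinitesimal generators of its compact part are the Hamiltonian vectors of `Φ_3`.

**The gradient-Hamiltonian flow.** It is found in closed form. With `m = k - 1`, let `a` be the
vector of the first `m` coordinates, `c` the next one and `S = nsq m + t² |c|²`. On the cones over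
the fibres the flow lines are the solutions of `dy/dt = -(c² / (2S)) · dualVec`, with `dualVec` the
vector dual to the differential of the equation; `isGradHam_dualVec` compares this with the
gradient of `Re f`. The solution that starts at a regular point of `X_{k,0}` is
`a ↦ C a - h c² ā`, `c ↦ κ c`, the other coordinates being constant, where `C`, `h`, `κ` are
explicit functions of `t`, `nsq m` and `|c|²` (`flowMap`, `hasDerivAt_flowMap`). Since
`C² - h² |c|⁴ = 1`, all the numbers `Im (x̄_i x_j)` with `i, j < m` are constant along it, and so
are `|a|² + |c|²` and the other norms: hence `Φ_k` is constant (`num_flowMap`). The inverse is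
equally explicit (`backMap`); it is defined where `disc m > 0`, the dense set `U_k` of the theorem.

The flow is symplectic by the variational equation: if `V`, `W` are transported tangent vectors,
symmetry of second derivatives gives `V' = -(c² / (2S)) · dualVec(V) + β · dualVec(y)`
(`hasDerivAt_fderiv_flowMap`), from which `⟨V, y⟩` and `Im ⟨V, W⟩` are constant because `V`, `W`
and `y` stay tangent to the cones (`fsForm_fderiv_flowMap`).

**The stages.** The map `φ_{k,s}` follows the flow lines from `X_{k,1}` down to `X_{k,0}` and up
again to `X_{k,1-s}` (`stageMap`). It preserves `disc j` for `j ≤ k - 1`, so it carries the set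
`disc j > 0` of one fibre onto that of the other. For `j = k - 1` and `s = 1` the image is the
regular locus of `X_{k,0}` (`regLocus_eq_discLocus`). For `j = 3` the sets `disc 3 > 0` are
matched by all stages at once, and the last one of them is the regular locus of `X_{3,1}`; this is
why the compositions are symplectomorphisms of `W = {disc 3 > 0}` onto dense open sets.
-/

namespace QuadricGC

noncomputable section

/-! ### Homogeneous coordinates and the quotient topology -/

lemma isRep_rep {n : ℕ} (p : PSpace n) : IsRep p p.rep := ⟨p.rep_nonzero, p.mk_rep⟩

lemma isRep_mk {n : ℕ} {x : E n} (hx : x ≠ 0) : IsRep (Projectivization.mk ℂ x hx) x := ⟨hx, rfl⟩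

lemma IsRep.ne_zero {n : ℕ} {p : PSpace n} {x : E n} (h : IsRep p x) : x ≠ 0 := h.1

lemma IsRep.eq {n : ℕ} {p q : PSpace n} {x : E n} (h : IsRep p x) (h' : IsRep q x) : p = q := by
  obtain ⟨h1, rfl⟩ := h
  obtain ⟨h2, rfl⟩ := h'
  rfl

lemma IsRep.exists_smul {n : ℕ} {p : PSpace n} {x y : E n} (h : IsRep p x) (h' : IsRep p y) :
    ∃ c : ℂ, c ≠ 0 ∧ y = c • x := by
  obtain ⟨h1, rfl⟩ := h
  obtain ⟨h2, h3⟩ := h'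
  rw [Projectivization.mk_eq_mk_iff'] at h3
  obtain ⟨a, ha⟩ := h3
  refine ⟨a, ?_, ha.symm⟩
  rintro rfl
  exact h2 (by simpa using ha.symm)

lemma IsRep.smul {n : ℕ} {p : PSpace n} {x : E n} (h : IsRep p x) {c : ℂ} (hc : c ≠ 0) :
    IsRep p (c • x) := by
  obtain ⟨h1, rfl⟩ := h
  refine ⟨smul_ne_zero hc h1, ?_⟩
  rw [Projectivization.mk_eq_mk_iff']
  exact ⟨c, rfl⟩

/-- A quantity that is constant on punctured lines may be computed at any representative. -/
lemma IsRep.apply_rep {n : ℕ} {α : Sort*} {F : E n → α}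
    (hF : ∀ (c : ℂ) (x : E n), c ≠ 0 → F (c • x) = F x)
    {p : PSpace n} {x : E n} (h : IsRep p x) : F p.rep = F x := by
  obtain ⟨c, hc, hcx⟩ := h.exists_smul (isRep_rep p)
  rw [hcx, hF c x hc]

lemma lift_apply {n : ℕ} (f : PSpace n → ℝ) {p : PSpace n} {x : E n} (h : IsRep p x) :
    lift f x = f p := by
  obtain ⟨hx, rfl⟩ := h
  simp [lift, hx]

lemma isOpen_iff_affine {n : ℕ} {O : Set (PSpace n)} :
    IsOpen O ↔ IsOpen {x : E n | ∃ p ∈ O, IsRep p x} := by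
  have h : {x : E n | ∃ p ∈ O, IsRep p x} = Subtype.val ''
      ((fun v : { v : E n // v ≠ 0 } => Projectivization.mk' ℂ v) ⁻¹' O) := by
    ext x
    constructor
    · rintro ⟨p, hp, hx, rfl⟩
      exact ⟨⟨x, hx⟩, hp, rfl⟩
    · rintro ⟨v, hv, rfl⟩
      exact ⟨_, hv, v.2, rfl⟩
  have ho : IsOpen {v : E n | v ≠ 0} := isOpen_ne
  rw [h]
  exact isOpen_coinduced.trans (ho.isOpenEmbedding_subtypeVal.isOpen_iff_image_isOpen)

/-- A subset of projective space cut out by an open condition on homogeneous coordinates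
is open. -/
lemma isOpen_setOf_rep {n : ℕ} {G : E n → Prop}
    (hG : ∀ (c : ℂ) (x : E n), c ≠ 0 → G (c • x) = G x) (ho : IsOpen {x | G x}) :
    IsOpen {p : PSpace n | G p.rep} := by
  rw [isOpen_iff_affine]
  have : {x : E n | ∃ p ∈ {p : PSpace n | G p.rep}, IsRep p x} = {x | G x} ∩ {x | x ≠ 0} := by
    ext x
    constructor
    · rintro ⟨p, hp, hx⟩
      exact ⟨by simpa [hx.apply_rep hG] using hp, hx.ne_zero⟩
    · rintro ⟨hx, hx0⟩
      refine ⟨_, ?_, isRep_mk hx0⟩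
      simpa [(isRep_mk hx0).apply_rep hG] using hx
  rw [this]
  exact ho.inter isOpen_ne

lemma continuous_of_affine {n : ℕ} {Y : Type*} [TopologicalSpace Y] {f : PSpace n → Y}
    {F : E n → Y} (hF : ∀ p x, IsRep p x → f p = F x) (hc : ContinuousOn F {x | x ≠ 0}) :
    Continuous f := by
  rw [continuous_coinduced_dom]
  have : f ∘ (fun v : { v : E n // v ≠ 0 } => Projectivization.mk' ℂ v) =
      Set.domRestrict {x : E n | x ≠ 0} F := by
    ext v
    exact hF _ _ ⟨v.2, rfl⟩
  rw [this]
  exact hc.domRestrict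

/-- The points of an open subset of projective space have open preimage near each
representative. -/
lemma eventually_mem_of_isOpen {n : ℕ} {O : Set (PSpace n)} (ho : IsOpen O) {p : PSpace n}
    (hp : p ∈ O) {x : E n} (hx : IsRep p x) : ∀ᶠ y in 𝓝 x, ∀ q, IsRep q y → q ∈ O := by
  filter_upwards [(isOpen_iff_affine.1 ho).mem_nhds ⟨p, hp, hx⟩] with y hy q hq
  obtain ⟨q', hq', h⟩ := hy
  rwa [hq.eq h]

/-! ### The quadrics of the families -/

/-- The coefficient of `x_i²` in the equation of `X_{k,t}`. -/
def wt {n : ℕ} (k : ℕ) (t : ℂ) (i : Fin n) : ℂ :=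
  if (i : ℕ) + 1 < k then 1 else if (i : ℕ) + 1 = k then t else 0

/-- The symmetric bilinear form of the quadric `X_{k,t}`. -/
def bil {n : ℕ} (k : ℕ) (t : ℂ) (x y : E n) : ℂ := ∑ i, wt k t i * (x i * y i)

lemma quad_eq (n k : ℕ) (t : ℂ) :
    quad n k t = ∑ i : Fin n, MvPolynomial.C (wt k t i) * MvPolynomial.X i ^ 2 := by
  simp only [quad, famPoly, map_sum, wt]
  refine Finset.sum_congr rfl fun i _ => ?_
  split_ifs <;> simp

lemma eval_quad {n : ℕ} (k : ℕ) (t : ℂ) (x : E n) :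
    MvPolynomial.eval (fun i => x i) (quad n k t) = bil k t x x := by
  simp [quad_eq, bil, pow_two]

lemma dPoly_quad {n : ℕ} (k : ℕ) (t : ℂ) (x v : E n) :
    dPoly (quad n k t) x v = 2 * bil k t x v := by
  simp only [dPoly, LinearMap.coe_mk, AddHom.coe_mk, quad_eq, bil, Finset.mul_sum]
  refine Finset.sum_congr rfl fun i _ => ?_
  simp only [map_sum, MvPolynomial.pderiv_mul, MvPolynomial.pderiv_C, MvPolynomial.pderiv_pow,
    MvPolynomial.pderiv_X]
  rw [Finset.sum_eq_single i]
  · simp; ring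
  · intro j _ hj
    simp [hj.symm]
  · simp

lemma mem_cone_quad {n k : ℕ} {t : ℂ} {x : E n} :
    x ∈ cone (quad n k t) ↔ x ≠ 0 ∧ bil k t x x = 0 := by
  rw [cone, Set.mem_ofPred_eq, eval_quad]

lemma bil_comm {n : ℕ} (k : ℕ) (t : ℂ) (x y : E n) : bil k t x y = bil k t y x :=
  Finset.sum_congr rfl fun i _ => by ring

lemma bil_add_right {n : ℕ} (k : ℕ) (t : ℂ) (x y z : E n) :
    bil k t x (y + z) = bil k t x y + bil k t x z := by
  simp [bil, mul_add, Finset.sum_add_distrib]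

lemma bil_smul_right {n : ℕ} (k : ℕ) (t c : ℂ) (x y : E n) :
    bil k t x (c • y) = c * bil k t x y := by
  simp only [bil, Finset.mul_sum, PiLp.smul_apply, smul_eq_mul]
  exact Finset.sum_congr rfl fun i _ => by ring

lemma bil_add_left {n : ℕ} (k : ℕ) (t : ℂ) (x y z : E n) :
    bil k t (x + y) z = bil k t x z + bil k t y z := by
  rw [bil_comm, bil_add_right, bil_comm, bil_comm k t z y]

lemma bil_smul_left {n : ℕ} (k : ℕ) (t c : ℂ) (x y : E n) :
    bil k t (c • x) y = c * bil k t x y := by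
  rw [bil_comm, bil_smul_right, bil_comm]

lemma smul_mem_cone {n k : ℕ} {t c : ℂ} (hc : c ≠ 0) {x : E n} (hx : x ∈ cone (quad n k t)) :
    c • x ∈ cone (quad n k t) := by
  rw [mem_cone_quad] at hx ⊢
  exact ⟨smul_ne_zero hc hx.1, by rw [bil_smul_left, bil_smul_right, hx.2]; simp⟩

lemma IsRep.mem_zeroLocus_iff {n k : ℕ} {t : ℂ} {p : PSpace n} {x : E n} (h : IsRep p x) :
    p ∈ zeroLocus (quad n k t) ↔ x ∈ cone (quad n k t) := by
  refine ⟨fun hp => hp x h, fun hx y hy => ?_⟩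
  obtain ⟨c, hc, rfl⟩ := h.exists_smul hy
  exact smul_mem_cone hc hx

lemma dPoly_quad_smul {n k : ℕ} {t : ℂ} (c : ℂ) (x : E n) :
    dPoly (quad n k t) (c • x) = c • dPoly (quad n k t) x := by
  ext v
  simp [dPoly_quad, bil_smul_left]; ring

lemma IsRep.mem_regLocus_iff {n k : ℕ} {t : ℂ} {p : PSpace n} {x : E n} (h : IsRep p x) :
    p ∈ regLocus (quad n k t) ↔ x ∈ cone (quad n k t) ∧ dPoly (quad n k t) x ≠ 0 := by
  rw [regLocus, Set.mem_ofPred_eq, h.mem_zeroLocus_iff]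
  refine and_congr_right fun _ => ⟨fun hp => hp x h, fun hx y hy => ?_⟩
  obtain ⟨c, hc, rfl⟩ := h.exists_smul hy
  rw [dPoly_quad_smul]
  exact smul_ne_zero hc hx

lemma dPoly_self {n k : ℕ} {t : ℂ} {x : E n} (hx : x ∈ cone (quad n k t)) :
    dPoly (quad n k t) x x = 0 := by
  rw [dPoly_quad, (mem_cone_quad.1 hx).2, mul_zero]

lemma mem_tangent_iff {n : ℕ} {P : MvPolynomial (Fin n) ℂ} {x v : E n} :
    v ∈ tangent P x ↔ inner ℂ x v = 0 ∧ dPoly P x v = 0 := by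
  rw [tangent, Submodule.mem_inf, Submodule.mem_orthogonal_singleton_iff_inner_right,
    LinearMap.mem_ker]

/-- A point with a nonzero coordinate that occurs in the equation is regular. -/
lemma dPoly_quad_ne_zero {n k : ℕ} {t : ℂ} {x : E n} (i : Fin n) (hi : wt k t i ≠ 0)
    (hx : x i ≠ 0) : dPoly (quad n k t) x ≠ 0 := by
  intro h
  have h1 := LinearMap.congr_fun h (EuclideanSpace.single i 1)
  rw [dPoly_quad, bil, Finset.sum_eq_single i] at h1
  · simp [hi, hx] at h1
  · intro j _ hj
    simp [hj]
  · simp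

lemma finrank_tangent {n k : ℕ} {t : ℂ} {x : E n} (hx : x ∈ cone (quad n k t))
    (hd : dPoly (quad n k t) x ≠ 0) : Module.finrank ℂ (tangent (quad n k t) x) = n - 2 := by
  let f : E n →ₗ[ℂ] ℂ × ℂ :=
    LinearMap.prod (innerSL ℂ x : E n →L[ℂ] ℂ).toLinearMap (dPoly (quad n k t) x)
  have hker : LinearMap.ker f = tangent (quad n k t) x := by
    ext v
    rw [mem_tangent_iff]
    simp [f]
  obtain ⟨u, hu⟩ : ∃ u, dPoly (quad n k t) x u ≠ 0 := by
    by_contra! h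
    exact hd (LinearMap.ext h)
  have hxx : inner ℂ x x ≠ (0 : ℂ) := inner_self_ne_zero.2 hx.1
  have hrange : LinearMap.range f = ⊤ := by
    rw [LinearMap.range_eq_top]
    rintro ⟨a, b⟩
    refine ⟨((a - b / dPoly (quad n k t) x u * inner ℂ x u) / inner ℂ x x) • x +
      (b / dPoly (quad n k t) x u) • u, ?_⟩
    refine Prod.ext ?_ ?_
    · change inner ℂ x _ = a
      rw [inner_add_right, inner_smul_right, inner_smul_right]
      field_simp
      ring
    · change dPoly (quad n k t) x _ = b
      rw [map_add, map_smul, map_smul, dPoly_self hx, smul_zero, smul_eq_mul, zero_add]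
      field_simp
  have h := LinearMap.finrank_range_add_finrank_ker f
  rw [hrange, hker, finrank_top, Module.finrank_prod, Module.finrank_self,
    finrank_euclideanSpace_fin] at h
  omega

/-! ### Hermitian algebra in homogeneous coordinates -/

/-- Complex conjugation of the homogeneous coordinates. -/
def cj {n : ℕ} (x : E n) : E n := WithLp.toLp 2 fun i => star (x i)

/-- The truncation of a vector to its first `m` coordinates. -/
def trunc {n : ℕ} (m : ℕ) (x : E n) : E n := WithLp.toLp 2 fun i => if (i : ℕ) < m then x i else 0

/-- The squared norm of the first `m` coordinates. -/
def nsq {n : ℕ} (m : ℕ) (x : E n) : ℝ := ∑ i : Fin n, if (i : ℕ) < m then ‖x i‖ ^ 2 else 0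

/-- The sum of the squares of the first `m` coordinates. -/
def sqs {n : ℕ} (m : ℕ) (x : E n) : ℂ := bil (m + 1) 0 x x

/-- The Gram discriminant `(∑_{i<m} |x_i|²)² - |∑_{i<m} x_i²|²`. It is four times the Gram
determinant of the real and imaginary parts of the first `m` coordinates. -/
def disc {n : ℕ} (m : ℕ) (x : E n) : ℝ := nsq m x ^ 2 - ‖sqs m x‖ ^ 2

@[simp] lemma cj_apply {n : ℕ} (x : E n) (i : Fin n) : cj x i = star (x i) := rfl

@[simp] lemma trunc_apply {n : ℕ} (m : ℕ) (x : E n) (i : Fin n) :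
    trunc m x i = if (i : ℕ) < m then x i else 0 := rfl

lemma inner_eq_sum {n : ℕ} (x y : E n) : inner ℂ x y = ∑ i, star (x i) * y i := by
  simp [PiLp.inner_apply, mul_comm]

lemma wt_zero {n : ℕ} (m : ℕ) (i : Fin n) : wt (m + 1) 0 i = if (i : ℕ) < m then 1 else 0 := by
  simp [wt]

lemma inner_trunc_right {n : ℕ} (m : ℕ) (x y : E n) :
    inner ℂ x (trunc m y) = bil (m + 1) 0 (cj x) y := by
  rw [inner_eq_sum, bil]
  refine Finset.sum_congr rfl fun i _ => ?_
  rw [wt_zero]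
  simp

lemma nsq_eq_bil {n : ℕ} (m : ℕ) (x : E n) : (nsq m x : ℂ) = bil (m + 1) 0 (cj x) x := by
  rw [nsq, bil]
  push_cast
  refine Finset.sum_congr rfl fun i _ => ?_
  rw [wt_zero]
  split_ifs
  · rw [one_mul, cj_apply, Complex.ofReal_pow]
    exact (Complex.conj_mul' (x i)).symm
  · simp

lemma bil_cj_cj {n : ℕ} (k : ℕ) (t : ℝ) (x y : E n) :
    bil k t (cj x) (cj y) = star (bil k t x y) := by
  simp only [bil, star_sum, star_mul', cj_apply]
  refine Finset.sum_congr rfl fun i _ => ?_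
  congr 1
  simp only [wt]
  split_ifs <;> simp

lemma bil_zero_cj_cj {n : ℕ} (k : ℕ) (x y : E n) :
    bil k 0 (cj x) (cj y) = star (bil k 0 x y) := by
  simpa using bil_cj_cj k 0 x y

@[simp] lemma cj_cj {n : ℕ} (x : E n) : cj (cj x) = x := by
  ext i; simp

lemma nsq_nonneg {n : ℕ} (m : ℕ) (x : E n) : 0 ≤ nsq m x :=
  Finset.sum_nonneg fun i _ => by split_ifs <;> positivity

lemma norm_sq_eq {n : ℕ} (x : E n) : ‖x‖ ^ 2 = ∑ i, ‖x i‖ ^ 2 :=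
  EuclideanSpace.norm_sq_eq x

lemma nsq_smul {n : ℕ} (m : ℕ) (c : ℂ) (x : E n) : nsq m (c • x) = ‖c‖ ^ 2 * nsq m x := by
  rw [nsq, nsq, Finset.mul_sum]
  refine Finset.sum_congr rfl fun i _ => ?_
  split_ifs
  · simp [mul_pow]
  · simp

lemma sqs_smul {n : ℕ} (m : ℕ) (c : ℂ) (x : E n) : sqs m (c • x) = c ^ 2 * sqs m x := by
  rw [sqs, sqs, bil_smul_left, bil_smul_right]; ring

lemma disc_smul {n : ℕ} (m : ℕ) (c : ℂ) (x : E n) : disc m (c • x) = ‖c‖ ^ 4 * disc m x := by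
  rw [disc, disc, nsq_smul, sqs_smul, norm_mul, norm_pow]; ring

/-- Lagrange's identity. -/
lemma disc_eq_sum {n : ℕ} (m : ℕ) (x : E n) :
    disc m x = 2 * ∑ i : Fin n, ∑ j : Fin n,
      if (i : ℕ) < m ∧ (j : ℕ) < m then (star (x i) * x j).im ^ 2 else 0 := by
  have h1 : nsq m x ^ 2 = ∑ i : Fin n, ∑ j : Fin n,
      if (i : ℕ) < m ∧ (j : ℕ) < m then ‖x i‖ ^ 2 * ‖x j‖ ^ 2 else 0 := by
    rw [pow_two, nsq, Finset.sum_mul_sum]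
    refine Finset.sum_congr rfl fun i _ => Finset.sum_congr rfl fun j _ => ?_
    by_cases hi : (i : ℕ) < m <;> by_cases hj : (j : ℕ) < m <;> simp [hi, hj]
  have h2 : ‖sqs m x‖ ^ 2 = ∑ i : Fin n, ∑ j : Fin n,
      if (i : ℕ) < m ∧ (j : ℕ) < m then ((star (x i) * x j) ^ 2).re else 0 := by
    have : ((‖sqs m x‖ ^ 2 : ℝ) : ℂ) = star (sqs m x) * sqs m x := by
      push_cast; exact (Complex.conj_mul' _).symm
    rw [← Complex.ofReal_re (‖sqs m x‖ ^ 2), this, sqs, bil, star_sum, Finset.sum_mul_sum,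
      Complex.re_sum]
    refine Finset.sum_congr rfl fun i _ => ?_
    rw [Complex.re_sum]
    refine Finset.sum_congr rfl fun j _ => ?_
    rw [wt_zero, wt_zero]
    by_cases hi : (i : ℕ) < m <;> by_cases hj : (j : ℕ) < m <;>
      simp [hi, hj, pow_two]
    ring
  rw [disc, h1, h2, ← Finset.sum_sub_distrib, Finset.mul_sum]
  refine Finset.sum_congr rfl fun i _ => ?_
  rw [← Finset.sum_sub_distrib, Finset.mul_sum]
  refine Finset.sum_congr rfl fun j _ => ?_
  split_ifs
  · rw [← Complex.normSq_eq_norm_sq, ← Complex.normSq_eq_norm_sq]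
    simp [Complex.normSq_apply, pow_two]
    ring
  · simp

lemma disc_nonneg {n : ℕ} (m : ℕ) (x : E n) : 0 ≤ disc m x := by
  rw [disc_eq_sum]
  refine mul_nonneg zero_le_two (Finset.sum_nonneg fun i _ => Finset.sum_nonneg fun j _ => ?_)
  split_ifs <;> positivity

lemma disc_mono {n : ℕ} {m m' : ℕ} (h : m ≤ m') (x : E n) : disc m x ≤ disc m' x := by
  rw [disc_eq_sum, disc_eq_sum]
  refine mul_le_mul_of_nonneg_left
    (Finset.sum_le_sum fun i _ => Finset.sum_le_sum fun j _ => ?_) zero_le_two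
  split_ifs
  · exact le_rfl
  · omega
  · positivity
  · exact le_rfl

lemma disc_two {n : ℕ} (hn : 2 ≤ n) (x : E n) :
    disc 2 x = (2 * (star (x ⟨0, by omega⟩) * x ⟨1, by omega⟩).im) ^ 2 := by
  obtain ⟨n, rfl⟩ := Nat.exists_eq_add_of_le' hn
  rw [disc_eq_sum]
  simp [Fin.sum_univ_succ]
  ring

lemma nsq_pos_of_disc_pos {n m : ℕ} {x : E n} (h : 0 < disc m x) : 0 < nsq m x := by
  refine lt_of_le_of_ne (nsq_nonneg m x) fun h0 => ?_
  rw [disc, ← h0] at h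
  have := sq_nonneg ‖sqs m x‖
  linarith

lemma norm_sqs_lt {n m : ℕ} {x : E n} (h : 0 < disc m x) : ‖sqs m x‖ < nsq m x := by
  rw [disc] at h
  exact lt_of_pow_lt_pow_left₀ 2 (nsq_nonneg m x) (by linarith)

/-! ### The Fubini-Study form -/

lemma inner_self_eq {n : ℕ} (x : E n) : inner ℂ x x = (‖x‖ : ℂ) ^ 2 := inner_self_eq_norm_sq_to_K x

lemma fsForm_add_smul {n : ℕ} (lam : ℝ) (x v w : E n) (a b : ℂ) :
    fsForm lam x (v + a • x) (w + b • x) = fsForm lam x v w := by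
  rw [fsForm, fsForm]
  congr 2
  simp only [inner_add_left, inner_add_right, inner_smul_left, inner_smul_right, inner_self_eq]
  ring

lemma fsForm_self_I {n : ℕ} (lam : ℝ) {x v : E n} (hv : inner ℂ x v = 0) :
    fsForm lam x (Complex.I • v) v = -(2 * lam / ‖x‖ ^ 4 * (‖x‖ ^ 2 * ‖v‖ ^ 2)) := by
  rw [fsForm, inner_smul_left, hv, mul_zero, sub_zero, inner_self_eq]
  rw [← mul_neg]
  congr 1
  simp [← Complex.ofReal_pow]

lemma fsForm_sum_right {n : ℕ} {ι : Type*} (lam : ℝ) (x v : E n) (s : Finset ι) (c : ι → ℝ)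
    (w : ι → E n) : fsForm lam x v (∑ i ∈ s, c i • w i) = ∑ i ∈ s, c i * fsForm lam x v (w i) := by
  classical
  induction s using Finset.induction_on with
  | empty => simp [fsForm]
  | insert a s ha ih =>
    rw [Finset.sum_insert ha, Finset.sum_insert ha, ← ih]
    simp only [fsForm, inner_add_right, ← Complex.coe_smul, inner_smul_right]
    rw [mul_left_comm, ← mul_add]
    congr 1
    rw [← Complex.im_ofReal_mul, ← Complex.add_im]
    congr 1
    ring

/-- A function `lam • G / ‖x‖²` with `dG = 2 Im⟨·, v⟩`, where `G` satisfies the Euler-type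
identity `⟨x, v⟩ = √-1 G(x)`, has Hamiltonian vector `v`. -/
lemma hasFDerivAt_moment {n : ℕ} (lam : ℝ) {f : PSpace n → ℝ} {G : E n → ℝ}
    (hf : ∀ p y, IsRep p y → f p = lam * G y / ‖y‖ ^ 2) {x v : E n} (hx : x ≠ 0)
    (hG : ∃ G' : E n →L[ℝ] ℝ, HasFDerivAt G G' x ∧ ∀ w, G' w = 2 * (inner ℂ w v).im)
    (hv : inner ℂ x v = Complex.I * G x) :
    ∃ L : E n →L[ℝ] ℝ, HasFDerivAt (lift f) L x ∧ ∀ w, L w = fsForm lam x w v := by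
  obtain ⟨G', hG', h1⟩ := hG
  have hx' : ‖x‖ ≠ 0 := norm_ne_zero_iff.2 hx
  have h2 : HasFDerivAt (fun y : E n => ‖y‖ ^ 2) (2 • innerSL ℝ x) x :=
    (hasStrictFDerivAt_norm_sq x).hasFDerivAt
  have h3 := ((hG'.const_mul lam).mul ((hasDerivAt_inv (pow_ne_zero 2 hx')).comp_hasFDerivAt x h2))
  refine ⟨_, h3.congr_of_eventuallyEq ?_, fun w => ?_⟩
  · filter_upwards [isOpen_ne.mem_nhds hx] with y hy
    rw [lift_apply f (isRep_mk hy), hf _ _ (isRep_mk hy), div_eq_mul_inv]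
    rfl
  · have hre : inner ℝ x w = (inner ℂ w x).re := by
      rw [inner_eq_sum, PiLp.inner_apply, Complex.re_sum]
      refine Finset.sum_congr rfl fun i _ => ?_
      rw [Complex.inner]
      simp
    have him : (inner ℂ w x * inner ℂ x v).im = (inner ℂ w x).re * G x := by
      rw [hv]; simp
    have him2 : (((‖x‖ : ℝ) : ℂ) ^ 2 * inner ℂ w v).im = ‖x‖ ^ 2 * (inner ℂ w v).im := by
      rw [← Complex.ofReal_pow, Complex.im_ofReal_mul]
    rw [fsForm, Complex.sub_im, him, him2]
    simp [h1, hre]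
    field_simp
    ring

/-! ### Derivatives of the basic quadratic functions -/

lemma hasFDerivAt_bil {n : ℕ} (k : ℕ) (t : ℂ) (x : E n) :
    ∃ L : E n →L[ℝ] ℂ, HasFDerivAt (fun y : E n => bil k t y y) L x ∧
      ∀ w, L w = 2 * bil k t x w := by
  have h : ∀ i : Fin n, HasFDerivAt (fun y : E n => wt k t i * (y i * y i))
      (wt k t i • (x i • ((EuclideanSpace.proj (𝕜 := ℂ) i).restrictScalars ℝ : E n →L[ℝ] ℂ) +
        x i • ((EuclideanSpace.proj (𝕜 := ℂ) i).restrictScalars ℝ : E n →L[ℝ] ℂ))) x := by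
    intro i
    have h1 : HasFDerivAt (fun y : E n => y i)
      ((EuclideanSpace.proj (𝕜 := ℂ) i).restrictScalars ℝ : E n →L[ℝ] ℂ) x :=
      ((EuclideanSpace.proj (𝕜 := ℂ) i).restrictScalars ℝ : E n →L[ℝ] ℂ).hasFDerivAt
    exact (h1.mul h1).const_mul _
  refine ⟨_, HasFDerivAt.fun_sum fun i _ => h i, fun w => ?_⟩
  simp [bil, Finset.mul_sum]
  refine Finset.sum_congr rfl fun i _ => by ring

lemma hasFDerivAt_nsq {n : ℕ} (m : ℕ) (x : E n) :
    ∃ L : E n →L[ℝ] ℝ, HasFDerivAt (fun y : E n => nsq m y) L x ∧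
      ∀ w, L w = 2 * (inner ℂ w (trunc m x)).re := by
  have h : ∀ i : Fin n, HasFDerivAt (fun y : E n => if (i : ℕ) < m then ‖y i‖ ^ 2 else 0)
      (if (i : ℕ) < m then 2 • (innerSL ℝ (x i)).comp
        ((EuclideanSpace.proj (𝕜 := ℂ) i).restrictScalars ℝ : E n →L[ℝ] ℂ) else 0) x := by
    intro i
    have h1 : HasFDerivAt (fun y : E n => y i)
      ((EuclideanSpace.proj (𝕜 := ℂ) i).restrictScalars ℝ : E n →L[ℝ] ℂ) x :=
      ((EuclideanSpace.proj (𝕜 := ℂ) i).restrictScalars ℝ : E n →L[ℝ] ℂ).hasFDerivAt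
    split_ifs
    · exact h1.norm_sq
    · exact hasFDerivAt_const _ _
  refine ⟨_, HasFDerivAt.fun_sum fun i _ => h i, fun w => ?_⟩
  rw [inner_eq_sum, Complex.re_sum, Finset.mul_sum, sum_apply]
  refine Finset.sum_congr rfl fun i _ => ?_
  rw [trunc_apply]
  split_ifs
  · simp [Complex.inner]
    ring
  · simp

lemma contDiff_bil {n : ℕ} (k : ℕ) (t : ℂ) : ContDiff ℝ ∞ (fun y : E n => bil k t y y) := by
  unfold bil
  fun_prop

lemma contDiff_nsq {n : ℕ} (m : ℕ) : ContDiff ℝ ∞ (fun y : E n => nsq m y) := by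
  unfold nsq
  refine ContDiff.sum fun i _ => ?_
  split_ifs
  · exact ContDiff.norm_sq ℝ (by fun_prop)
  · exact contDiff_const

lemma contDiff_sqs {n : ℕ} (m : ℕ) : ContDiff ℝ ∞ (fun y : E n => sqs m y) := contDiff_bil _ _

lemma contDiff_disc {n : ℕ} (m : ℕ) : ContDiff ℝ ∞ (fun y : E n => disc m y) :=
  ((contDiff_nsq m).pow 2).sub ((contDiff_sqs m).norm_sq ℝ)

lemma hasFDerivAt_disc {n : ℕ} (m : ℕ) (x : E n) :
    ∃ L : E n →L[ℝ] ℝ, HasFDerivAt (fun y : E n => disc m y) L x ∧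
      ∀ w, L w = 4 * (inner ℂ w (trunc m ((nsq m x : ℂ) • x - sqs m x • cj x))).re := by
  obtain ⟨L1, h1, h1'⟩ := hasFDerivAt_nsq m x
  obtain ⟨L2, h2, h2'⟩ := hasFDerivAt_bil (m + 1) 0 x
  refine ⟨_, (h1.pow 2).sub h2.norm_sq, fun w => ?_⟩
  have e : bil (m + 1) 0 (cj w) (-sqs m x • cj x) = -(sqs m x * star (bil (m + 1) 0 x w)) := by
    rw [bil_smul_right, bil_zero_cj_cj, bil_comm _ _ w x, neg_mul]
  have e' : inner ℂ w (trunc m ((nsq m x : ℂ) • x - sqs m x • cj x)) =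
      nsq m x * bil (m + 1) 0 (cj w) x - sqs m x * star (bil (m + 1) 0 x w) := by
    rw [inner_trunc_right, sub_eq_add_neg, ← neg_smul, bil_add_right, e, bil_smul_right,
      ← sub_eq_add_neg]
  rw [e']
  simp [h1', h2', Complex.inner, inner_trunc_right]
  simp only [sqs]
  ring

/-! ### The moment map of the special orthogonal group -/

lemma sum_dite_lt {n k : ℕ} (hk : k ≤ n) {M : Type*} [AddCommMonoid M] (f : Fin k → M) :
    (∑ i : Fin n, if h : (i : ℕ) < k then f ⟨i, h⟩ else 0) = ∑ i, f i := by
  obtain ⟨d, rfl⟩ := Nat.exists_eq_add_of_le hk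
  rw [Fin.sum_univ_add]
  simp

lemma coord_of_lt {n i : ℕ} (x : E n) (h : i < n) : coord x i = x ⟨i, h⟩ := by simp [coord, h]

lemma coord_smul {n : ℕ} (c : ℂ) (x : E n) (i : ℕ) : coord (c • x) i = c * coord x i := by
  simp only [coord]; split_ifs <;> simp

lemma coord_add {n : ℕ} (x y : E n) (i : ℕ) : coord (x + y) i = coord x i + coord y i := by
  simp only [coord]; split_ifs <;> simp

lemma muSO_apply {n : ℕ} (lam : ℝ) (k : ℕ) {p : PSpace n} {x : E n} (h : IsRep p x)
    (i j : Fin k) :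
    muSO lam k p i j = lam * (2 * (star (coord x i) * coord x j).im) / ‖x‖ ^ 2 := by
  have key : ∀ y : E n, (Complex.I * lam / (‖y‖ : ℂ) ^ 2 *
      (coord y i * star (coord y j) - star (coord y i) * coord y j)).re =
      lam * (2 * (star (coord y i) * coord y j).im) / ‖y‖ ^ 2 := by
    intro y
    have : Complex.I * lam / (‖y‖ : ℂ) ^ 2 *
      (coord y i * star (coord y j) - star (coord y i) * coord y j) = ((lam / ‖y‖ ^ 2 : ℝ) : ℂ) *
        (Complex.I * (coord y i * star (coord y j) - star (coord y i) * coord y j)) := by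
      push_cast; ring
    rw [this, Complex.re_ofReal_mul]
    simp
    ring
  rw [muSO, Matrix.of_apply, key]
  refine h.apply_rep (F := fun y => lam * (2 * (star (coord y i) * coord y j).im) / ‖y‖ ^ 2) ?_
  intro c y hc
  have hc' : ‖c‖ ≠ 0 := norm_ne_zero_iff.2 hc
  have h2 : star (coord (c • y) i) * coord (c • y) j =
      ((‖c‖ ^ 2 : ℝ) : ℂ) * (star (coord y i) * coord y j) := by
    have := Complex.conj_mul' c
    rw [coord_smul, coord_smul, star_mul']
    push_cast
    rw [← this]
    simp only [starRingEnd_apply]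
    ring
  simp only [h2, Complex.im_ofReal_mul, norm_smul]
  by_cases hy : ‖y‖ = 0
  · simp [hy]
  · field_simp

lemma inner_cornerGen {n k : ℕ} (hk : k ≤ n) (A : Matrix (Fin k) (Fin k) ℝ) (x y : E n) :
    inner ℂ y (cornerGen A x) = ∑ i : Fin k, ∑ j : Fin k,
      (A i j : ℂ) * (star (coord y i) * coord x j) := by
  rw [inner_eq_sum, ← sum_dite_lt hk]
  refine Finset.sum_congr rfl fun i _ => ?_
  simp only [cornerGen]
  split_ifs with h
  · rw [Finset.mul_sum, coord_of_lt y i.2]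
    exact Finset.sum_congr rfl fun j _ => by ring
  · simp

lemma inner_cornerGen_skew {n k : ℕ} (hk : k ≤ n) {A : Matrix (Fin k) (Fin k) ℝ}
    (hA : A.transpose = -A) (x y : E n) :
    inner ℂ y (cornerGen A x) = -inner ℂ (cornerGen A y) x := by
  rw [← inner_conj_symm (cornerGen A y) x, ← RCLike.star_def, inner_cornerGen hk, inner_cornerGen hk,
    star_sum, Finset.sum_comm, ← Finset.sum_neg_distrib]
  refine Finset.sum_congr rfl fun i _ => ?_
  rw [star_sum, ← Finset.sum_neg_distrib]
  refine Finset.sum_congr rfl fun j _ => ?_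
  have h := congrFun (congrFun hA i) j
  rw [Matrix.transpose_apply, Matrix.neg_apply] at h
  rw [h, star_mul', star_mul', star_star]
  push_cast
  simp only [RCLike.star_def, Complex.conj_ofReal]
  ring

/-- The infinitesimal action of `A`, as a continuous linear map. -/
def cornerGenL {n k : ℕ} (A : Matrix (Fin k) (Fin k) ℝ) : E n →L[ℂ] E n :=
  LinearMap.toContinuousLinearMap
    { toFun := cornerGen A
      map_add' := fun x y => by
        ext i
        simp only [cornerGen, PiLp.add_apply, coord_add, mul_add, Finset.sum_add_distrib]
        split_ifs <;> simp
      map_smul' := fun c x => by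
        ext i
        simp only [cornerGen, PiLp.smul_apply, coord_smul, smul_eq_mul, RingHom.id_apply]
        split_ifs
        · rw [Finset.mul_sum]
          exact Finset.sum_congr rfl fun j _ => by ring
        · simp }

lemma sum_upper_skew {k : ℕ} {A B : Matrix (Fin k) (Fin k) ℝ}
    (hA : A.transpose = -A) (hB : B.transpose = -B) :
    2 * (∑ i, ∑ j, if i < j then A i j * B i j else 0) = ∑ i, ∑ j, A i j * B i j := by
  have hA' : ∀ i j, A j i = -A i j := fun i j => congrFun (congrFun hA i) j
  have hB' : ∀ i j, B j i = -B i j := fun i j => congrFun (congrFun hB i) j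
  have h : ∀ i j, A i j * B i j = (if i < j then A i j * B i j else 0) +
      if j < i then A j i * B j i else 0 := by
    intro i j
    rcases lt_trichotomy i j with h | h | h
    · simp [h, h.not_gt]
    · subst h
      have := hA' i i
      have h0 : A i i = 0 := by linarith
      simp [h0]
    · simp only [h, h.not_gt, if_true, if_false, zero_add, hA' i j, hB' i j, neg_mul_neg]
  rw [Finset.sum_congr rfl fun i _ => Finset.sum_congr rfl fun j _ => h i j]
  simp_rw [Finset.sum_add_distrib]
  rw [two_mul]
  congr 1
  exact Finset.sum_comm

lemma muSO_transpose {n : ℕ} (lam : ℝ) (k : ℕ) (p : PSpace n) :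
    (muSO lam k p).transpose = -muSO lam k p := by
  ext i j
  rw [Matrix.transpose_apply, Matrix.neg_apply, muSO_apply lam k (isRep_rep p),
    muSO_apply lam k (isRep_rep p), ← neg_div, ← mul_neg, ← mul_neg]
  congr 3
  simp
  ring

lemma coord_cornerAct {n k : ℕ} (hk : k ≤ n) (g : Matrix (Fin k) (Fin k) ℝ) (x : E n)
    (i : Fin k) : coord (cornerAct g x) i = ∑ j : Fin k, (g i j : ℂ) * coord x j := by
  rw [coord_of_lt _ (i.2.trans_le hk)]
  simp [cornerAct]

lemma norm_cornerAct {n k : ℕ} (hk : k ≤ n) {g : Matrix (Fin k) (Fin k) ℝ}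
    (hg : g.transpose * g = 1) (x : E n) : ‖cornerAct g x‖ ^ 2 = ‖x‖ ^ 2 := by
  have hs : ∀ y : E n, ‖y‖ ^ 2 = (∑ i : Fin k, ‖coord y i‖ ^ 2) +
      ∑ i : Fin n, if (i : ℕ) < k then 0 else ‖y i‖ ^ 2 := by
    intro y
    rw [norm_sq_eq, ← sum_dite_lt hk, ← Finset.sum_add_distrib]
    refine Finset.sum_congr rfl fun i _ => ?_
    by_cases h : (i : ℕ) < k
    · simp [h, coord_of_lt y i.2]
    · simp [h]
  rw [hs, hs x]
  congr 1
  · have h : (g.map Complex.ofRealHom).transpose * g.map Complex.ofRealHom = 1 := by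
      rw [← Matrix.transpose_map, ← Matrix.map_mul, hg]
      exact Matrix.map_one _ (map_zero _) (map_one _)
    have hsq : ∀ z : Fin k → ℂ, ((∑ i, ‖z i‖ ^ 2 : ℝ) : ℂ) = dotProduct (star z) z := by
      intro z
      push_cast
      exact Finset.sum_congr rfl fun i _ => (Complex.conj_mul' _).symm
    have hv : (fun i : Fin k => coord (cornerAct g x) i) =
        (g.map Complex.ofRealHom).mulVec fun i : Fin k => coord x i := by
      ext i
      rw [coord_cornerAct hk]
      rfl
    have hct : (g.map Complex.ofRealHom).conjTranspose = (g.map Complex.ofRealHom).transpose := by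
      ext i j; simp
    apply Complex.ofReal_injective
    rw [hsq fun i => coord (cornerAct g x) i, hsq fun i => coord x i, hv, Matrix.star_mulVec,
      hct, Matrix.dotProduct_mulVec, Matrix.vecMul_vecMul, h, Matrix.vecMul_one]
  · refine Finset.sum_congr rfl fun i _ => ?_
    split_ifs with h
    · rfl
    · simp [cornerAct, h]

lemma isMomentMapSO_muSO {n : ℕ} (lam : ℝ) {k : ℕ} (hk : k ≤ n) :
    IsMomentMapSO (n := n) lam k (muSO lam k) := by
  constructor
  · intro g hg p q x hp hq
    have hg' : g.transpose * g = 1 := by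
      have := (Matrix.mem_specialOrthogonalGroup_iff.1 hg).1
      exact (Matrix.mem_orthogonalGroup_iff' _ _).1 this
    ext i j
    rw [muSO_apply lam k hq, norm_cornerAct hk hg', coord_cornerAct hk, coord_cornerAct hk,
      star_sum, Finset.sum_mul_sum, Complex.im_sum, Matrix.mul_apply]
    simp only [Matrix.mul_apply, Matrix.transpose_apply, muSO_apply lam k hp, Complex.im_sum]
    simp only [Finset.mul_sum, Finset.sum_div, Finset.sum_mul]
    rw [Finset.sum_comm]
    refine Finset.sum_congr rfl fun a _ => Finset.sum_congr rfl fun b _ => ?_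
    have : star ((g i b : ℂ) * coord x b) * ((g j a : ℂ) * coord x a) =
      ((g i b * g j a : ℝ) : ℂ) * (star (coord x b) * coord x a) := by
      rw [star_mul']
      push_cast
      simp only [RCLike.star_def, Complex.conj_ofReal]
      ring
    rw [this, Complex.im_ofReal_mul]
    ring
  · intro A hA x hx
    refine hasFDerivAt_moment lam (G := fun y => (inner ℂ y (cornerGen A y)).im) ?_ hx ?_ ?_
    · intro p y hp
      have h := sum_upper_skew hA (muSO_transpose lam k p)
      rw [inner_cornerGen hk, Complex.im_sum]
      have h2 : ∑ i, ∑ j, A i j * muSO lam k p i j = 2 * (lam * (∑ i : Fin k,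
          (∑ j : Fin k, (A i j : ℂ) * (star (coord y i) * coord y j)).im) / ‖y‖ ^ 2) := by
        simp_rw [Complex.im_sum, Complex.im_ofReal_mul, muSO_apply lam k hp]
        simp_rw [Finset.mul_sum, Finset.sum_div, Finset.mul_sum]
        refine Finset.sum_congr rfl fun a _ => Finset.sum_congr rfl fun b _ => ?_
        ring
      linarith
    · have h1 : HasFDerivAt (fun y : E n => y) (ContinuousLinearMap.id ℝ (E n)) x :=
        hasFDerivAt_id x
      have h2 : HasFDerivAt (fun y : E n => cornerGen A y)
          ((cornerGenL A : E n →L[ℂ] E n).restrictScalars ℝ) x :=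
        ((cornerGenL A : E n →L[ℂ] E n).restrictScalars ℝ).hasFDerivAt
      have h3 := h1.inner ℂ h2
      refine ⟨_, Complex.imCLM.hasFDerivAt.comp x h3, fun w => ?_⟩
      have h4 : (cornerGenL A : E n → E n) w = cornerGen A w := rfl
      simp [fderivInnerCLM_apply, h4]
      have h5 : (inner ℂ x (cornerGen A w)).im = (inner ℂ w (cornerGen A x)).im := by
        rw [inner_cornerGen_skew hk hA w x, Complex.neg_im, ← inner_conj_symm, Complex.conj_im,
          neg_neg]
      rw [h5]
      ring
    · have h := inner_cornerGen_skew hk hA x x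
      rw [← inner_conj_symm (cornerGen A x) x] at h
      apply Complex.ext
      · have := congrArg Complex.re h
        rw [Complex.neg_re, Complex.conj_re] at this
        simp
        linarith
      · simp

/-! ### Skew-symmetric matrices of rank two and the Weyl chamber -/

/-- The skew-symmetric matrix `α βᵀ - β αᵀ`. -/
def wedge {k : ℕ} (α β : Fin k → ℝ) : Matrix (Fin k) (Fin k) ℝ :=
  Matrix.vecMulVec α β - Matrix.vecMulVec β α

lemma wedge_apply {k : ℕ} (α β : Fin k → ℝ) (i j : Fin k) :
    wedge α β i j = α i * β j - β i * α j := by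
  simp [wedge, Matrix.vecMulVec_apply]

lemma conj_wedge {k : ℕ} (g : Matrix (Fin k) (Fin k) ℝ) (α β : Fin k → ℝ) :
    g.transpose * wedge α β * g =
      wedge (g.transpose.mulVec α) (g.transpose.mulVec β) := by
  simp only [wedge, mul_sub, sub_mul, Matrix.mul_vecMulVec, Matrix.vecMulVec_mul,
    Matrix.mulVec_transpose]

/-- The Plücker relation. -/
lemma wedge_plucker {k : ℕ} (α β : Fin k → ℝ) (i j p q : Fin k) :
    wedge α β i j * wedge α β p q - wedge α β i p * wedge α β j q +
      wedge α β i q * wedge α β j p = 0 := by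
  simp only [wedge_apply]; ring

lemma cartanMatrix_even_odd (k : ℕ) (l : Fin (k / 2) → ℝ) (m : Fin (k / 2)) :
    cartanMatrix k l ⟨2 * m, by omega⟩ ⟨2 * m + 1, by omega⟩ = l m := by
  rw [cartanMatrix, Matrix.of_apply, Finset.sum_eq_single m]
  · simp
  · intro b _ hb
    have : (m : ℕ) ≠ b := fun h => hb (Fin.ext h.symm)
    simp only
    split_ifs <;> first | omega | rfl
  · simp

lemma cartanMatrix_eq_zero (k : ℕ) (l : Fin (k / 2) → ℝ) (i j : Fin k)
    (h : (i : ℕ) / 2 ≠ (j : ℕ) / 2) : cartanMatrix k l i j = 0 := by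
  rw [cartanMatrix, Matrix.of_apply]
  refine Finset.sum_eq_zero fun m _ => ?_
  split_ifs <;> first | omega | rfl

lemma cartanMatrix_of_head {k : ℕ} (hk : 2 ≤ k) {l : Fin (k / 2) → ℝ}
    (hl : ∀ m : Fin (k / 2), 1 ≤ (m : ℕ) → l m = 0) :
    cartanMatrix k l = wedge (l ⟨0, by omega⟩ • Pi.single ⟨0, by omega⟩ 1)
      (Pi.single ⟨1, by omega⟩ 1) := by
  ext i j
  rw [wedge_apply, cartanMatrix, Matrix.of_apply, Finset.sum_eq_single ⟨0, by omega⟩]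
  · simp only [Pi.smul_apply, Pi.single_apply, smul_eq_mul, Fin.ext_iff]
    split_ifs <;> first | omega | simp
  · intro b _ hb
    have hb' : 1 ≤ (b : ℕ) := by
      rcases Nat.eq_zero_or_pos (b : ℕ) with h | h
      · exact absurd (Fin.ext h) hb
      · exact h
    rw [hl b hb']
    simp
  · simp

lemma sum_wedge_sq {k : ℕ} (α β : Fin k → ℝ) :
    ∑ i, ∑ j, wedge α β i j ^ 2 =
      2 * (dotProduct α α * dotProduct β β - dotProduct α β ^ 2) := by
  have : ∀ i j, wedge α β i j ^ 2 = (α i * α i) * (β j * β j) + (β i * β i) * (α j * α j) -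
      2 * ((α i * β i) * (α j * β j)) := fun i j => by rw [wedge_apply]; ring
  simp only [this, Finset.sum_add_distrib, Finset.sum_sub_distrib, ← Finset.mul_sum,
    ← Finset.sum_mul, dotProduct]
  ring

lemma sum_sq_conj {k : ℕ} {g : Matrix (Fin k) (Fin k) ℝ} (hg : g * g.transpose = 1)
    (α β : Fin k → ℝ) :
    ∑ i, ∑ j, (wedge (g.transpose.mulVec α) (g.transpose.mulVec β)) i j ^ 2 =
      ∑ i, ∑ j, wedge α β i j ^ 2 := by
  have h : ∀ u v : Fin k → ℝ, dotProduct (g.transpose.mulVec u) (g.transpose.mulVec v) =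
      dotProduct u v := by
    intro u v
    rw [Matrix.dotProduct_mulVec, Matrix.vecMul_transpose, Matrix.mulVec_mulVec, hg,
      Matrix.one_mulVec]
  rw [sum_wedge_sq, sum_wedge_sq, h, h, h]

/-- A point of the positive Weyl chamber that is conjugate to a matrix of rank at most two has at
most one nonzero entry, which is determined by the matrix. -/
lemma IsChamberPoint.of_wedge {k : ℕ} (hk : 2 ≤ k) {α β : Fin k → ℝ} {l : Fin (k / 2) → ℝ}
    (h : IsChamberPoint k (wedge α β) l) :
    (∀ m : Fin (k / 2), 1 ≤ (m : ℕ) → l m = 0) ∧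
    (k = 2 → l ⟨0, by omega⟩ = wedge α β ⟨0, by omega⟩ ⟨1, by omega⟩) ∧
    (3 ≤ k → l ⟨0, by omega⟩ = Real.sqrt ((∑ i, ∑ j, wedge α β i j ^ 2) / 2)) := by
  obtain ⟨⟨hw, hodd⟩, g, hg, hA⟩ := h
  rw [Matrix.mem_specialOrthogonalGroup_iff] at hg
  have hg1 : g.transpose * g = 1 := (Matrix.mem_orthogonalGroup_iff' _ _).1 hg.1
  have hg2 : g * g.transpose = 1 := (Matrix.mem_orthogonalGroup_iff _ _).1 hg.1
  have hC : cartanMatrix k l = wedge (g.transpose.mulVec α) (g.transpose.mulVec β) := by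
    rw [← conj_wedge, hA]
    calc cartanMatrix k l = (g.transpose * g) * cartanMatrix k l * (g.transpose * g) := by
          rw [hg1, one_mul, mul_one]
      _ = _ := by simp only [mul_assoc]
  have hzero : ∀ m : Fin (k / 2), 1 ≤ (m : ℕ) → l m = 0 := by
    intro m hm
    have hp := wedge_plucker (g.transpose.mulVec α) (g.transpose.mulVec β)
      ⟨0, by omega⟩ ⟨1, by omega⟩ ⟨2 * m, by omega⟩ ⟨2 * m + 1, by omega⟩
    rw [← hC] at hp
    rw [cartanMatrix_even_odd k l m, cartanMatrix_eq_zero k l ⟨0, by omega⟩ ⟨2 * m, by omega⟩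
      (by simp only; omega), cartanMatrix_eq_zero k l ⟨0, by omega⟩ ⟨2 * m + 1, by omega⟩
      (by simp only; omega)] at hp
    have h01 := cartanMatrix_even_odd k l ⟨0, by omega⟩
    simp only [mul_zero, zero_add] at h01
    rw [h01] at hp
    have hle := hw ⟨0, by omega⟩ m (Fin.lt_def.2 hm)
    have h0 : l ⟨0, by omega⟩ * l m = 0 := by linarith
    rcases mul_eq_zero.1 h0 with h0 | h0
    · rw [h0] at hle
      exact abs_nonpos_iff.1 hle
    · exact h0
  refine ⟨hzero, ?_, ?_⟩
  · rintro rfl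
    rw [hA, Matrix.mul_apply]
    have hdet := hg.2
    rw [Matrix.det_fin_two] at hdet
    rw [cartanMatrix_of_head le_rfl hzero]
    simp only [Matrix.mul_apply, Fin.sum_univ_two, Matrix.transpose_apply, wedge_apply]
    simp
    linear_combination (-l 0) * hdet
  · intro hk3
    have hpos : 0 ≤ l ⟨0, by omega⟩ := by
      rcases Nat.even_or_odd k with hev | hod
      · have hle := hw ⟨0, by omega⟩ ⟨1, by rcases hev with ⟨r, hr⟩; omega⟩
          (Fin.lt_def.2 Nat.zero_lt_one)
        exact (abs_nonneg _).trans hle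
      · exact hodd hod _
    have hsum := sum_sq_conj hg2 α β
    rw [← hC, cartanMatrix_of_head hk hzero, sum_wedge_sq] at hsum
    rw [← hsum]
    have : (2 * (dotProduct (l ⟨0, by omega⟩ • Pi.single (⟨0, by omega⟩ : Fin k) (1 : ℝ))
        (l ⟨0, by omega⟩ • Pi.single (⟨0, by omega⟩ : Fin k) (1 : ℝ)) *
        dotProduct (Pi.single (⟨1, by omega⟩ : Fin k) (1 : ℝ)) (Pi.single ⟨1, by omega⟩ 1) -
        dotProduct (l ⟨0, by omega⟩ • Pi.single (⟨0, by omega⟩ : Fin k) (1 : ℝ))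
          (Pi.single ⟨1, by omega⟩ 1) ^ 2)) / 2 = l ⟨0, by omega⟩ ^ 2 := by
      simp [Fin.ext_iff, pow_two]
    rw [this, Real.sqrt_sq hpos]

/-- For `k ≥ 3` an orthonormal basis whose first two vectors span the plane of `α` and `β`
conjugates `wedge α β` into the chamber; the sign of its third vector is used to make the
determinant one. For `k = 2` the matrix is in normal form already. -/
lemma exists_isChamberPoint_wedge {k : ℕ} (hk : 2 ≤ k) (α β : Fin k → ℝ) :
    ∃ l, IsChamberPoint k (wedge α β) l := by
  classical
  rcases hk.eq_or_lt with rfl | hk3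
  · refine ⟨fun _ => wedge α β 0 1, ⟨fun i j hij => ?_, fun h => ?_⟩, 1, one_mem _, ?_⟩
    · have := i.2; have := j.2; rw [Fin.lt_def] at hij; omega
    · exact absurd h (by decide)
    · rw [Matrix.transpose_one, one_mul, mul_one]
      rw [cartanMatrix_of_head le_rfl fun m hm => by have := m.2; omega]
      ext i j
      fin_cases i <;> fin_cases j <;> simp [wedge_apply] <;> ring
  by_cases h0 : wedge α β = 0
  · refine ⟨0, ⟨fun i j _ => by simp, fun _ i => le_rfl⟩, 1, one_mem _, ?_⟩
    have : cartanMatrix k 0 = 0 := by ext i j; simp [cartanMatrix]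
    rw [h0, this, mul_zero, zero_mul]
  -- Gram-Schmidt: an orthonormal pair spanning the plane of `α` and `β`
  obtain ⟨u, v, s, hs, hu, hv, huv, hw⟩ : ∃ (u v : EuclideanSpace ℝ (Fin k)) (s : ℝ), 0 ≤ s ∧
      ‖u‖ = 1 ∧ ‖v‖ = 1 ∧ inner ℝ u v = 0 ∧ wedge α β = s • wedge u v := by
    set a : EuclideanSpace ℝ (Fin k) := WithLp.toLp 2 α
    set b : EuclideanSpace ℝ (Fin k) := WithLp.toLp 2 β
    set b' : EuclideanSpace ℝ (Fin k) := b - (inner ℝ a b / ‖a‖ ^ 2) • a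
    have hwb : wedge α β = wedge a b' := by
      ext i j
      simp only [wedge_apply, b', PiLp.sub_apply, PiLp.smul_apply, smul_eq_mul, a, b]
      ring
    have ha : ‖a‖ ≠ 0 := by
      intro h
      have h : a = 0 := norm_eq_zero.1 h
      exact h0 (by rw [hwb, h]; ext i j; simp [wedge_apply])
    have hb : ‖b'‖ ≠ 0 := by
      intro h
      have h : b' = 0 := norm_eq_zero.1 h
      exact h0 (by rw [hwb, h]; ext i j; simp [wedge_apply])
    have hab : inner ℝ a b' = 0 := by
      simp only [b', inner_sub_right, inner_smul_right, real_inner_self_eq_norm_sq]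
      field_simp
      ring
    refine ⟨‖a‖⁻¹ • a, ‖b'‖⁻¹ • b', ‖a‖ * ‖b'‖, by positivity, ?_, ?_, ?_, ?_⟩
    · rw [norm_smul, norm_inv, norm_norm, inv_mul_cancel₀ ha]
    · rw [norm_smul, norm_inv, norm_norm, inv_mul_cancel₀ hb]
    · rw [inner_smul_left, inner_smul_right, hab, mul_zero, mul_zero]
    · rw [hwb]
      ext i j
      simp only [wedge_apply, Matrix.smul_apply, PiLp.smul_apply, smul_eq_mul]
      field_simp
  set i0 : Fin k := ⟨0, by omega⟩
  set i1 : Fin k := ⟨1, by omega⟩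
  set i2 : Fin k := ⟨2, by omega⟩
  have h01 : i0 ≠ i1 := by simp [i0, i1]
  have h02 : i0 ≠ i2 := by simp [i0, i2]
  have h12 : i1 ≠ i2 := by simp [i1, i2]
  obtain ⟨e, he⟩ := Orthonormal.exists_orthonormalBasis_extension_of_card_eq (𝕜 := ℝ)
    (E := EuclideanSpace ℝ (Fin k)) (ι := Fin k) (by simp)
    (v := fun i => if i = i0 then u else v) (s := {i0, i1}) (by
      rw [orthonormal_iff_ite]
      rintro ⟨i, rfl | rfl⟩ ⟨j, rfl | rfl⟩
      · simp [hu]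
      · simp [h01.symm, huv, Subtype.ext_iff, h01]
      · simp [h01.symm, real_inner_comm, huv, Subtype.ext_iff]
      · simp [h01.symm, hv])
  have he0 : e i0 = u := by rw [he i0 (by simp)]; simp
  have he1 : e i1 = v := by rw [he i1 (by simp)]; simp [h01.symm]
  let g' : Matrix (Fin k) (Fin k) ℝ := Matrix.of fun i j => e j i
  have hg' : g'.transpose * g' = 1 := by
    ext i j
    have := orthonormal_iff_ite.1 e.orthonormal i j
    rw [Matrix.mul_apply, Matrix.one_apply, ← this, PiLp.inner_apply]
    refine Finset.sum_congr rfl fun a _ => ?_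
    simp [g', mul_comm]
  -- the sign of the third column adjusts the determinant
  let σ : Fin k → ℝ := Function.update 1 i2 g'.det
  have hdet : g'.det * g'.det = 1 := by
    have := congrArg Matrix.det hg'
    rwa [Matrix.det_mul, Matrix.det_transpose, Matrix.det_one] at this
  have hσ : Matrix.diagonal σ * Matrix.diagonal σ = 1 := by
    rw [Matrix.diagonal_mul_diagonal, ← Matrix.diagonal_one]
    congr 1
    ext i
    by_cases h : i = i2
    · subst h; simp [σ, hdet]
    · simp [σ, h]
  let g := g' * Matrix.diagonal σ
  have hg : g ∈ Matrix.specialOrthogonalGroup (Fin k) ℝ := by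
    rw [Matrix.mem_specialOrthogonalGroup_iff]
    constructor
    · rw [Matrix.mem_orthogonalGroup_iff']
      calc g.transpose * g = Matrix.diagonal σ * (g'.transpose * g') * Matrix.diagonal σ := by
            simp only [g, Matrix.transpose_mul, Matrix.diagonal_transpose, mul_assoc]
        _ = 1 := by rw [hg', mul_one, hσ]
    · rw [Matrix.det_mul, Matrix.det_diagonal, Finset.prod_update_of_mem (Finset.mem_univ _)]
      simp [hdet]
  have hcol : ∀ i : Fin k, i ≠ i2 → g.mulVec (Pi.single i 1) = e i := by
    intro i hi
    ext a
    simp [g, g', σ, hi]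
  refine ⟨Pi.single ⟨0, by omega⟩ s, ⟨?_, ?_⟩, g, hg, ?_⟩
  · intro i j hij
    have : j ≠ ⟨0, by omega⟩ := by
      intro h; rw [h] at hij; exact absurd (Fin.lt_def.1 hij) (by simp)
    rw [Pi.single_eq_of_ne this, abs_zero, Pi.single_apply]
    split_ifs <;> simp [hs]
  · intro _ i
    rw [Pi.single_apply]
    split_ifs <;> simp [hs]
  · have h := conj_wedge g.transpose (s • Pi.single i0 1) (Pi.single i1 1)
    rw [Matrix.transpose_transpose] at h
    rw [cartanMatrix_of_head (by omega), Pi.single_eq_same, h, Matrix.mulVec_smul, hcol i0 h02,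
      hcol i1 h12, he0, he1, hw]
    · ext i j
      simp only [wedge_apply, Matrix.smul_apply, Pi.smul_apply, smul_eq_mul]
      ring
    · intro m hm
      rw [Pi.single_eq_of_ne]
      rintro rfl
      simp at hm

/-! ### The Gelfand-Cetlin functions in homogeneous coordinates -/

lemma muSO_eq_wedge {n : ℕ} (lam : ℝ) (k : ℕ) {p : PSpace n} {x : E n} (h : IsRep p x) :
    muSO lam k p = wedge (fun i => 2 * lam / ‖x‖ ^ 2 * (coord x i).re)
      (fun i => (coord x i).im) := by
  ext i j
  rw [muSO_apply lam k h, wedge_apply]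
  simp
  ring

lemma existsUnique_isChamberPoint {n : ℕ} (lam : ℝ) {k : ℕ} (hk : 2 ≤ k) (p : PSpace n) :
    ∃! l, IsChamberPoint k (muSO lam k p) l := by
  rw [muSO_eq_wedge lam k (isRep_rep p)]
  obtain ⟨l, hl⟩ := exists_isChamberPoint_wedge hk
    (fun i => 2 * lam / ‖p.rep‖ ^ 2 * (coord p.rep i).re) (fun i => (coord p.rep i).im)
  refine ⟨l, hl, fun l' hl' => ?_⟩
  obtain ⟨h1, h2, h3⟩ := hl.of_wedge hk
  obtain ⟨h1', h2', h3'⟩ := hl'.of_wedge hk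
  ext m
  rcases Nat.eq_zero_or_pos (m : ℕ) with hm | hm
  · have : m = ⟨0, by omega⟩ := Fin.ext hm
    rw [this]
    rcases hk.eq_or_lt with hk2 | hk3
    · rw [h2 hk2.symm, h2' hk2.symm]
    · rw [h3 hk3, h3' hk3]
  · rw [h1 m hm, h1' m hm]

lemma isChamberPoint_gcTuple {n : ℕ} (lam : ℝ) {k : ℕ} (hk : 2 ≤ k) (p : PSpace n) :
    IsChamberPoint k (muSO lam k p) (gcTuple lam k p) :=
  Classical.epsilon_spec (existsUnique_isChamberPoint lam hk p).exists

lemma gcFun_eq_zero {n : ℕ} (lam : ℝ) {k i : ℕ} (hk : 2 ≤ k) (hi : 2 ≤ i) (p : PSpace n) :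
    gcFun lam k i p = 0 := by
  rw [gcFun]
  split_ifs with h
  · have h1 := isChamberPoint_gcTuple lam hk p
    rw [muSO_eq_wedge lam k (isRep_rep p)] at h1
    exact (h1.of_wedge hk).1 _ (by simp only; omega)
  · rfl

lemma gcFun_two {n : ℕ} (lam : ℝ) {p : PSpace n} {x : E n} (hx : IsRep p x) :
    gcFun lam 2 1 p = lam * (2 * (star (coord x 0) * coord x 1).im) / ‖x‖ ^ 2 := by
  have h1 := isChamberPoint_gcTuple lam le_rfl p
  rw [muSO_eq_wedge lam 2 hx] at h1
  rw [gcFun, dif_pos (by norm_num)]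
  refine ((h1.of_wedge le_rfl).2.1 rfl).trans ?_
  rw [← muSO_eq_wedge lam 2 hx, muSO_apply lam 2 hx]

lemma sum_muSO_sq {n : ℕ} (lam : ℝ) {k : ℕ} (hkn : k ≤ n) {p : PSpace n} {x : E n}
    (hx : IsRep p x) :
    (∑ i, ∑ j, muSO lam k p i j ^ 2) / 2 = (lam / ‖x‖ ^ 2) ^ 2 * disc k x := by
  rw [disc_eq_sum]
  have h : ∀ i : Fin n, (∑ j : Fin n, if (i : ℕ) < k ∧ (j : ℕ) < k then
      (star (x i) * x j).im ^ 2 else 0) = if h : (i : ℕ) < k then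
        ∑ j : Fin k, (star (coord x (⟨i, h⟩ : Fin k)) * coord x j).im ^ 2 else 0 := by
    intro i
    split_ifs with h
    · rw [← sum_dite_lt hkn]
      refine Finset.sum_congr rfl fun j _ => ?_
      by_cases hj : (j : ℕ) < k <;> simp [h, hj, coord_of_lt]
    · simp [h]
  rw [Finset.sum_congr rfl fun i _ => h i,
    sum_dite_lt hkn fun i : Fin k => ∑ j : Fin k, (star (coord x i) * coord x j).im ^ 2]
  simp only [muSO_apply lam k hx, Finset.mul_sum, Finset.sum_div]
  refine Finset.sum_congr rfl fun i _ => Finset.sum_congr rfl fun j _ => ?_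
  ring

lemma gcFun_of_three_le {n : ℕ} {lam : ℝ} (hlam : 0 < lam) {k : ℕ} (hk : 3 ≤ k) (hkn : k ≤ n)
    {p : PSpace n} {x : E n} (hx : IsRep p x) :
    gcFun lam k 1 p = lam * Real.sqrt (disc k x) / ‖x‖ ^ 2 := by
  have hk2 : 2 ≤ k := by omega
  have h1 := isChamberPoint_gcTuple lam hk2 p
  rw [muSO_eq_wedge lam k hx] at h1
  rw [gcFun, dif_pos (show 1 - 1 < k / 2 by omega)]
  refine ((h1.of_wedge hk2).2.2 hk).trans ?_
  rw [← muSO_eq_wedge lam k hx, sum_muSO_sq lam hkn hx, Real.sqrt_mul (by positivity),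
    Real.sqrt_sq (by positivity)]
  ring

lemma nu_apply {n : ℕ} (lam : ℝ) (k : ℕ) {p : PSpace n} {x : E n} (hx : IsRep p x) :
    nu lam k p = lam * nsq k x / ‖x‖ ^ 2 := by
  refine hx.apply_rep (F := fun x => lam * nsq k x / ‖x‖ ^ 2) fun c y hc => ?_
  have hc' : ‖c‖ ≠ 0 := norm_ne_zero_iff.2 hc
  simp only [nsq_smul, norm_smul]
  by_cases hy : ‖y‖ = 0
  · simp [hy]
  · field_simp

/-! ### Density of the generic points of the quadrics -/

/-- The genericity condition used for all density statements: all coordinates are nonzero, and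
the first two have linearly independent real and imaginary parts. -/
def Generic {n : ℕ} (x : E n) : Prop :=
  (star (coord x 0) * coord x 1).im ≠ 0 ∧ ∀ i, x i ≠ 0

lemma generic_smul {n : ℕ} (c : ℂ) (x : E n) (hc : c ≠ 0) : Generic (c • x) = Generic x := by
  have h2 : star (coord (c • x) 0) * coord (c • x) 1 =
      ((‖c‖ ^ 2 : ℝ) : ℂ) * (star (coord x 0) * coord x 1) := by
    have := Complex.conj_mul' c
    rw [coord_smul, coord_smul, star_mul']
    push_cast
    rw [← this]
    simp only [starRingEnd_apply]
    ring
  rw [Generic, Generic, h2, Complex.im_ofReal_mul]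
  simp [hc]

lemma continuous_coord {n : ℕ} (i : ℕ) : Continuous fun x : E n => coord x i := by
  by_cases h : i < n
  · simp only [coord_of_lt _ h]
    fun_prop
  · simp only [coord, h, dif_neg, not_false_eq_true]
    fun_prop

lemma isOpen_generic {n : ℕ} : IsOpen {x : E n | Generic x} := by
  refine IsOpen.inter ?_ ?_
  · refine isOpen_ne_fun ?_ continuous_const
    exact Complex.continuous_im.comp ((continuous_coord 0).star.mul (continuous_coord 1))
  · change IsOpen {x : E n | ∀ i, x i ≠ 0}
    simp only [Set.ofPred_forall]
    exact isOpen_iInter_of_finite fun i => isOpen_ne_fun (by fun_prop) continuous_const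

lemma wt_of_lt {n k : ℕ} (t : ℂ) {i : Fin n} (h : (i : ℕ) + 1 < k) : wt k t i = 1 := by
  simp [wt, h]

lemma bil_add_single {n : ℕ} (k : ℕ) (t : ℂ) (x : E n) {i j : Fin n} (hij : i ≠ j) (a b : ℂ) :
    bil k t (x + EuclideanSpace.single i a + EuclideanSpace.single j b)
        (x + EuclideanSpace.single i a + EuclideanSpace.single j b) =
      bil k t x x + wt k t i * (2 * x i * a + a ^ 2) + wt k t j * (2 * x j * b + b ^ 2) := by
  have hs : ∀ (y : E n) (i : Fin n) (a : ℂ),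
      bil k t y (EuclideanSpace.single i a) = wt k t i * (y i * a) := by
    intro y i a
    rw [bil, Finset.sum_eq_single i]
    · simp
    · intro m _ hm; simp [hm]
    · simp
  have hs' : ∀ (y : E n) (i : Fin n) (a : ℂ),
      bil k t (EuclideanSpace.single i a) y = wt k t i * (y i * a) := by
    intro y i a
    rw [bil_comm, hs]
  simp only [bil_add_left, bil_add_right, hs, hs']
  simp [hij, hij.symm]
  ring

/-- A point of the quadric is a limit of points satisfying `T` as soon as some curve in the
quadric, obtained by moving two of the coordinates, enters `T` immediately. -/
lemma mem_closure_of_curve {n k : ℕ} {t : ℂ} {x : E n} (hx : x ∈ cone (quad n k t)) {i j : Fin n}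
    (hij : i ≠ j) (a b : ℝ → ℂ) (ha : Continuous a) (hb : Continuous b) (ha0 : a 0 = 0)
    (hb0 : b 0 = 0)
    (hab : ∀ s, wt k t i * (2 * x i * a s + a s ^ 2) + wt k t j * (2 * x j * b s + b s ^ 2) = 0)
    {T : E n → Prop} (hT : ∀ᶠ s in 𝓝[≠] (0 : ℝ),
      T (x + EuclideanSpace.single i (a s) + EuclideanSpace.single j (b s))) :
    x ∈ closure {y | y ∈ cone (quad n k t) ∧ T y} := by
  have hc : Continuous fun s : ℝ =>
      x + EuclideanSpace.single i (a s) + EuclideanSpace.single j (b s) := by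
    have h : ∀ (i : Fin n) (f : ℝ → ℂ), Continuous f →
        Continuous fun s => (EuclideanSpace.single i (f s) : E n) := by
      intro i f hf
      have : (fun s => (EuclideanSpace.single i (f s) : E n)) =
          fun s => f s • EuclideanSpace.single i (1 : ℂ) := by
        ext s m
        by_cases hm : m = i <;> simp [hm]
      rw [this]
      fun_prop
    exact (continuous_const.add (h i a ha)).add (h j b hb)
  have h0 : x + EuclideanSpace.single i (a 0) + EuclideanSpace.single j (b 0) = x := by
    rw [ha0, hb0]; ext m; simp
  have ht : Filter.Tendsto (fun s : ℝ =>
      x + EuclideanSpace.single i (a s) + EuclideanSpace.single j (b s)) (𝓝[≠] 0) (𝓝 x) := by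
    have := hc.tendsto 0
    rw [h0] at this
    exact this.mono_left nhdsWithin_le_nhds
  refine mem_closure_of_tendsto ht ?_
  filter_upwards [hT, ht.eventually_ne hx.1] with s hs hs0
  refine ⟨mem_cone_quad.2 ⟨hs0, ?_⟩, hs⟩
  rw [bil_add_single k t x hij, (mem_cone_quad.1 hx).2, zero_add, hab s]

lemma eventually_sin_ne_zero : ∀ᶠ s in 𝓝[≠] (0 : ℝ), Real.sin s ≠ 0 := by
  have h : ∀ᶠ s in 𝓝 (0 : ℝ), s ∈ Set.Ioo (-Real.pi) Real.pi :=
    Ioo_mem_nhds (by linarith [Real.pi_pos]) Real.pi_pos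
  filter_upwards [nhdsWithin_le_nhds h, self_mem_nhdsWithin] with s hs hs0
  intro h
  exact hs0 ((Real.sin_eq_zero_iff_of_lt_of_lt hs.1 hs.2).1 h)

lemma sin_sq_add_cos_sq_complex (s : ℝ) :
    (Real.sin s : ℂ) ^ 2 + (Real.cos s : ℂ) ^ 2 = 1 := by
  rw [← Complex.ofReal_pow, ← Complex.ofReal_pow, ← Complex.ofReal_add, Real.sin_sq_add_cos_sq,
    Complex.ofReal_one]

section Density

variable {n k : ℕ} {t : ℂ}

/-- Every point of the cone is a limit of points of the cone with nonzero first coordinate: rotate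
a nonzero coordinate that occurs in the equation into the first one, or, if there is none, add
multiples of the isotropic vector `(1, i, 0, …, 0)`. -/
lemma dense_first_coord_ne_zero (hk : 3 ≤ k) (hkn : k ≤ n) {x : E n}
    (hx : x ∈ cone (quad n k t)) :
    x ∈ closure {y : E n | y ∈ cone (quad n k t) ∧ y ⟨0, by omega⟩ ≠ 0} := by
  set i0 : Fin n := ⟨0, by omega⟩
  set i1 : Fin n := ⟨1, by omega⟩
  have h01 : i0 ≠ i1 := by simp [i0, i1]
  have w0 : wt k t i0 = 1 := wt_of_lt t (by simp only [i0]; omega)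
  have w1 : wt k t i1 = 1 := wt_of_lt t (by simp only [i1]; omega)
  by_cases hx0 : x i0 ≠ 0
  · exact subset_closure ⟨hx, hx0⟩
  rw [not_not] at hx0
  by_cases hl : ∃ l, wt k t l ≠ 0 ∧ x l ≠ 0
  · -- rotate a nonzero coordinate into the first one
    obtain ⟨l, hwl, hxl⟩ := hl
    have hl0 : i0 ≠ l := by rintro rfl; exact hxl hx0
    obtain ⟨c, hc⟩ := IsAlgClosed.exists_pow_nat_eq (wt k t l) two_pos
    have hc0 : c ≠ 0 := by rintro rfl; exact hwl (by rw [← hc]; ring)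
    refine mem_closure_of_curve hx hl0 (fun s => c * x l * Real.sin s)
      (fun s => x l * (Real.cos s - 1)) (by fun_prop) (by fun_prop) (by simp) (by simp) ?_ ?_
    · intro s
      rw [w0, hx0]
      linear_combination wt k t l * x l ^ 2 * sin_sq_add_cos_sq_complex s +
        x l ^ 2 * (Real.sin s : ℂ) ^ 2 * hc
    · filter_upwards [eventually_sin_ne_zero] with s hs
      simp [hl0, hx0, hc0, hxl]
      exact_mod_cast hs
  · push Not at hl
    have hx1 : x i1 = 0 := hl i1 (by rw [w1]; exact one_ne_zero)
    refine mem_closure_of_curve hx h01 (fun s => (s : ℂ)) (fun s => Complex.I * s)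
      (by fun_prop) (by fun_prop) (by simp) (by simp) ?_ ?_
    · intro s
      rw [w0, w1, hx0, hx1, mul_pow, Complex.I_sq]
      ring
    · filter_upwards [self_mem_nhdsWithin] with s hs
      simpa [h01, hx0] using hs

/-- A further coordinate becomes nonzero on rotating the first one into it (or on moving it freely,
if the equation does not involve it), while the coordinates that are already nonzero remain so for
small parameters. -/
lemma dense_insert_coord_ne_zero (hk : 3 ≤ k) (hkn : k ≤ n) {x : E n}
    (hx : x ∈ cone (quad n k t)) (S : Finset (Fin n)) (i : Fin n)
    (h0 : x ⟨0, by omega⟩ ≠ 0) (hS : ∀ l ∈ S, x l ≠ 0) :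
    x ∈ closure {y : E n | y ∈ cone (quad n k t) ∧ (y ⟨0, by omega⟩ ≠ 0 ∧
      ∀ l ∈ insert i S, y l ≠ 0)} := by
  set i0 : Fin n := ⟨0, by omega⟩
  have w0 : wt k t i0 = 1 := wt_of_lt t (by simp only [i0]; omega)
  by_cases hxi : x i ≠ 0
  · refine subset_closure ⟨hx, h0, fun l hl => ?_⟩
    rcases Finset.mem_insert.1 hl with rfl | hl
    exacts [hxi, hS l hl]
  rw [not_not] at hxi
  have hi0 : i0 ≠ i := by rintro rfl; exact h0 hxi
  have key : ∀ a b : ℝ → ℂ, Continuous a → Continuous b → a 0 = 0 → b 0 = 0 →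
      (∀ᶠ s in 𝓝[≠] (0 : ℝ), b s ≠ 0) → ∀ᶠ s in 𝓝[≠] (0 : ℝ),
      ((x + EuclideanSpace.single i0 (a s) + EuclideanSpace.single i (b s) : E n) i0 ≠ 0 ∧
      ∀ l ∈ insert i S,
        (x + EuclideanSpace.single i0 (a s) + EuclideanSpace.single i (b s) : E n) l ≠ 0) := by
    intro a b ha hb ha0 hb0 hne
    have hcont : ∀ l : Fin n, x l ≠ 0 → ∀ᶠ s in 𝓝[≠] (0 : ℝ),
        (x + EuclideanSpace.single i0 (a s) + EuclideanSpace.single i (b s) : E n) l ≠ 0 := by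
      intro l hl
      have hc : Continuous fun s : ℝ =>
          (x + EuclideanSpace.single i0 (a s) + EuclideanSpace.single i (b s) : E n) l := by
        simp only [PiLp.add_apply, PiLp.single_apply]
        split_ifs <;> fun_prop
      refine nhdsWithin_le_nhds (hc.continuousAt.eventually_ne ?_)
      simpa [ha0, hb0] using hl
    filter_upwards [hcont i0 h0, hne,
      (Filter.eventually_all_finset S).2 fun l hl => hcont l (hS l hl)] with s hs0 hsi hsS
    refine ⟨hs0, fun l hl => ?_⟩
    rcases Finset.mem_insert.1 hl with rfl | hl
    · simpa [hi0.symm, hxi] using hsi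
    · exact hsS l hl
  by_cases hwi : wt k t i = 0
  · refine mem_closure_of_curve hx hi0 (fun _ => 0) (fun s => (s : ℂ))
      (by fun_prop) (by fun_prop) (by simp) (by simp) ?_
      (key _ _ (by fun_prop) (by fun_prop) (by simp) (by simp) ?_)
    · intro s
      rw [hwi]
      ring
    · filter_upwards [self_mem_nhdsWithin] with s hs
      simpa using hs
  · obtain ⟨c, hc⟩ := IsAlgClosed.exists_pow_nat_eq (wt k t i)⁻¹ two_pos
    have hc' : wt k t i * c ^ 2 = 1 := by rw [hc, mul_inv_cancel₀ hwi]
    have hc0 : c ≠ 0 := by rintro rfl; simp at hc'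
    refine mem_closure_of_curve hx hi0 (fun s => x i0 * (Real.cos s - 1))
      (fun s => c * x i0 * Real.sin s) (by fun_prop) (by fun_prop) (by simp) (by simp) ?_
      (key _ _ (by fun_prop) (by fun_prop) (by simp) (by simp) ?_)
    · intro s
      rw [w0, hxi]
      linear_combination x i0 ^ 2 * sin_sq_add_cos_sq_complex s +
        x i0 ^ 2 * (Real.sin s : ℂ) ^ 2 * hc'
    · filter_upwards [eventually_sin_ne_zero] with s hs
      exact mul_ne_zero (mul_ne_zero hc0 h0) (by exact_mod_cast hs)

/-- Rotating the first two coordinates by a small imaginary angle makes `Im (x̄_1 x_2)` nonzero. -/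
lemma dense_generic_of_forall_ne_zero (hk : 3 ≤ k) (hkn : k ≤ n) {x : E n}
    (hx : x ∈ cone (quad n k t)) (hne : ∀ i, x i ≠ 0) :
    x ∈ closure {y : E n | y ∈ cone (quad n k t) ∧ Generic y} := by
  by_cases hI : (star (coord x 0) * coord x 1).im ≠ 0
  · exact subset_closure ⟨hx, hI, hne⟩
  rw [not_not] at hI
  set i0 : Fin n := ⟨0, by omega⟩ with hi0
  set i1 : Fin n := ⟨1, by omega⟩ with hi1
  have h01 : i0 ≠ i1 := by simp [i0, i1]
  have w0 : wt k t i0 = 1 := wt_of_lt t (by simp only [i0]; omega)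
  have w1 : wt k t i1 = 1 := wt_of_lt t (by simp only [i1]; omega)
  have hch : ∀ s : ℝ, (Real.cosh s : ℂ) ^ 2 - (Real.sinh s : ℂ) ^ 2 = 1 := by
    intro s
    rw [← Complex.ofReal_pow, ← Complex.ofReal_pow, ← Complex.ofReal_sub, Real.cosh_sq_sub_sinh_sq,
      Complex.ofReal_one]
  -- a rotation of the first two coordinates by an imaginary angle
  refine mem_closure_of_curve hx h01
    (fun s => x i0 * (Real.cosh s - 1) - Complex.I * Real.sinh s * x i1)
    (fun s => x i1 * (Real.cosh s - 1) + Complex.I * Real.sinh s * x i0)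
    (by fun_prop) (by fun_prop) (by simp) (by simp) ?_ ?_
  · intro s
    rw [w0, w1]
    linear_combination (x i0 ^ 2 + x i1 ^ 2) * hch s +
      (x i0 ^ 2 + x i1 ^ 2) * (Real.sinh s : ℂ) ^ 2 * Complex.I_sq
  · have hcont : ∀ l : Fin n, ∀ᶠ s in 𝓝[≠] (0 : ℝ),
        (x + EuclideanSpace.single i0
          (x i0 * (Real.cosh s - 1) - Complex.I * Real.sinh s * x i1) +
          EuclideanSpace.single i1
          (x i1 * (Real.cosh s - 1) + Complex.I * Real.sinh s * x i0) : E n) l ≠ 0 := by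
      intro l
      have hc : Continuous fun s : ℝ => (x + EuclideanSpace.single i0
          (x i0 * (Real.cosh s - 1) - Complex.I * Real.sinh s * x i1) +
          EuclideanSpace.single i1
          (x i1 * (Real.cosh s - 1) + Complex.I * Real.sinh s * x i0) : E n) l := by
        simp only [PiLp.add_apply, PiLp.single_apply]
        split_ifs <;> fun_prop
      refine nhdsWithin_le_nhds (hc.continuousAt.eventually_ne ?_)
      simpa using hne l
    filter_upwards [Filter.eventually_all.2 hcont, self_mem_nhdsWithin] with s hs hs0
    refine ⟨?_, hs⟩
    rw [coord_of_lt _ (by omega : 0 < n), coord_of_lt _ (by omega : 1 < n)] at hI ⊢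
    rw [← hi0, ← hi1] at hI ⊢
    have e : (star ((x + EuclideanSpace.single i0
          (x i0 * (Real.cosh s - 1) - Complex.I * Real.sinh s * x i1) +
          EuclideanSpace.single i1
          (x i1 * (Real.cosh s - 1) + Complex.I * Real.sinh s * x i0) : E n) i0) *
        (x + EuclideanSpace.single i0
          (x i0 * (Real.cosh s - 1) - Complex.I * Real.sinh s * x i1) +
          EuclideanSpace.single i1
          (x i1 * (Real.cosh s - 1) + Complex.I * Real.sinh s * x i0) : E n) i1).im =
        Real.cosh s * Real.sinh s * (Complex.normSq (x i0) + Complex.normSq (x i1)) +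
        (Real.cosh s ^ 2 + Real.sinh s ^ 2) * (star (x i0) * x i1).im := by
      simp only [PiLp.add_apply, PiLp.single_apply, h01, h01.symm, if_true, if_false,
        add_zero, Complex.normSq_apply]
      simp [-Complex.ofReal_cosh,
        -Complex.ofReal_sinh]
      ring
    rw [e, hI, mul_zero, add_zero]
    have h1 : 0 < Complex.normSq (x i0) := Complex.normSq_pos.2 (hne i0)
    have h2 : 0 < Complex.normSq (x i1) := Complex.normSq_pos.2 (hne i1)
    have h3 : Real.sinh s ≠ 0 := fun h => hs0 (Real.sinh_eq_zero.1 h)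
    exact mul_ne_zero (mul_ne_zero (Real.cosh_pos s).ne' h3) (by linarith)

/-- The generic points are dense in the cone over every fibre. -/
lemma mem_closure_generic (hk : 3 ≤ k) (hkn : k ≤ n) {x : E n} (hx : x ∈ cone (quad n k t)) :
    x ∈ closure {y : E n | y ∈ cone (quad n k t) ∧ Generic y} := by
  have h : ∀ S : Finset (Fin n), x ∈ closure {y : E n | y ∈ cone (quad n k t) ∧
      (y ⟨0, by omega⟩ ≠ 0 ∧ ∀ l ∈ S, y l ≠ 0)} := by
    intro S
    induction S using Finset.induction_on with
    | empty =>
      simpa using dense_first_coord_ne_zero hk hkn hx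
    | insert i S _ ih =>
      refine closure_minimal ?_ isClosed_closure ih
      rintro y ⟨hy, hy0, hyS⟩
      exact dense_insert_coord_ne_zero hk hkn hy S i hy0 hyS
  refine closure_minimal ?_ isClosed_closure (h Finset.univ)
  rintro y ⟨hy, -, hy1⟩
  exact dense_generic_of_forall_ne_zero hk hkn hy fun i => hy1 i (Finset.mem_univ i)

/-- An open condition that is implied by genericity defines an open dense subset of the
quadric. -/
lemma isOpenDenseIn_of_generic (hk : 3 ≤ k) (hkn : k ≤ n) {G : E n → Prop}
    (hG : ∀ (c : ℂ) (x : E n), c ≠ 0 → G (c • x) = G x) (ho : IsOpen {x | G x})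
    (h : ∀ x ∈ cone (quad n k t), Generic x → G x) :
    IsOpenDenseIn (zeroLocus (quad n k t)) {p | p ∈ zeroLocus (quad n k t) ∧ G p.rep} := by
  refine ⟨fun p hp => hp.1, ⟨_, isOpen_setOf_rep hG ho, Set.inter_comm _ _⟩, fun p hp => ?_⟩
  rw [mem_closure_iff]
  intro O hO hpO
  have hx := hp _ (isRep_rep p)
  obtain ⟨y, ⟨q, hq, hqy⟩, hy, hgen⟩ := mem_closure_iff.1 (mem_closure_generic hk hkn hx) _
    (isOpen_iff_affine.1 hO) ⟨p, hpO, isRep_rep p⟩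
  exact ⟨q, hq, hqy.mem_zeroLocus_iff.2 hy, by rw [hqy.apply_rep hG]; exact h y hy hgen⟩

end Density

/-! ### Flatness of the families -/

/-- A hypersurface over a principal ideal domain whose equation has content one is flat. -/
lemma flat_quotient_of_not_C_dvd {σ R : Type*} [CommRing R] [IsDomain R] [IsPrincipalIdealRing R]
    {F : MvPolynomial σ R} (hF : ∀ r : R, Prime r → ¬ MvPolynomial.C r ∣ F) :
    Module.Flat R (MvPolynomial σ R ⧸ Ideal.span {F}) := by
  rw [IsDedekindDomain.flat_iff_torsion_eq_bot, Submodule.eq_bot_iff]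
  have key : ∀ a : R, a ≠ 0 → ∀ g : MvPolynomial σ R, F ∣ MvPolynomial.C a * g → F ∣ g := by
    intro a
    induction a using UniqueFactorizationMonoid.induction_on_prime with
    | h₁ => exact fun h => absurd rfl h
    | h₂ a ha =>
      intro _ g hg
      exact ((ha.map MvPolynomial.C).dvd_mul_left).1 hg
    | h₃ a r ha hr ih =>
      rintro - g ⟨h, hh⟩
      rw [map_mul, mul_assoc] at hh
      have hp : Prime (MvPolynomial.C r : MvPolynomial σ R) := (MvPolynomial.prime_C_iff σ).2 hr
      obtain ⟨h', rfl⟩ := (hp.dvd_or_dvd ⟨_, hh.symm⟩).resolve_left (hF r hr)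
      refine ih ha g ⟨h', mul_left_cancel₀ hp.ne_zero ?_⟩
      rw [hh]
      ring
  rintro y hy
  obtain ⟨a, ha⟩ := (Submodule.mem_torsion_iff y).1 hy
  obtain ⟨g, rfl⟩ := Ideal.Quotient.mk_surjective y
  have h : Ideal.Quotient.mk (Ideal.span {F}) (MvPolynomial.C (a : R) * g) = 0 := by
    rw [← ha, ← MvPolynomial.smul_eq_C_mul]
    rfl
  rw [Ideal.Quotient.eq_zero_iff_mem, Ideal.mem_span_singleton] at h ⊢
  exact key a (nonZeroDivisors.ne_zero a.2) g h

/-- A constant dividing the equation divides its coefficient of `X_0 ^ 2`, which is one. -/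
lemma flat_famPoly {n k : ℕ} (hk : 3 ≤ k) (hkn : k ≤ n) :
    Module.Flat (Polynomial ℂ)
      (MvPolynomial (Fin n) (Polynomial ℂ) ⧸ Ideal.span {famPoly n k}) := by
  refine flat_quotient_of_not_C_dvd fun r hr hdvd => hr.not_isUnit ?_
  have h := (MvPolynomial.C_dvd_iff_dvd_coeff _ _).1 hdvd (Finsupp.single ⟨0, by omega⟩ 2)
  have hc : (famPoly n k).coeff (Finsupp.single ⟨0, by omega⟩ 2) = 1 := by
    rw [famPoly, MvPolynomial.coeff_sum, Finset.sum_eq_single ⟨0, by omega⟩]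
    · rw [if_pos (by simp only; omega), MvPolynomial.coeff_X_pow, if_pos rfl]
    · intro i _ hi
      have hne : Finsupp.single i 2 ≠ Finsupp.single (⟨0, by omega⟩ : Fin n) 2 := by
        intro h
        exact hi ((Finsupp.single_left_inj two_ne_zero).1 h)
      split_ifs
      · rw [MvPolynomial.coeff_X_pow, if_neg hne]
      · rw [MvPolynomial.coeff_C_mul, MvPolynomial.coeff_X_pow, if_neg hne, mul_zero]
      · exact MvPolynomial.coeff_zero _
    · simp
  rw [hc] at h
  exact isUnit_of_dvd_one h

/-! ### The integrable systems on the fibres -/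

/-- The homogeneous numerator of `λ_1^{(m)}`, a square root of `disc m`, signed if `m = 2`. -/
def ell {n : ℕ} (m : ℕ) (x : E n) : ℝ :=
  if m = 2 then 2 * (star (coord x 0) * coord x 1).im else Real.sqrt (disc m x)

lemma ell_sq {n m : ℕ} (hm : 2 ≤ m) (hmn : m ≤ n) (x : E n) : ell m x ^ 2 = disc m x := by
  rw [ell]
  split_ifs with h
  · subst h
    rw [disc_two hmn, coord_of_lt x (by omega : 0 < n), coord_of_lt x (by omega : 1 < n)]
  · exact Real.sq_sqrt (disc_nonneg m x)

lemma gcFun_one {n m : ℕ} {lam : ℝ} (hlam : 0 < lam) (hm : 2 ≤ m) (hmn : m ≤ n) {p : PSpace n}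
    {x : E n} (hx : IsRep p x) : gcFun lam m 1 p = lam * ell m x / ‖x‖ ^ 2 := by
  rw [ell]
  split_ifs with h
  · subst h; exact gcFun_two lam hx
  · exact gcFun_of_three_le hlam (by omega) hmn hx

lemma contDiff_coord {n : ℕ} (i : ℕ) : ContDiff ℝ ∞ fun x : E n => coord x i := by
  by_cases h : i < n
  · simp only [coord_of_lt _ h]
    fun_prop
  · simp only [coord, h, dif_neg, not_false_eq_true]
    fun_prop

lemma contDiff_ell_two {n : ℕ} : ContDiff ℝ ∞ fun x : E n => ell 2 x := by
  simp only [ell, if_true]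
  refine contDiff_const.mul (Complex.imCLM.contDiff.comp (ContDiff.mul ?_ (contDiff_coord 1)))
  exact Complex.conjCLE.contDiff.comp (contDiff_coord 0)

lemma continuous_ell {n : ℕ} (m : ℕ) : Continuous fun x : E n => ell m x := by
  by_cases h : m = 2
  · subst h; exact contDiff_ell_two.continuous
  · simp only [ell, h, if_false]
    exact (contDiff_disc m).continuous.sqrt

lemma contDiffAt_ell {n m : ℕ} {x : E n} (h : 0 < disc m x) :
    ContDiffAt ℝ ∞ (fun x : E n => ell m x) x := by
  by_cases h2 : m = 2
  · subst h2; exact contDiff_ell_two.contDiffAt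
  · simp only [ell, h2, if_false]
    exact (contDiff_disc m).contDiffAt.sqrt h.ne'

/-- The numerator of the function `λ_1^{(m)}` (for `m < k`) or `ν_m` (for `m ≥ k`). -/
def num {n : ℕ} (k m : ℕ) (x : E n) : ℝ := if m < k then ell m x else nsq m x

/-- The Hamiltonian vector of the function with numerator `num k m`: an infinitesimal rotation in
the plane spanned by the real and imaginary parts of `(x_1, …, x_m)`, or an infinitesimal
multiplication of `(x_1, …, x_m)` by phases. -/
def gen {n : ℕ} (k m : ℕ) (x : E n) : E n :=
  if m < k then (Complex.I / ell m x) • trunc m ((nsq m x : ℂ) • x - sqs m x • cj x)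
  else Complex.I • trunc m x

lemma Phi_apply {n k : ℕ} {lam : ℝ} (hlam : 0 < lam) {p : PSpace n}
    {x : E n} (hx : IsRep p x) (j : Fin (n - 2)) :
    Phi lam k p j = lam * num k (j + 2) x / ‖x‖ ^ 2 := by
  have := j.2
  rw [Phi, num]
  split_ifs
  · exact gcFun_one hlam (by omega) (by omega) hx
  · exact nu_apply lam _ hx

lemma continuous_num {n : ℕ} (k m : ℕ) : Continuous fun x : E n => num k m x := by
  unfold num
  split_ifs
  · exact continuous_ell m
  · exact (contDiff_nsq m).continuous

lemma continuous_Phi {n : ℕ} {lam : ℝ} (hlam : 0 < lam) (k : ℕ) :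
    Continuous (Phi (n := n) lam k) := by
  refine continuous_pi fun j => continuous_of_affine (fun p x hx => Phi_apply hlam hx j) ?_
  refine ContinuousOn.div ((continuous_const.mul (continuous_num k _)).continuousOn)
    (by fun_prop) fun x hx => ?_
  exact pow_ne_zero 2 (norm_ne_zero_iff.2 hx)

lemma inner_trunc_disc {n : ℕ} (m : ℕ) (x : E n) :
    inner ℂ x (trunc m ((nsq m x : ℂ) • x - sqs m x • cj x)) = disc m x := by
  rw [inner_trunc_right, sub_eq_add_neg, ← neg_smul, bil_add_right, bil_smul_right,
    bil_smul_right, bil_zero_cj_cj, ← nsq_eq_bil, ← sqs, disc]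
  have := Complex.mul_conj' (sqs m x)
  simp only [RCLike.star_def]
  push_cast
  linear_combination -this

lemma inner_gen {n k m : ℕ} (hm : 2 ≤ m) (hmn : m ≤ n) {x : E n} (h : m < k → 0 < disc m x) :
    inner ℂ x (gen k m x) = Complex.I * num k m x := by
  rw [gen, num]
  split_ifs with hk
  · rw [inner_smul_right, inner_trunc_disc, ← ell_sq hm hmn]
    have : ell m x ≠ 0 := by
      intro h0
      have := h hk
      rw [← ell_sq hm hmn, h0] at this
      simp at this
    have : (ell m x : ℂ) ≠ 0 := by exact_mod_cast this
    push_cast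
    field_simp
  · rw [inner_smul_right, inner_trunc_right, ← nsq_eq_bil]

lemma ell_ne_zero {n m : ℕ} (hm : 2 ≤ m) (hmn : m ≤ n) {x : E n} (h : 0 < disc m x) :
    ell m x ≠ 0 := by
  intro h0
  rw [← ell_sq hm hmn, h0] at h
  simp at h

lemma hasFDerivAt_num {n k m : ℕ} (hm : 2 ≤ m) (hmn : m ≤ n) {x : E n}
    (h : m < k → 0 < disc m x) :
    ∃ L : E n →L[ℝ] ℝ, HasFDerivAt (fun y : E n => num k m y) L x ∧
      ∀ w, L w = 2 * (inner ℂ w (gen k m x)).im := by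
  unfold num gen
  split_ifs with hk
  · have hd := h hk
    have h1 := ((contDiffAt_ell hd).differentiableAt (by simp)).hasFDerivAt
    refine ⟨_, h1, fun w => ?_⟩
    obtain ⟨L, h2, h2'⟩ := hasFDerivAt_disc m x
    have h3 := h1.pow 2
    have h4 : (fun y : E n => disc m y) = (fun y => ell m y) ^ 2 := by
      ext y; exact (ell_sq hm hmn y).symm
    rw [h4] at h2
    have h5 := congrArg (fun L : E n →L[ℝ] ℝ => L w) (h3.unique h2)
    simp [h2', -Complex.coe_smul] at h5
    have h0 := ell_ne_zero hm hmn hd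
    rw [inner_smul_right]
    have e : Complex.I / (ell m x : ℂ) *
        inner ℂ w (trunc m ((nsq m x : ℂ) • x - sqs m x • cj x)) =
        (((ell m x)⁻¹ : ℝ) : ℂ) * (Complex.I *
          inner ℂ w (trunc m ((nsq m x : ℂ) • x - sqs m x • cj x))) := by
      push_cast; ring
    rw [e, Complex.im_ofReal_mul, Complex.I_mul_im]
    field_simp
    linarith
  · obtain ⟨L, h1, h2⟩ := hasFDerivAt_nsq m x
    refine ⟨L, h1, fun w => ?_⟩
    rw [h2, inner_smul_right, Complex.I_mul_im]

lemma bil_trunc_lt {n k m : ℕ} (t : ℂ) (h : m < k) (x y : E n) :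
    bil k t x (trunc m y) = bil (m + 1) 0 x y := by
  refine Finset.sum_congr rfl fun i _ => ?_
  rw [wt_zero, trunc_apply]
  split_ifs with hi
  · rw [wt_of_lt t (by omega)]
  · simp

lemma bil_trunc_ge {n k m : ℕ} (t : ℂ) (h : k ≤ m) (x y : E n) :
    bil k t x (trunc m y) = bil k t x y := by
  refine Finset.sum_congr rfl fun i _ => ?_
  rw [trunc_apply]
  split_ifs with hi
  · rfl
  · have : wt k t i = 0 := by
      rw [wt, if_neg (by omega), if_neg (by omega)]
    simp [this]

lemma bil_gen {n k m : ℕ} {t : ℂ} {x : E n} (hx : bil k t x x = 0) : bil k t x (gen k m x) = 0 := by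
  rw [gen]
  split_ifs with h
  · rw [bil_smul_right, bil_trunc_lt t h, sub_eq_add_neg, ← neg_smul, bil_add_right,
      bil_smul_right, bil_smul_right, bil_comm _ _ x (cj x), ← nsq_eq_bil, ← sqs]
    ring
  · rw [bil_smul_right, bil_trunc_ge t (by omega), hx, mul_zero]

lemma gen_apply_of_le {n k m : ℕ} (x : E n) {i : Fin n} (h : m ≤ i) : gen k m x i = 0 := by
  rw [gen]
  split_ifs <;> simp [show ¬ (i : ℕ) < m by omega]

lemma gen_apply_ne_zero {n k m : ℕ} (hm : 2 ≤ m) (hmn : m ≤ n) {x : E n}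
    (h : 0 < disc m x) {i : Fin n} (hi : (i : ℕ) < m) (hxi : x i ≠ 0) : gen k m x i ≠ 0 := by
  rw [gen]
  split_ifs with hk
  · intro h0
    have h1 := ell_ne_zero hm hmn h
    simp [hi, h1, sub_eq_zero] at h0
    have h2 := congrArg norm h0
    rw [norm_mul, norm_mul, Complex.norm_real, Real.norm_of_nonneg (nsq_nonneg m x),
      RCLike.norm_conj] at h2
    exact (norm_sqs_lt h).ne (mul_right_cancel₀ (norm_ne_zero_iff.2 hxi) h2).symm
  · simp [hi, hxi]

lemma inner_trunc_trunc {n m m' : ℕ} (h : m ≤ m') (x y : E n) :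
    inner ℂ (trunc m x) (trunc m' y) = bil (m + 1) 0 (cj x) y := by
  rw [← inner_trunc_right, inner_eq_sum, inner_eq_sum]
  refine Finset.sum_congr rfl fun i _ => ?_
  rw [trunc_apply, trunc_apply, trunc_apply]
  by_cases hi : (i : ℕ) < m
  · simp [hi, hi.trans_le h]
  · simp [hi]

lemma cj_sub_smul {n : ℕ} (a b : ℂ) (x y : E n) :
    cj (a • x - b • y) = star a • cj x - star b • cj y := by
  ext i; simp

/-- The Hamiltonian vectors span an isotropic subspace. -/
lemma im_inner_gen_gen {n k : ℕ} (m m' : ℕ) (x : E n) :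
    (inner ℂ (gen k m x) (gen k m' x)).im = 0 := by
  wlog h : m ≤ m' generalizing m m'
  · have := this m' m (by omega)
    rw [← inner_conj_symm, Complex.conj_im, this, neg_zero]
  have hP := nsq_eq_bil m x
  -- in the first `m` coordinates the second vector is a combination of `x` and its conjugate
  have key : ∀ (q : ℝ) (z : ℂ), (inner ℂ (trunc m ((nsq m x : ℂ) • x - sqs m x • cj x))
      (trunc m' ((q : ℂ) • x - z • cj x))) = ((q * disc m x : ℝ) : ℂ) := by
    intro q z
    rw [inner_trunc_trunc h, cj_sub_smul, cj_cj, sub_eq_add_neg, sub_eq_add_neg, ← neg_smul,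
      ← neg_smul, bil_add_left, bil_add_right, bil_add_right]
    simp only [bil_smul_left, bil_smul_right, bil_zero_cj_cj, ← hP, bil_comm _ _ x (cj x)]
    have := Complex.mul_conj' (sqs m x)
    simp only [RCLike.star_def, Complex.conj_ofReal, disc]
    rw [show bil (m + 1) 0 x x = sqs m x from rfl]
    push_cast
    linear_combination -(q : ℂ) * this
  rw [gen, gen]
  split_ifs with h1 h2 h2
  · rw [inner_smul_left, inner_smul_right, key]
    have : (starRingEnd ℂ) (Complex.I / ell m x) * (Complex.I / ell m' x *
        ((nsq m' x * disc m x : ℝ) : ℂ)) =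
        (((ell m x)⁻¹ * (ell m' x)⁻¹ * (nsq m' x * disc m x) : ℝ) : ℂ) := by
      simp only [map_div₀, Complex.conj_I, Complex.conj_ofReal]
      push_cast
      linear_combination (-(ell m x : ℂ)⁻¹ * (ell m' x : ℂ)⁻¹ * (nsq m' x * disc m x)) *
        Complex.I_sq
    rw [this, Complex.ofReal_im]
  · have := key 1 0
    rw [Complex.ofReal_one, one_smul, zero_smul, sub_zero] at this
    rw [inner_smul_left, inner_smul_right, this]
    have : (starRingEnd ℂ) (Complex.I / ell m x) * (Complex.I * ((1 * disc m x : ℝ) : ℂ)) =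
        (((ell m x)⁻¹ * disc m x : ℝ) : ℂ) := by
      simp only [map_div₀, Complex.conj_I, Complex.conj_ofReal]
      push_cast
      linear_combination (-(ell m x : ℂ)⁻¹ * disc m x) * Complex.I_sq
    rw [this, Complex.ofReal_im]
  · omega
  · rw [inner_smul_left, inner_smul_right, inner_trunc_trunc h, ← hP, ← mul_assoc,
      Complex.conj_I, neg_mul, Complex.I_mul_I, neg_neg, one_mul, Complex.ofReal_im]

lemma Generic.disc_pos {n m : ℕ} (hm : 2 ≤ m) (hn : 2 ≤ n) {x : E n} (h : Generic x) :
    0 < disc m x := by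
  refine lt_of_lt_of_le ?_ (disc_mono hm x)
  have h1 := h.1
  rw [coord_of_lt x (by omega : 0 < n), coord_of_lt x (by omega : 1 < n)] at h1
  rw [disc_two hn]
  positivity

lemma fsForm_gen_gen {n k m m' : ℕ} (lam : ℝ) {x : E n} {a b : ℝ}
    (h : inner ℂ x (gen k m x) = Complex.I * a) (h' : inner ℂ x (gen k m' x) = Complex.I * b) :
    fsForm lam x (gen k m x) (gen k m' x) = 0 := by
  rw [fsForm, ← inner_conj_symm (gen k m x) x, h, h', Complex.sub_im, ← Complex.ofReal_pow,
    Complex.im_ofReal_mul, im_inner_gen_gen]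
  simp

/-- The Hamiltonian vectors are linearly independent modulo `x`: their matrix of coordinates is
triangular. -/
lemma gen_independent {n k : ℕ} {x : E n} (hn : 3 ≤ n) (hx : Generic x) (c : Fin (n - 2) → ℝ)
    (a : ℂ) (h : ∑ j, c j • gen k ((j : ℕ) + 2) x = a • x) : c = 0 := by
  have hcoord : ∀ i : Fin n, ∑ j, (c j : ℂ) * gen k ((j : ℕ) + 2) x i = a * x i := by
    intro i
    have := congrArg (fun v : E n => v i) h
    simpa using this
  have ha : a = 0 := by
    have h1 := hcoord ⟨n - 1, by omega⟩
    rw [Finset.sum_eq_zero] at h1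
    · exact (mul_eq_zero.1 h1.symm).resolve_right (hx.2 _)
    · intro j _
      have := j.2
      rw [gen_apply_of_le _ (by simp only; omega), mul_zero]
  by_contra hne
  obtain ⟨j0, hj0⟩ := Function.ne_iff.1 hne
  obtain ⟨j, hj, hmax⟩ := Finset.exists_max_image (Finset.univ.filter fun j => c j ≠ 0)
    (fun j => (j : ℕ)) ⟨j0, by simpa using hj0⟩
  have hjn := j.2
  have h1 := hcoord ⟨j + 1, by omega⟩
  rw [ha, zero_mul, Finset.sum_eq_single j] at h1
  · have hcj : (c j : ℂ) ≠ 0 := by simpa using hj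
    have hg : gen k ((j : ℕ) + 2) x ⟨j + 1, by omega⟩ ≠ 0 :=
      gen_apply_ne_zero (by omega) (by omega) (hx.disc_pos (by omega) (by omega))
        (by simp only; omega) (hx.2 _)
    exact mul_ne_zero hcj hg h1
  · intro b _ hb
    by_cases hcb : c b = 0
    · rw [hcb, Complex.ofReal_zero, zero_mul]
    · have hle : (b : ℕ) ≤ j := hmax b (by simpa using hcb)
      have hlt : (b : ℕ) < j := lt_of_le_of_ne hle fun h => hb (Fin.ext h)
      rw [gen_apply_of_le _ (by simp only; omega), mul_zero]
  · simp

/-- The generic points are regular, and there the Hamiltonian vectors `gen k m` are tangent to the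
fibre, orthogonal for the symplectic form, and independent. -/
lemma isIntegrableSystem_quad {n k : ℕ} (hk : 3 ≤ k) (hkn : k ≤ n) {lam : ℝ} (hlam : 0 < lam)
    (t : ℂ) : IsIntegrableSystem lam (quad n k t) (Phi lam k) where
  dim p hp x hx := by
    obtain ⟨h1, h2⟩ := hx.mem_regLocus_iff.1 hp
    exact finrank_tangent h1 h2
  continuousOn := (continuous_Phi hlam k).continuousOn
  integrable := by
    refine ⟨_, isOpenDenseIn_of_generic hk hkn generic_smul isOpen_generic fun _ _ h => h, ?_, ?_⟩
    · rintro p ⟨hp, hg⟩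
      refine (isRep_rep p).mem_regLocus_iff.2 ⟨hp _ (isRep_rep p), ?_⟩
      refine dPoly_quad_ne_zero ⟨0, by omega⟩ ?_ (hg.2 _)
      rw [wt_of_lt t (by simp only; omega)]
      exact one_ne_zero
    rintro p ⟨hp, hg⟩ x hx
    rw [hx.apply_rep generic_smul] at hg
    have hxc := hx.mem_zeroLocus_iff.1 hp
    have hx0 : ‖x‖ ≠ 0 := norm_ne_zero_iff.2 hxc.1
    have hd : ∀ m, 2 ≤ m → 0 < disc m x := fun m hm => hg.disc_pos hm (by omega)
    have hgen : ∀ j : Fin (n - 2), inner ℂ x (gen k ((j : ℕ) + 2) x) =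
        Complex.I * num k ((j : ℕ) + 2) x := fun j =>
      inner_gen (by omega) (by have := j.2; omega) fun _ => hd _ (by omega)
    have hL : ∀ j : Fin (n - 2), ∃ L : E n →L[ℝ] ℝ,
        HasFDerivAt (lift fun q => Phi lam k q j) L x ∧
          ∀ w, L w = fsForm lam x w (gen k ((j : ℕ) + 2) x) := fun j =>
      hasFDerivAt_moment lam (fun q y hy => Phi_apply hlam hy j) hxc.1
        (hasFDerivAt_num (by omega) (by have := j.2; omega) fun _ => hd _ (by omega)) (hgen j)
    choose L hL1 hL2 using hL
    -- the Hamiltonian vectors are moved into the tangent space along the line through `x`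
    let a : Fin (n - 2) → ℂ := fun j => -(Complex.I * num k ((j : ℕ) + 2) x / (‖x‖ : ℂ) ^ 2)
    let ξ : Fin (n - 2) → E n := fun j => gen k ((j : ℕ) + 2) x + a j • x
    have hξ : ∀ j, ξ j ∈ tangent (quad n k t) x := by
      intro j
      rw [mem_tangent_iff]
      constructor
      · have : (‖x‖ : ℂ) ≠ 0 := by exact_mod_cast hx0
        rw [inner_add_right, inner_smul_right, hgen, inner_self_eq]
        simp only [a]
        field_simp
        ring
      · rw [map_add, map_smul, dPoly_self hxc, dPoly_quad, bil_gen (mem_cone_quad.1 hxc).2]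
        simp
    have hform : ∀ w j, fsForm lam x w (ξ j) = fsForm lam x w (gen k ((j : ℕ) + 2) x) := by
      intro w j
      have := fsForm_add_smul lam x w (gen k ((j : ℕ) + 2) x) 0 (a j)
      rwa [zero_smul, add_zero] at this
    refine ⟨fun j => ?_, L, ξ, fun j => (hL1 j).hasFDerivWithinAt, ?_, fun j => ⟨hξ j, ?_⟩, ?_⟩
    · refine ContDiffAt.contDiffWithinAt ?_
      have hn : ContDiffAt ℝ ∞ (fun y : E n => num k ((j : ℕ) + 2) y) x := by
        unfold num
        split_ifs
        · exact contDiffAt_ell (hd _ (by omega))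
        · exact (contDiff_nsq _).contDiffAt
      have h2 : ContDiffAt ℝ ∞ (fun y : E n => lam * num k ((j : ℕ) + 2) y / ‖y‖ ^ 2) x :=
        (contDiffAt_const.mul hn).div (contDiff_norm_sq ℝ).contDiffAt (pow_ne_zero 2 hx0)
      refine h2.congr_of_eventuallyEq ?_
      filter_upwards [isOpen_ne.mem_nhds hxc.1] with y hy
      rw [lift_apply _ (isRep_mk hy), Phi_apply hlam (isRep_mk hy) j]
    · rw [Fintype.linearIndependent_iff]
      intro c hc
      set X : E n := ∑ j, c j • ξ j with hX
      have hXt : X ∈ tangent (quad n k t) x :=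
        Submodule.sum_mem _ fun j _ => Submodule.smul_of_tower_mem _ (c j) (hξ j)
      have h1 := LinearMap.congr_fun hc
        ⟨Complex.I • X, Submodule.smul_mem _ Complex.I hXt⟩
      have h1' : ∑ j, c j * L j (Complex.I • X) = 0 := by simpa using h1
      have h2 : fsForm lam x (Complex.I • X) (∑ j, c j • ξ j) = 0 := by
        rw [fsForm_sum_right]
        simpa only [hform, ← hL2] using h1'
      rw [← hX] at h2
      rw [fsForm_self_I lam (mem_tangent_iff.1 hXt).1, neg_eq_zero] at h2
      have hX0 : X = 0 := by
        have h3 : 2 * lam / ‖x‖ ^ 4 * ‖x‖ ^ 2 ≠ 0 := by positivity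
        rw [← mul_assoc] at h2
        simpa using (mul_eq_zero.1 h2).resolve_left h3
      have h4 : ∑ j, c j • gen k ((j : ℕ) + 2) x = (-∑ j, (c j : ℂ) * a j) • x := by
        have h5 : X = ∑ j, c j • gen k ((j : ℕ) + 2) x + (∑ j, (c j : ℂ) * a j) • x := by
          simp only [hX, ξ, smul_add, Finset.sum_add_distrib, Finset.sum_smul, mul_smul,
            Complex.coe_smul]
        rw [hX0] at h5
        rw [neg_smul]
        exact eq_neg_of_add_eq_zero_left h5.symm
      intro j
      exact congrFun (gen_independent (by omega) hg c _ h4) j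
    · intro w _
      rw [hform, hL2]
    · intro i j
      have h1 := fsForm_add_smul lam x (gen k ((i : ℕ) + 2) x) (gen k ((j : ℕ) + 2) x) (a i) (a j)
      exact h1.trans (fsForm_gen_gen lam (hgen i) (hgen j))

/-! ### Normality of the quadric cone of rank three -/

/-- A ring that is a direct summand, as a module over itself, of an integrally closed domain is
an integrally closed domain. -/
lemma isIntegrallyClosed_of_retract {R S : Type*} [CommRing R] [CommRing S] [IsDomain S]
    [IsIntegrallyClosed S] (ι : R →+* S) (ρ : S →+ R) (h : ∀ r s, ρ (ι r * s) = r * ρ s)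
    (h1 : ρ 1 = 1) : IsDomain R ∧ IsIntegrallyClosed R := by
  have hρ : ∀ r, ρ (ι r) = r := fun r => by rw [← mul_one (ι r), h, h1, mul_one]
  have hinj : Function.Injective ι := Function.LeftInverse.injective hρ
  have hdom : IsDomain R := hinj.isDomain ι
  refine ⟨hdom, (isIntegrallyClosed_iff (FractionRing R)).2 fun {x} hx => ?_⟩
  let ψ : FractionRing R →+* FractionRing S :=
    IsFractionRing.lift (A := R) (g := (algebraMap S (FractionRing S)).comp ι)
      ((IsFractionRing.injective S (FractionRing S)).comp hinj)
  have hψ : ∀ r, ψ (algebraMap R (FractionRing R) r) = algebraMap S (FractionRing S) (ι r) :=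
    fun r => IsFractionRing.lift_algebraMap _ r
  have hx' : IsIntegral S (ψ x) := hx.map_of_comp_eq ι ψ (by ext r; exact (hψ r).symm)
  obtain ⟨s, hs⟩ := (isIntegrallyClosed_iff (FractionRing S)).1 inferInstance hx'
  obtain ⟨p, q, hq, rfl⟩ := IsFractionRing.div_surjective (A := R) x
  have hq0 : q ≠ 0 := nonZeroDivisors.ne_zero hq
  have hq1 : algebraMap S (FractionRing S) (ι q) ≠ 0 := by
    rw [Ne, IsFractionRing.to_map_eq_zero_iff, map_eq_zero_iff ι hinj]
    exact hq0
  rw [map_div₀, hψ, hψ, eq_div_iff hq1, ← map_mul] at hs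
  have hs' := IsFractionRing.injective S (FractionRing S) hs
  refine ⟨ρ s, ?_⟩
  rw [eq_div_iff (by rwa [Ne, IsFractionRing.to_map_eq_zero_iff]), ← map_mul, ← hρ p, ← hs',
    mul_comm s, h, mul_comm]

section Veronese

open MvPolynomial

variable {m : ℕ} {R : Type*} [CommRing R]

/-- The image of the monomial `s^a t^b` under the projection of `ℂ[s, t]` onto the subring of
even polynomials `ℂ[z, u, v] / (z² - u v)`, where `u = s²`, `v = t²` and `z = s t`. -/
def evenMonomial (z u v : R) (a b : ℕ) : R :=
  if Even a ∧ Even b then u ^ (a / 2) * v ^ (b / 2)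
  else if ¬ Even a ∧ ¬ Even b then z * (u ^ (a / 2) * v ^ (b / 2)) else 0

lemma evenMonomial_add_two_left (z u v : R) (a b : ℕ) :
    evenMonomial z u v (a + 2) b = u * evenMonomial z u v a b := by
  have h : Even (a + 2) ↔ Even a := by simp [Nat.even_add]
  have h2 : (a + 2) / 2 = a / 2 + 1 := by omega
  simp only [evenMonomial, h, h2]
  split_ifs <;> ring

lemma evenMonomial_add_two_right (z u v : R) (a b : ℕ) :
    evenMonomial z u v a (b + 2) = v * evenMonomial z u v a b := by
  have h : Even (b + 2) ↔ Even b := by simp [Nat.even_add]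
  have h2 : (b + 2) / 2 = b / 2 + 1 := by omega
  simp only [evenMonomial, h, h2]
  split_ifs <;> ring

lemma evenMonomial_add_one {z u v : R} (hz : z ^ 2 = u * v) (a b : ℕ) :
    evenMonomial z u v (a + 1) (b + 1) = z * evenMonomial z u v a b := by
  have ha : Even (a + 1) ↔ ¬ Even a := by simp [Nat.even_add_one]
  have hb : Even (b + 1) ↔ ¬ Even b := by simp [Nat.even_add_one]
  simp only [evenMonomial, ha, hb, not_not]
  by_cases h1 : Even a <;> by_cases h2 : Even b
  · have e1 : (a + 1) / 2 = a / 2 := by obtain ⟨r, hr⟩ := h1; omega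
    have e2 : (b + 1) / 2 = b / 2 := by obtain ⟨r, hr⟩ := h2; omega
    simp [h1, h2, e1, e2]
  · simp [h1, h2]
  · simp [h1, h2]
  · have e1 : (a + 1) / 2 = a / 2 + 1 := by
      obtain ⟨r, hr⟩ := Nat.not_even_iff_odd.1 h1; omega
    have e2 : (b + 1) / 2 = b / 2 + 1 := by
      obtain ⟨r, hr⟩ := Nat.not_even_iff_odd.1 h2; omega
    simp only [h1, h2, e1, e2, not_false_eq_true, and_self, if_true, if_false]
    linear_combination (-(u ^ (a / 2) * v ^ (b / 2))) * hz

/-- The value of the projection onto even polynomials on monomials in `s = Y_0`, `t = Y_1` and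
the parameters `Y_3, …`; the redundant variable `Y_2` is sent to `1`. -/
def retractMonomial (z u v : R) (y : Fin (m + 3) → R) (e : Fin (m + 3) →₀ ℕ) : R :=
  evenMonomial z u v (e 0) (e 1) * ∏ i : Fin (m + 3), if 3 ≤ (i : ℕ) then y i ^ e i else 1

lemma prod_tail_add {y : Fin (m + 3) → R} (d e : Fin (m + 3) →₀ ℕ)
    (hd : ∀ i : Fin (m + 3), 3 ≤ (i : ℕ) → d i = 0) :
    (∏ i : Fin (m + 3), if 3 ≤ (i : ℕ) then y i ^ (d + e) i else 1) =
      ∏ i : Fin (m + 3), if 3 ≤ (i : ℕ) then y i ^ e i else 1 := by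
  refine Finset.prod_congr rfl fun i _ => ?_
  split_ifs with h
  · rw [Finsupp.add_apply, hd i h, zero_add]
  · rfl

variable [Algebra ℂ R]

/-- The projection onto even polynomials. -/
def retractMap (z u v : R) (y : Fin (m + 3) → R) : MvPolynomial (Fin (m + 3)) ℂ →ₗ[ℂ] R :=
  (basisMonomials (Fin (m + 3)) ℂ).constr ℂ (retractMonomial z u v y)

lemma retractMap_monomial (z u v : R) (y : Fin (m + 3) → R) (e : Fin (m + 3) →₀ ℕ) :
    retractMap z u v y (monomial e 1) = retractMonomial z u v y e := by
  have := (basisMonomials (Fin (m + 3)) ℂ).constr_basis ℂ (retractMonomial z u v y) e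
  rwa [coe_basisMonomials] at this

/-- Multiplication by a monomial can be moved out of the projection if this is so on
monomials. -/
lemma retractMap_monomial_mul (z u v : R) (y : Fin (m + 3) → R) (d : Fin (m + 3) →₀ ℕ) (r : R)
    (h : ∀ e, retractMonomial z u v y (d + e) = r * retractMonomial z u v y e)
    (s : MvPolynomial (Fin (m + 3)) ℂ) :
    retractMap z u v y (monomial d 1 * s) = r * retractMap z u v y s := by
  have : (retractMap z u v y) ∘ₗ (LinearMap.mulLeft ℂ (monomial d (1 : ℂ))) =
      (LinearMap.mulLeft ℂ r) ∘ₗ (retractMap z u v y) := by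
    refine (basisMonomials (Fin (m + 3)) ℂ).ext fun e => ?_
    simp only [coe_basisMonomials, LinearMap.comp_apply, LinearMap.mulLeft_apply, monomial_mul,
      mul_one, retractMap_monomial]
    exact h e
  exact LinearMap.congr_fun this s

lemma retractMap_mul {z u v : R} (hz : z ^ 2 = u * v) (y : Fin (m + 3) → R)
    (s : MvPolynomial (Fin (m + 3)) ℂ) :
    retractMap z u v y (X 0 ^ 2 * s) = u * retractMap z u v y s ∧
    retractMap z u v y (X 1 ^ 2 * s) = v * retractMap z u v y s ∧
    retractMap z u v y (X 0 * X 1 * s) = z * retractMap z u v y s ∧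
    ∀ i : Fin (m + 3), 3 ≤ (i : ℕ) →
      retractMap z u v y (X i * s) = y i * retractMap z u v y s := by
  have h01 : (0 : Fin (m + 3)) ≠ 1 := by simp
  have h0 : ∀ i : Fin (m + 3), 3 ≤ (i : ℕ) → i ≠ 0 := by rintro i h rfl; simp at h
  have h1 : ∀ i : Fin (m + 3), 3 ≤ (i : ℕ) → i ≠ 1 := by
    rintro i h rfl; simp at h
  refine ⟨?_, ?_, ?_, fun i hi => ?_⟩
  · rw [X_pow_eq_monomial]
    refine retractMap_monomial_mul _ _ _ _ _ _ (fun e => ?_) s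
    rw [retractMonomial, retractMonomial, prod_tail_add _ _ (fun i hi => by simp [h0 i hi])]
    simp only [Finsupp.add_apply, Finsupp.single_eq_same, Finsupp.single_eq_of_ne h01.symm,
      zero_add, add_comm 2 (e 0)]
    rw [evenMonomial_add_two_left, mul_assoc]
  · rw [X_pow_eq_monomial]
    refine retractMap_monomial_mul _ _ _ _ _ _ (fun e => ?_) s
    rw [retractMonomial, retractMonomial, prod_tail_add _ _ (fun i hi => by simp [h1 i hi])]
    simp only [Finsupp.add_apply, Finsupp.single_eq_same, Finsupp.single_eq_of_ne h01,
      zero_add, add_comm 2 (e 1)]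
    rw [evenMonomial_add_two_right, mul_assoc]
  · have : (X 0 * X 1 : MvPolynomial (Fin (m + 3)) ℂ) =
        monomial (Finsupp.single 0 1 + Finsupp.single 1 1) 1 := by
      rw [X, X, monomial_mul, one_mul]
    rw [this]
    refine retractMap_monomial_mul _ _ _ _ _ _ (fun e => ?_) s
    rw [retractMonomial, retractMonomial,
      prod_tail_add _ _ (fun i hi => by simp [h0 i hi, h1 i hi])]
    simp only [Finsupp.add_apply, Finsupp.single_eq_same, Finsupp.single_eq_of_ne h01,
      Finsupp.single_eq_of_ne h01.symm, zero_add, add_zero, add_comm 1 (e 0), add_comm 1 (e 1)]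
    rw [evenMonomial_add_one hz, mul_assoc]
  · rw [X]
    refine retractMap_monomial_mul _ _ _ _ _ _ (fun e => ?_) s
    have hp : (∏ l : Fin (m + 3), if 3 ≤ (l : ℕ) then
        y l ^ (Finsupp.single i 1 + e : Fin (m + 3) →₀ ℕ) l else 1) =
        y i * ∏ l : Fin (m + 3), if 3 ≤ (l : ℕ) then y l ^ e l else 1 := by
      have h2 : y i = ∏ l : Fin (m + 3), if l = i then y i else 1 := by simp
      rw [h2, ← Finset.prod_mul_distrib]
      refine Finset.prod_congr rfl fun l _ => ?_
      by_cases hl : l = i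
      · subst hl
        simp [hi, pow_add]
      · simp [hl]
    rw [retractMonomial, retractMonomial, hp]
    simp only [Finsupp.add_apply, Finsupp.single_eq_of_ne (h0 i hi).symm,
      Finsupp.single_eq_of_ne (h1 i hi).symm, zero_add]
    ring

end Veronese

lemma quad_three_one (m : ℕ) : quad (m + 3) 3 1 =
    MvPolynomial.X 0 ^ 2 + MvPolynomial.X 1 ^ 2 + MvPolynomial.X 2 ^ 2 := by
  rw [quad_eq, Fin.sum_univ_succ, Fin.sum_univ_succ, Fin.sum_univ_succ]
  have h : ∀ a : ℕ, ¬ (a + 1 + 1 + 1 + 1 < 3) := by omega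
  have h' : ∀ a : ℕ, a + 1 + 1 + 1 + 1 ≠ 3 := by omega
  simp [wt, h, h', add_assoc]

open MvPolynomial in
/-- The quadric cone of rank three is normal: its coordinate ring is the ring of even
polynomials in two variables, with free parameters. -/
lemma quad_three_one_normal (m : ℕ) :
    IsDomain (MvPolynomial (Fin (m + 3)) ℂ ⧸ Ideal.span {quad (m + 3) 3 1}) ∧
    IsIntegrallyClosed (MvPolynomial (Fin (m + 3)) ℂ ⧸ Ideal.span {quad (m + 3) 3 1}) := by
  set R := MvPolynomial (Fin (m + 3)) ℂ ⧸ Ideal.span {quad (m + 3) 3 1} with hR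
  let x : Fin (m + 3) → R := fun i => Ideal.Quotient.mk _ (X i)
  let I' : R := algebraMap ℂ R Complex.I
  have hI : I' ^ 2 = -1 := by rw [← map_pow, Complex.I_sq, map_neg, map_one]
  have hx : x 0 ^ 2 + x 1 ^ 2 + x 2 ^ 2 = 0 := by
    have : Ideal.Quotient.mk (Ideal.span {quad (m + 3) 3 1}) (quad (m + 3) 3 1) = 0 :=
      Ideal.Quotient.eq_zero_iff_mem.2 (Ideal.mem_span_singleton_self _)
    simpa only [map_add, map_pow] using (congrArg (Ideal.Quotient.mk
      (Ideal.span {quad (m + 3) 3 1})) (quad_three_one m)).symm.trans this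
  let u : R := x 1 + I' * x 2
  let v : R := -x 1 + I' * x 2
  have hz : x 0 ^ 2 = u * v := by
    simp only [u, v]
    linear_combination hx - x 2 ^ 2 * hI
  -- the parametrisation of the cone
  let y : Fin (m + 3) → MvPolynomial (Fin (m + 3)) ℂ := fun i =>
    if i = 0 then X 0 * X 1 else if i = 1 then C (1 / 2) * (X 0 ^ 2 - X 1 ^ 2)
    else if i = 2 then C (-Complex.I / 2) * (X 0 ^ 2 + X 1 ^ 2) else X i
  have h10 : (1 : Fin (m + 3)) ≠ 0 := by simp
  have v2 : ((2 : Fin (m + 3)) : ℕ) = 2 := Fin.val_two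
  have h20 : (2 : Fin (m + 3)) ≠ 0 := fun h => by rw [h] at v2; simp at v2
  have h21 : (2 : Fin (m + 3)) ≠ 1 := fun h => by rw [h] at v2; simp at v2
  have hC1 : (C (1 / 2) : MvPolynomial (Fin (m + 3)) ℂ) ^ 2 = C (1 / 4) := by
    rw [← C_pow]; norm_num
  have hC2 : (C (-Complex.I / 2) : MvPolynomial (Fin (m + 3)) ℂ) ^ 2 = -C (1 / 4) := by
    rw [← C_pow, ← C_neg, div_pow, neg_sq, Complex.I_sq]; norm_num
  have hC4 : (C (1 / 4) * 4 : MvPolynomial (Fin (m + 3)) ℂ) = 1 := by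
    rw [show (4 : MvPolynomial (Fin (m + 3)) ℂ) = C 4 from (map_ofNat C 4).symm, ← C_mul]
    norm_num
  have hy : aeval y (quad (m + 3) 3 1) = 0 := by
    rw [quad_three_one]
    simp only [map_add, map_pow, aeval_X, y, h10, h20, h21, if_true, if_false]
    linear_combination (X 0 ^ 2 - X 1 ^ 2) ^ 2 * hC1 + (X 0 ^ 2 + X 1 ^ 2) ^ 2 * hC2 -
      (X 0 * X 1) ^ 2 * hC4
  let ι : R →+* MvPolynomial (Fin (m + 3)) ℂ :=
    Ideal.Quotient.lift _ (aeval y : MvPolynomial (Fin (m + 3)) ℂ →ₐ[ℂ] _).toRingHom (by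
      intro a ha
      obtain ⟨c, rfl⟩ := Ideal.mem_span_singleton.1 ha
      change aeval y (quad (m + 3) 3 1 * c) = 0
      rw [map_mul, hy, zero_mul])
  have hι : ∀ f, ι (Ideal.Quotient.mk _ f) = aeval y f := fun f => rfl
  let ρ := retractMap (x 0) u v x
  have hρ := fun s => retractMap_mul hz x s
  have hsm : ∀ (c : ℂ) (s : MvPolynomial (Fin (m + 3)) ℂ),
      ρ (C c * s) = algebraMap ℂ R c * ρ s := by
    intro c s
    rw [← smul_eq_C_mul, map_smul]
    exact Algebra.smul_def c (ρ s)
  have htwo : algebraMap ℂ R (1 / 2) * 2 = 1 := by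
    rw [show (2 : R) = algebraMap ℂ R 2 from (map_ofNat _ 2).symm, ← map_mul]
    norm_num
  have hItwo : algebraMap ℂ R (-Complex.I / 2) = -I' * algebraMap ℂ R (1 / 2) := by
    rw [← map_neg, ← map_mul]; congr 1; ring
  refine isIntegrallyClosed_of_retract ι ρ.toAddMonoidHom (fun r => ?_) ?_
  · obtain ⟨f, rfl⟩ := Ideal.Quotient.mk_surjective r
    change ∀ s, ρ (ι _ * s) = _ * ρ s
    induction f using MvPolynomial.induction_on with
    | C a =>
      intro s
      rw [hι, aeval_C]
      exact hsm a s
    | add p q hp hq =>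
      intro s
      rw [map_add, map_add, add_mul, map_add, hp, hq, add_mul]
    | mul_X p i hp =>
      intro s
      have e : ι (Ideal.Quotient.mk _ (p * X i)) =
          ι (Ideal.Quotient.mk _ p) * ι (Ideal.Quotient.mk _ (X i)) := by rw [map_mul, map_mul]
      rw [e, mul_assoc, hp, map_mul (Ideal.Quotient.mk _), mul_assoc]
      congr 1
      rw [hι, aeval_X]
      change ρ (y i * s) = x i * ρ s
      simp only [y]
      split_ifs with h0 h1 h2
      · rw [h0]; exact (hρ s).2.2.1
      · rw [h1, mul_assoc, hsm, sub_mul, map_sub, (hρ s).1, (hρ s).2.1]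
        change _ * (u * ρ s - v * ρ s) = x 1 * ρ s
        simp only [u, v]
        linear_combination x 1 * ρ s * htwo
      · rw [h2, mul_assoc, hsm, add_mul, map_add, (hρ s).1, (hρ s).2.1, hItwo]
        change _ * (u * ρ s + v * ρ s) = x 2 * ρ s
        simp only [u, v]
        linear_combination x 2 * ρ s * htwo - 2 * x 2 * ρ s * algebraMap ℂ R (1 / 2) * hI
      · refine (hρ s).2.2.2 i ?_
        have a0 : (i : ℕ) ≠ 0 := fun h => h0 (Fin.ext h)
        have a1 : (i : ℕ) ≠ 1 := fun h => h1 (Fin.ext (by simpa using h))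
        have a2 : (i : ℕ) ≠ 2 := fun h => h2 (Fin.ext (h.trans v2.symm))
        omega
  · change ρ 1 = 1
    have := retractMap_monomial (x 0) u v x 0
    rw [retractMonomial] at this
    simpa [evenMonomial] using this

/-! ### The torus action on the quadric of rank three -/

/-- The orthonormal basis of common eigenvectors of the torus: the eigenvectors of the rotations
of the first two coordinates, and the remaining standard basis vectors. -/
lemma exists_torusBasis {n : ℕ} (hn : 3 ≤ n) : ∃ b : OrthonormalBasis (Fin n) ℂ (E n),
    (∀ x, inner ℂ (b ⟨0, by omega⟩) x =
      (coord x 0 - Complex.I * coord x 1) / (Real.sqrt 2 : ℂ)) ∧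
    (∀ x, inner ℂ (b ⟨1, by omega⟩) x =
      (coord x 0 + Complex.I * coord x 1) / (Real.sqrt 2 : ℂ)) ∧
    ∀ i : Fin n, 2 ≤ (i : ℕ) → ∀ x, inner ℂ (b i) x = x i := by
  set i0 : Fin n := ⟨0, by omega⟩ with hi0
  set i1 : Fin n := ⟨1, by omega⟩ with hi1
  have h01 : i0 ≠ i1 := by simp [i0, i1]
  have h2 : ((Real.sqrt 2 : ℝ) : ℂ) ^ 2 = 2 := by
    rw [← Complex.ofReal_pow, Real.sq_sqrt (by norm_num)]; norm_num
  have h20 : ((Real.sqrt 2 : ℝ) : ℂ) ≠ 0 := by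
    intro h; rw [h] at h2; norm_num at h2
  let v : Fin n → E n := fun i =>
    if i = i0 then ((Real.sqrt 2 : ℂ)⁻¹) • (EuclideanSpace.single i0 1 +
      Complex.I • EuclideanSpace.single i1 1)
    else if i = i1 then ((Real.sqrt 2 : ℂ)⁻¹) • (EuclideanSpace.single i0 1 -
      Complex.I • EuclideanSpace.single i1 1)
    else EuclideanSpace.single i 1
  have hsq : (starRingEnd ℂ) (Real.sqrt 2 : ℂ)⁻¹ = (Real.sqrt 2 : ℂ)⁻¹ := by
    rw [map_inv₀, Complex.conj_ofReal]
  have hv0 : ∀ x : E n, inner ℂ (v i0) x = (x i0 - Complex.I * x i1) / (Real.sqrt 2 : ℂ) := by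
    intro x
    simp only [v, if_true, inner_smul_left, inner_add_left, EuclideanSpace.inner_single_left, hsq]
    simp
    ring
  have hv1 : ∀ x : E n, inner ℂ (v i1) x = (x i0 + Complex.I * x i1) / (Real.sqrt 2 : ℂ) := by
    intro x
    simp only [v, h01.symm, if_true, if_false, inner_smul_left, inner_sub_left,
      EuclideanSpace.inner_single_left, hsq]
    simp
    ring
  have hvi : ∀ i, i ≠ i0 → i ≠ i1 → ∀ x : E n, inner ℂ (v i) x = x i := by
    intro i h0 h1 x
    simp [v, h0, h1, EuclideanSpace.inner_single_left]
  have hinv : ((Real.sqrt 2 : ℝ) : ℂ)⁻¹ * ((Real.sqrt 2 : ℝ) : ℂ)⁻¹ = 1 / 2 := by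
    rw [← mul_inv, ← pow_two, h2]; norm_num
  have hon : Orthonormal ℂ v := by
    rw [orthonormal_iff_ite]
    intro i j
    by_cases hi : i = i0
    · subst hi
      rw [hv0]
      by_cases hj : j = i0
      · subst hj
        simp [v, h01, h01.symm, div_eq_mul_inv]
        linear_combination 2 * hinv - (((Real.sqrt 2 : ℝ) : ℂ)⁻¹ * ((Real.sqrt 2 : ℝ) : ℂ)⁻¹) *
          Complex.I_sq
      · by_cases hj1 : j = i1
        · subst hj1
          simp [v, h01, h01.symm, div_eq_mul_inv]
          linear_combination ((Real.sqrt 2 : ℝ) : ℂ)⁻¹ * Complex.I_sq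
        · simp [v, hj, hj1, Ne.symm hj, Ne.symm hj1]
    · by_cases hi1 : i = i1
      · subst hi1
        rw [hv1]
        by_cases hj : j = i0
        · subst hj
          simp [v, h01, h01.symm, div_eq_mul_inv]
          linear_combination ((Real.sqrt 2 : ℝ) : ℂ)⁻¹ * Complex.I_sq
        · by_cases hj1 : j = i1
          · subst hj1
            simp [v, h01, h01.symm, div_eq_mul_inv]
            linear_combination 2 * hinv - (((Real.sqrt 2 : ℝ) : ℂ)⁻¹ *
              ((Real.sqrt 2 : ℝ) : ℂ)⁻¹) * Complex.I_sq
          · simp [v, hj, hj1, Ne.symm hj, Ne.symm hj1]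
      · rw [hvi i hi hi1]
        by_cases hj : j = i0
        · subst hj
          simp [v, hi, hi1]
        · by_cases hj1 : j = i1
          · subst hj1
            simp [v, hi, hi1, h01.symm]
          · simp [v, hj, hj1]
  obtain ⟨b, hb⟩ := Orthonormal.exists_orthonormalBasis_extension_of_card_eq (𝕜 := ℂ)
    (E := E n) (ι := Fin n) (by simp) (v := v) (s := Set.univ)
    (hon.comp _ Subtype.val_injective)
  have hb' : ∀ i, b i = v i := fun i => hb i trivial
  refine ⟨b, fun x => ?_, fun x => ?_, fun i hi x => ?_⟩
  · rw [hb', hv0, coord_of_lt x (by omega : 0 < n), coord_of_lt x (by omega : 1 < n)]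
  · rw [hb', hv1, coord_of_lt x (by omega : 0 < n), coord_of_lt x (by omega : 1 < n)]
  · rw [hb', hvi]
    · rintro rfl; simp [i0] at hi
    · rintro rfl; simp [i1] at hi

/-- The weights of the torus: the first circle rotates the plane of the first two coordinates,
the others multiply initial segments of coordinates by phases. -/
def torusWt {n : ℕ} (i : Fin n) (j : Fin (n - 2)) : ℤ :=
  if (j : ℕ) = 0 then if (i : ℕ) = 0 then 1 else if (i : ℕ) = 1 then -1 else 0
  else if (i : ℕ) < j + 2 then 1 else 0

/-- The character by which the torus acts on the `i`-th basis vector. -/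
def torusChar {n : ℕ} (s : Fin (n - 2) → ℂˣ) (i : Fin n) : ℂˣ := ∏ j, s j ^ torusWt i j

lemma torusChar_zero {n : ℕ} (hn : 3 ≤ n) (s : Fin (n - 2) → ℂˣ) :
    torusChar s ⟨0, by omega⟩ = s ⟨0, by omega⟩ * torusChar s ⟨2, by omega⟩ := by
  rw [torusChar, torusChar, Finset.prod_eq_mul_prod_sdiff_singleton_of_mem
    (Finset.mem_univ (⟨0, by omega⟩ : Fin (n - 2))),
    Finset.prod_eq_mul_prod_sdiff_singleton_of_mem
    (Finset.mem_univ (⟨0, by omega⟩ : Fin (n - 2)))]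
  have h : ∀ j ∈ Finset.univ \ {(⟨0, by omega⟩ : Fin (n - 2))},
      s j ^ torusWt (⟨0, by omega⟩ : Fin n) j = s j ^ torusWt (⟨2, by omega⟩ : Fin n) j := by
    intro j hj
    have hj0 : (j : ℕ) ≠ 0 := fun h => by simp [Fin.ext_iff, h] at hj
    simp [torusWt, hj0, Nat.pos_of_ne_zero hj0]
  rw [Finset.prod_congr rfl h]
  simp [torusWt]

lemma torusChar_one {n : ℕ} (hn : 3 ≤ n) (s : Fin (n - 2) → ℂˣ) :
    torusChar s ⟨1, by omega⟩ = (s ⟨0, by omega⟩)⁻¹ * torusChar s ⟨2, by omega⟩ := by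
  rw [torusChar, torusChar, Finset.prod_eq_mul_prod_sdiff_singleton_of_mem
    (Finset.mem_univ (⟨0, by omega⟩ : Fin (n - 2))),
    Finset.prod_eq_mul_prod_sdiff_singleton_of_mem
    (Finset.mem_univ (⟨0, by omega⟩ : Fin (n - 2)))]
  have h : ∀ j ∈ Finset.univ \ {(⟨0, by omega⟩ : Fin (n - 2))},
      s j ^ torusWt (⟨1, by omega⟩ : Fin n) j = s j ^ torusWt (⟨2, by omega⟩ : Fin n) j := by
    intro j hj
    have hj0 : (j : ℕ) ≠ 0 := fun h => by simp [Fin.ext_iff, h] at hj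
    simp [torusWt, hj0, Nat.pos_of_ne_zero hj0]
  rw [Finset.prod_congr rfl h]
  simp [torusWt]

lemma torusChar_succ {n : ℕ} (s : Fin (n - 2) → ℂˣ) {j : ℕ} (hj1 : 1 ≤ j) (hj : j < n - 2) :
    torusChar s ⟨j + 1, by omega⟩ = s ⟨j, hj⟩ * torusChar s ⟨j + 2, by omega⟩ := by
  rw [torusChar, torusChar, Finset.prod_eq_mul_prod_sdiff_singleton_of_mem
    (Finset.mem_univ (⟨j, hj⟩ : Fin (n - 2))),
    Finset.prod_eq_mul_prod_sdiff_singleton_of_mem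
    (Finset.mem_univ (⟨j, hj⟩ : Fin (n - 2)))]
  have h : ∀ l ∈ Finset.univ \ {(⟨j, hj⟩ : Fin (n - 2))},
      s l ^ torusWt (⟨j + 1, by omega⟩ : Fin n) l =
        s l ^ torusWt (⟨j + 2, by omega⟩ : Fin n) l := by
    intro l hl
    have hl0 : (l : ℕ) ≠ j := fun h => by simp [Fin.ext_iff, h] at hl
    simp only [torusWt]
    congr 1
    split_ifs <;> omega
  rw [Finset.prod_congr rfl h]
  simp [torusWt, show j ≠ 0 by omega]

lemma torusChar_last {n : ℕ} (hn : 3 ≤ n) (s : Fin (n - 2) → ℂˣ) :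
    torusChar s ⟨n - 1, by omega⟩ = 1 := by
  rw [torusChar]
  refine Finset.prod_eq_one fun j _ => ?_
  have := j.2
  have : torusWt (⟨n - 1, by omega⟩ : Fin n) j = 0 := by
    simp only [torusWt]
    split_ifs <;> omega
  rw [this, zpow_zero]

lemma inner_torusAct {n : ℕ} (b : OrthonormalBasis (Fin n) ℂ (E n)) (s : Fin (n - 2) → ℂˣ) (x : E n)
    (i : Fin n) : inner ℂ (b i) (torusAct b torusWt s x) = torusChar s i * inner ℂ (b i) x := by
  rw [torusAct, b.orthonormal.inner_right_fintype]
  rfl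

lemma inner_torusGen {n : ℕ} (b : OrthonormalBasis (Fin n) ℂ (E n)) (j : Fin (n - 2)) (x : E n)
    (i : Fin n) : inner ℂ (b i) (torusGen b torusWt j x) =
      Complex.I * (torusWt i j : ℂ) * inner ℂ (b i) x := by
  rw [torusGen, b.orthonormal.inner_right_fintype]

lemma ext_inner_basis {n : ℕ} (b : OrthonormalBasis (Fin n) ℂ (E n)) {x y : E n}
    (h : ∀ i, inner ℂ (b i) x = inner ℂ (b i) y) : x = y := by
  rw [← b.sum_repr' x, ← b.sum_repr' y]
  exact Finset.sum_congr rfl fun i _ => by rw [h]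

lemma bil_three_one {n : ℕ} (hn : 3 ≤ n) (x : E n) : bil 3 1 x x =
    coord x 0 ^ 2 + coord x 1 ^ 2 + x ⟨2, by omega⟩ ^ 2 := by
  obtain ⟨m, rfl⟩ := Nat.exists_eq_add_of_le' hn
  rw [← eval_quad, quad_three_one]
  simp [coord_of_lt]
  rfl

/-- The character values of a torus element are arbitrary up to a common factor, subject to the
relation imposed by the equation of the quadric. -/
lemma exists_torusChar_eq {n : ℕ} (hn : 3 ≤ n) (c : Fin n → ℂˣ)
    (hc : c ⟨0, by omega⟩ * c ⟨1, by omega⟩ = c ⟨2, by omega⟩ ^ 2) :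
    ∃ s : Fin (n - 2) → ℂˣ, ∀ i, torusChar s i = c i * (c ⟨n - 1, by omega⟩)⁻¹ := by
  let s : Fin (n - 2) → ℂˣ := fun j =>
    if (j : ℕ) = 0 then c ⟨0, by omega⟩ * (c ⟨2, by omega⟩)⁻¹
    else c ⟨j + 1, by have := j.2; omega⟩ * (c ⟨j + 2, by have := j.2; omega⟩)⁻¹
  have hge : ∀ d i : ℕ, ∀ hi : i < n, i + d = n - 1 → 2 ≤ i →
      torusChar s ⟨i, hi⟩ = c ⟨i, hi⟩ * (c ⟨n - 1, by omega⟩)⁻¹ := by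
    intro d
    induction d with
    | zero =>
      intro i hi h _
      have : (⟨i, hi⟩ : Fin n) = ⟨n - 1, by omega⟩ := Fin.ext (by simpa using h)
      rw [this, torusChar_last hn, mul_inv_cancel]
    | succ d ih =>
      intro i hi h h2
      obtain ⟨j, rfl⟩ : ∃ j, i = j + 1 := ⟨i - 1, by omega⟩
      rw [torusChar_succ s (by omega) (by omega), ih (j + 2) (by omega) (by omega) (by omega)]
      simp only [s, show j ≠ 0 by omega, if_false]
      group
  have h2 := hge (n - 1 - 2) 2 (by omega) (by omega) le_rfl
  refine ⟨s, fun i => ?_⟩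
  rcases Nat.lt_or_ge i 2 with hi | hi
  · rcases (by omega : (i : ℕ) = 0 ∨ (i : ℕ) = 1) with h | h
    · have : i = ⟨0, by omega⟩ := Fin.ext h
      rw [this, torusChar_zero hn, h2]
      simp only [s, if_true]
      group
    · have : i = ⟨1, by omega⟩ := Fin.ext h
      rw [this, torusChar_one hn, h2]
      simp only [s, if_true, mul_inv_rev, inv_inv]
      rw [← mul_assoc]
      congr 1
      rw [mul_right_comm, ← pow_two, ← hc, mul_comm, ← mul_assoc, inv_mul_cancel, one_mul]
  · exact hge (n - 1 - i) i i.2 (by have := i.2; omega) hi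

/-- A torus element is determined by the values of the characters. -/
lemma torusChar_injective {n : ℕ} {s s' : Fin (n - 2) → ℂˣ} (h : torusChar s = torusChar s') :
    s = s' := by
  ext1 j
  have hj := j.2
  have hn : 3 ≤ n := by omega
  rcases Nat.eq_zero_or_pos (j : ℕ) with h0 | h0
  · have hj0 : j = ⟨0, by omega⟩ := Fin.ext h0
    have h1 := torusChar_zero hn s
    have h2 := torusChar_zero hn s'
    rw [h] at h1
    rw [h1] at h2
    rw [hj0]
    exact mul_right_cancel h2
  · have h1 := torusChar_succ s h0 hj
    have h2 := torusChar_succ s' h0 hj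
    rw [h] at h1
    rw [h1] at h2
    exact mul_right_cancel h2

/-! ### The toric moment map -/

/-- The function `λ_1^{(2)}` is the moment map of the rotations of the first two coordinates. -/
lemma exists_hamiltonian_gcFun_two {n : ℕ} (hn : 3 ≤ n) (lam : ℝ) {x : E n} (hx : x ≠ 0) :
    ∃ L : E n →L[ℝ] ℝ, HasFDerivAt (lift fun q => gcFun lam 2 1 q) L x ∧ ∀ w, L w =
      fsForm lam x w (cornerGen (!![0, 1; -1, 0] : Matrix (Fin 2) (Fin 2) ℝ) x) := by
  have h := (isMomentMapSO_muSO lam (show 2 ≤ n by omega)).2 !![0, 1; -1, 0]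
    (by ext i j; fin_cases i <;> fin_cases j <;> simp) x hx
  have he : (fun q : PSpace n => ∑ i, ∑ j, if i < j then
      (!![0, 1; -1, 0] : Matrix (Fin 2) (Fin 2) ℝ) i j * muSO lam 2 q i j else 0) =
      fun q => gcFun lam 2 1 q := by
    ext q
    rw [gcFun_two lam (isRep_rep q)]
    simp [Fin.sum_univ_two, muSO_apply lam 2 (isRep_rep q)]
  rwa [he] at h

lemma isToricMomentMap_quad {n : ℕ} (hn : 3 ≤ n) {lam : ℝ} (hlam : 0 < lam) :
    IsToricMomentMap lam (quad n 3 1) (Phi lam 3) := by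
  have hnormal : IsDomain (MvPolynomial (Fin n) ℂ ⧸ Ideal.span {quad n 3 1}) ∧
      IsIntegrallyClosed (MvPolynomial (Fin n) ℂ ⧸ Ideal.span {quad n 3 1}) := by
    obtain ⟨m, rfl⟩ := Nat.exists_eq_add_of_le' hn
    exact quad_three_one_normal m
  refine ⟨hnormal.1, hnormal.2, (continuous_Phi hlam 3).continuousOn, ?_⟩
  obtain ⟨b, hb0, hb1, hbi⟩ := exists_torusBasis hn
  have h2 : ((Real.sqrt 2 : ℝ) : ℂ) ^ 2 = 2 := by
    rw [← Complex.ofReal_pow, Real.sq_sqrt (by norm_num)]; norm_num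
  have h20 : ((Real.sqrt 2 : ℝ) : ℂ) ≠ 0 := by
    intro h; rw [h] at h2; norm_num at h2
  -- the equation in the eigenbasis
  have hbil : ∀ x : E n, bil 3 1 x x = 2 * (inner ℂ (b ⟨0, by omega⟩) x *
      inner ℂ (b ⟨1, by omega⟩) x) + inner ℂ (b ⟨2, by omega⟩) x ^ 2 := by
    intro x
    rw [bil_three_one hn, hb0, hb1, hbi ⟨2, by omega⟩ le_rfl, div_mul_div_comm, ← pow_two, h2]
    linear_combination coord x 1 ^ 2 * Complex.I_sq
  have hact : ∀ s : Fin (n - 2) → ℂˣ, ∀ x ∈ cone (quad n 3 1),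
      torusAct b torusWt s x ∈ cone (quad n 3 1) := by
    intro s x hx
    obtain ⟨hx0, hx1⟩ := mem_cone_quad.1 hx
    refine mem_cone_quad.2 ⟨fun h => hx0 ?_, ?_⟩
    · refine ext_inner_basis b fun i => ?_
      have h3 := inner_torusAct b s x i
      rw [h, inner_zero_right] at h3
      rw [inner_zero_right]
      exact (mul_eq_zero.1 h3.symm).resolve_left (Units.ne_zero _)
    · rw [hbil] at hx1 ⊢
      rw [inner_torusAct, inner_torusAct, inner_torusAct, torusChar_zero hn, torusChar_one hn]
      have := (s ⟨0, by omega⟩).mul_inv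
      push_cast
      have e : ((s ⟨0, by omega⟩ : ℂˣ) : ℂ) * ((s ⟨0, by omega⟩ : ℂˣ) : ℂ)⁻¹ = 1 :=
        mul_inv_cancel₀ (Units.ne_zero _)
      linear_combination ((torusChar s ⟨2, by omega⟩ : ℂˣ) : ℂ) ^ 2 * hx1 +
        2 * ((torusChar s ⟨2, by omega⟩ : ℂˣ) : ℂ) ^ 2 * inner ℂ (b ⟨0, by omega⟩) x *
        inner ℂ (b ⟨1, by omega⟩) x * e
  -- a base point of the open orbit
  let ξ : Fin n → ℂ := fun i => if (i : ℕ) = 1 then -1 / 2 else 1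
  let x₀ : E n := ∑ i, ξ i • b i
  have hξ : ∀ i, inner ℂ (b i) x₀ = ξ i := fun i => b.orthonormal.inner_right_fintype ξ i
  have hξ0 : ∀ i, ξ i ≠ 0 := by
    intro i
    simp only [ξ]
    split_ifs <;> norm_num
  have hx₀ : x₀ ∈ cone (quad n 3 1) := by
    refine mem_cone_quad.2 ⟨fun h => ?_, ?_⟩
    · have := hξ ⟨0, by omega⟩
      rw [h, inner_zero_right] at this
      exact hξ0 _ this.symm
    · rw [hbil, hξ, hξ, hξ]
      simp [ξ]
      norm_num
  have horbit : {p | ∃ s, IsRep p (torusAct b torusWt s x₀)} = {p | p ∈ zeroLocus (quad n 3 1) ∧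
      ∀ i : Fin n, 2 ≤ (i : ℕ) → p.rep i ≠ 0} := by
    have hinv : ∀ (c : ℂ) (x : E n), c ≠ 0 →
        (∀ i : Fin n, 2 ≤ (i : ℕ) → (c • x) i ≠ 0) = ∀ i : Fin n, 2 ≤ (i : ℕ) → x i ≠ 0 := by
      intro c x hc
      simp [hc]
    ext p
    constructor
    · rintro ⟨s, hs⟩
      refine ⟨hs.mem_zeroLocus_iff.2 (hact s x₀ hx₀), ?_⟩
      rw [hs.apply_rep (F := fun x : E n => ∀ i : Fin n, 2 ≤ (i : ℕ) → x i ≠ 0) hinv]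
      intro i hi
      rw [← hbi i hi, inner_torusAct, hξ]
      exact mul_ne_zero (Units.ne_zero _) (hξ0 i)
    · rintro ⟨hp, hne⟩
      set y := p.rep with hy
      have hyc := hp y (isRep_rep p)
      have hyb := (mem_cone_quad.1 hyc).2
      rw [hbil] at hyb
      have hge : ∀ i : Fin n, 2 ≤ (i : ℕ) → inner ℂ (b i) y ≠ 0 := fun i hi => by
        rw [hbi i hi]; exact hne i hi
      have h2' := hge ⟨2, by omega⟩ le_rfl
      have h01 : inner ℂ (b ⟨0, by omega⟩) y * inner ℂ (b ⟨1, by omega⟩) y ≠ 0 := by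
        intro h
        rw [h, mul_zero, zero_add] at hyb
        exact h2' (pow_eq_zero_iff two_ne_zero |>.1 hyb)
      have hall : ∀ i : Fin n, inner ℂ (b i) y ≠ 0 := by
        intro i
        rcases Nat.lt_or_ge i 2 with hi | hi
        · rcases (by omega : (i : ℕ) = 0 ∨ (i : ℕ) = 1) with h | h
          · rw [show i = ⟨0, by omega⟩ from Fin.ext h]; exact left_ne_zero_of_mul h01
          · rw [show i = ⟨1, by omega⟩ from Fin.ext h]; exact right_ne_zero_of_mul h01
        · exact hge i hi
      obtain ⟨s, hs⟩ := exists_torusChar_eq hn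
        (fun i => Units.mk0 (inner ℂ (b i) y / ξ i) (div_ne_zero (hall i) (hξ0 i))) (by
          ext
          simp only [Units.val_mul, Units.val_pow_eq_pow_val, Units.val_mk0, ξ]
          simp
          linear_combination (-1 : ℂ) * hyb)
      refine ⟨s, ?_⟩
      have hl := hall ⟨n - 1, by omega⟩
      have hξl : ξ ⟨n - 1, by omega⟩ = 1 := by
        simp [ξ, show n - 1 ≠ 1 by omega]
      have : torusAct b torusWt s x₀ = (inner ℂ (b ⟨n - 1, by omega⟩) y)⁻¹ • y := by
        refine ext_inner_basis b fun i => ?_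
        rw [inner_torusAct, hs, inner_smul_right, hξ]
        push_cast
        simp only [Units.val_mk0, hξl, div_one]
        have := hξ0 i
        field_simp
      rw [this]
      exact (isRep_rep p).smul (inv_ne_zero hl)
  refine ⟨b, torusWt, hact, ⟨x₀, hx₀, ?_, ?_⟩, ?_⟩
  · intro s s' p hs hs'
    obtain ⟨c, hc, hcs⟩ := hs.exists_smul hs'
    have hch : ∀ i, ((torusChar s' i : ℂˣ) : ℂ) = c * torusChar s i := by
      intro i
      have := congrArg (fun v => inner ℂ (b i) v) hcs
      simp only [inner_smul_right, inner_torusAct, hξ] at this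
      exact mul_right_cancel₀ (hξ0 i) (by rw [this]; ring)
    have hc1 : c = 1 := by
      have := hch ⟨n - 1, by omega⟩
      rw [torusChar_last hn, torusChar_last hn] at this
      simpa using this.symm
    refine torusChar_injective (funext fun i => Units.ext ?_)
    rw [hch, hc1, one_mul]
  · rw [horbit]
    refine isOpenDenseIn_of_generic le_rfl hn
      (G := fun x : E n => ∀ i : Fin n, 2 ≤ (i : ℕ) → x i ≠ 0) ?_ ?_ ?_
    · intro c x hc
      simp [hc]
    · simp only [Set.ofPred_forall]
      exact isOpen_iInter_of_finite fun i => isOpen_iInter_of_finite fun _ =>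
        isOpen_ne_fun (by fun_prop) continuous_const
    · intro x _ hx i _
      exact hx.2 i
  · intro p _ x hx j
    rcases Nat.eq_zero_or_pos (j : ℕ) with hj | hj
    · obtain ⟨L, hL1, hL2⟩ := exists_hamiltonian_gcFun_two hn lam hx.ne_zero
      have hgen : torusGen b torusWt j x =
          cornerGen (!![0, 1; -1, 0] : Matrix (Fin 2) (Fin 2) ℝ) x := by
        have hc0 : coord (cornerGen (!![0, 1; -1, 0] : Matrix (Fin 2) (Fin 2) ℝ) x) 0 =
            coord x 1 := by
          rw [coord_of_lt _ (by omega : 0 < n)]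
          simp [cornerGen, Fin.sum_univ_two]
        have hc1 : coord (cornerGen (!![0, 1; -1, 0] : Matrix (Fin 2) (Fin 2) ℝ) x) 1 =
            -coord x 0 := by
          rw [coord_of_lt _ (by omega : 1 < n)]
          simp [cornerGen, Fin.sum_univ_two]
        refine ext_inner_basis b fun i => ?_
        rw [inner_torusGen]
        rcases Nat.lt_or_ge i 2 with hi | hi
        · rcases (by omega : (i : ℕ) = 0 ∨ (i : ℕ) = 1) with h | h
          · rw [show i = ⟨0, by omega⟩ from Fin.ext h, hb0, hb0, hc0, hc1]
            simp only [torusWt, hj, if_true]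
            push_cast
            linear_combination (-coord x 1 / (Real.sqrt 2 : ℂ)) * Complex.I_sq
          · rw [show i = ⟨1, by omega⟩ from Fin.ext h, hb1, hb1, hc0, hc1]
            simp only [torusWt, hj, if_true]
            push_cast
            simp
            linear_combination (-coord x 1 / (Real.sqrt 2 : ℂ)) * Complex.I_sq
        · rw [hbi i hi, hbi i hi]
          have h0 : cornerGen (!![0, 1; -1, 0] : Matrix (Fin 2) (Fin 2) ℝ) x i = 0 := by
            simp only [cornerGen]
            rw [dif_neg (by omega)]
          rw [h0]
          simp [torusWt, hj, show (i : ℕ) ≠ 0 by omega, show (i : ℕ) ≠ 1 by omega]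
      refine ⟨L, HasFDerivAt.hasFDerivWithinAt ?_, fun v _ => by rw [hL2, hgen]⟩
      have : (fun q : PSpace n => Phi lam 3 q j) = fun q => gcFun lam 2 1 q := by
        ext q
        rw [Phi, if_pos (by omega), hj]
      rw [this]
      exact hL1
    · have hlt : ¬ (j : ℕ) + 2 < 3 := by omega
      have hjn : (j : ℕ) + 2 ≤ n := by have := j.2; omega
      obtain ⟨L, hL1, hL2⟩ := hasFDerivAt_moment lam (fun q y hy => Phi_apply hlam hy j) hx.ne_zero
        (hasFDerivAt_num (k := 3) (m := j + 2) (by omega) hjn fun h => absurd h hlt)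
        (inner_gen (by omega) hjn fun h => absurd h hlt)
      refine ⟨L, hL1.hasFDerivWithinAt, fun v _ => ?_⟩
      rw [hL2]
      congr 1
      refine ext_inner_basis b fun i => ?_
      rw [inner_torusGen, gen, if_neg hlt, inner_smul_right, mul_assoc]
      congr 1
      have hcoord : ∀ l : ℕ, l < 2 → coord (trunc ((j : ℕ) + 2) x) l = coord x l := by
        intro l hl
        rw [coord_of_lt _ (by omega : l < n), coord_of_lt _ (by omega : l < n)]
        simp [show l < (j : ℕ) + 2 by omega]
      rcases Nat.lt_or_ge i 2 with hi | hi
      · rcases (by omega : (i : ℕ) = 0 ∨ (i : ℕ) = 1) with h | h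
        · rw [show i = ⟨0, by omega⟩ from Fin.ext h, hb0, hb0, hcoord 0 (by omega),
            hcoord 1 (by omega)]
          simp [torusWt, hj.ne']
        · rw [show i = ⟨1, by omega⟩ from Fin.ext h, hb1, hb1, hcoord 0 (by omega),
            hcoord 1 (by omega)]
          simp [torusWt, hj.ne']
      · rw [hbi i hi, hbi i hi]
        simp [torusWt, hj.ne']

/-! ### Symplectic maps in homogeneous coordinates -/

lemma bil_cj_self {n k : ℕ} {t : ℝ} (ht : 0 ≤ t) {x : E n}
    (h : dPoly (quad n k t) x ≠ 0) : bil k t x (cj x) ≠ 0 := by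
  have he : bil k t x (cj x) = ((∑ i, (wt k (t : ℂ) i).re * ‖x i‖ ^ 2 : ℝ) : ℂ) := by
    rw [bil]
    push_cast
    refine Finset.sum_congr rfl fun i _ => ?_
    rw [cj_apply, Complex.star_def, Complex.mul_conj']
    congr 1
    simp only [wt]
    split_ifs <;> simp
  have hw : ∀ i : Fin n, 0 ≤ (wt k (t : ℂ) i).re := by
    intro i
    simp only [wt]
    split_ifs <;> simp [ht]
  intro h0
  rw [he] at h0
  have h0 := (Finset.sum_eq_zero_iff_of_nonneg fun i _ =>
    mul_nonneg (hw i) (sq_nonneg _)).1 (Complex.ofReal_eq_zero.1 h0)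
  refine h (LinearMap.ext fun v => ?_)
  rw [dPoly_quad, bil, LinearMap.zero_apply]
  refine mul_eq_zero_of_right _ (Finset.sum_eq_zero fun i _ => ?_)
  rcases mul_eq_zero.1 (h0 i (Finset.mem_univ i)) with h1 | h1
  · have : wt k (t : ℂ) i = 0 := by
      revert h1
      simp only [wt]
      split_ifs <;> simp
    simp [this]
  · have : x i = 0 := by simpa using h1
    simp [this]

/-- Every vector in the kernel of the differential of the equation is the velocity of a curve on
the cone, at a regular point. -/
lemma exists_curve {n k : ℕ} {t : ℝ} (ht : 0 ≤ t) {x : E n}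
    (hx : x ∈ cone (quad n k t)) (h : dPoly (quad n k t) x ≠ 0) {v : E n}
    (hv : dPoly (quad n k t) x v = 0) :
    ∃ γ : ℝ → E n, γ 0 = x ∧ HasDerivAt γ v 0 ∧ ∀ᶠ s in 𝓝 0, γ s ∈ cone (quad n k t) := by
  obtain ⟨hx0, hxx⟩ := mem_cone_quad.1 hx
  have hb := bil_cj_self ht h
  have hv0 : bil k t x v = 0 := by
    rw [dPoly_quad] at hv
    simpa using hv
  have hcc : bil k (t : ℂ) (cj x) (cj x) = 0 := by rw [bil_cj_cj, hxx, star_zero]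
  -- the isotropic direction `cj x` corrects the straight line
  let d : ℝ → ℂ := fun s => bil k t x (cj x) + s * bil k t v (cj x)
  let τ : ℝ → ℂ := fun s => (s : ℂ) ^ 2 * (-(bil k t v v) / (2 * d s))
  have hd : Continuous d := by fun_prop
  have hd0 : d 0 ≠ 0 := by simpa [d] using hb
  have hτ0 : τ 0 = 0 := by simp [τ]
  have hdd : HasDerivAt d (bil k t v (cj x)) 0 := by
    have := ((Complex.ofRealCLM.hasDerivAt (x := 0)).mul_const (bil k t v (cj x))).const_add
      (bil k t x (cj x))
    simpa [d] using this
  have hτ : HasDerivAt τ 0 0 := by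
    have h1 : HasDerivAt (fun s : ℝ => (s : ℂ) ^ 2) 0 0 := by
      have := (Complex.ofRealCLM.hasDerivAt (x := 0)).fun_pow 2
      simpa using this
    have h2 : DifferentiableAt ℝ (fun s => -(bil k t v v) / (2 * d s)) 0 :=
      (differentiableAt_const _).div (hdd.differentiableAt.const_mul 2)
        (mul_ne_zero two_ne_zero hd0)
    have := h1.fun_mul h2.hasDerivAt
    simpa [τ] using this
  refine ⟨fun s => x + (s : ℂ) • v + τ s • cj x, by simp [hτ0], ?_, ?_⟩
  · have h1 : HasDerivAt (fun s : ℝ => (s : ℂ) • v) v 0 := by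
      have := (Complex.ofRealCLM.hasDerivAt (x := 0)).smul_const v
      simpa using this
    have := (h1.const_add x).fun_add (hτ.smul_const (cj x))
    simpa using this
  · have hc : ContinuousAt (fun s : ℝ => x + (s : ℂ) • v + τ s • cj x) 0 := by
      have := hτ.continuousAt
      fun_prop
    have e0 : x + ((0 : ℝ) : ℂ) • v + τ 0 • cj x ≠ 0 := by simpa [hτ0] using hx0
    filter_upwards [hc.eventually_ne e0, hd.continuousAt.eventually_ne hd0] with s hs hds
    refine mem_cone_quad.2 ⟨hs, ?_⟩
    simp only [bil_add_right, bil_add_left, bil_smul_right, bil_smul_left, hxx, hcc,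
      bil_comm k (t : ℂ) v x, bil_comm k (t : ℂ) (cj x) _, hv0]
    have : τ s * (2 * d s) = -(s : ℂ) ^ 2 * bil k t v v := by
      simp only [τ]
      field_simp
    simp only [d] at this
    linear_combination this

/-- The map `Ψ` of homogeneous coordinates is a smooth lift, from the cone `G` over part of
`{P = 0}` to the cone `H` over part of `{Q = 0}`, of the map `f` of projective space, and it
preserves the pulled back symplectic forms. -/
structure IsSymplecticLift {n : ℕ} (lam : ℝ) (P Q : MvPolynomial (Fin n) ℂ)
    (G H : Set (E n)) (f : PSpace n → PSpace n) (Ψ : E n → E n) : Prop where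
  mapsTo : Set.MapsTo Ψ G H
  rep : ∀ p x, IsRep p x → x ∈ G → IsRep (f p) (Ψ x)
  contDiffAt : ∀ x ∈ G, ContDiffAt ℝ ∞ Ψ x
  ker : ∀ x ∈ G, ∀ v, dPoly P x v = 0 → dPoly Q (Ψ x) (fderiv ℝ Ψ x v) = 0
  symplectic : ∀ x ∈ G, ∀ v w, dPoly P x v = 0 → dPoly P x w = 0 →
    fsForm lam (Ψ x) (fderiv ℝ Ψ x v) (fderiv ℝ Ψ x w) = fsForm lam x v w

lemma IsSymplecticLift.comp {n : ℕ} {lam : ℝ} {P Q R : MvPolynomial (Fin n) ℂ}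
    {G H K : Set (E n)} {f g : PSpace n → PSpace n} {Ψ Θ : E n → E n}
    (hg : IsSymplecticLift lam Q R H K g Θ) (hf : IsSymplecticLift lam P Q G H f Ψ) :
    IsSymplecticLift lam P R G K (fun p => g (f p)) (fun x => Θ (Ψ x)) := by
  have hD : ∀ x ∈ G, ∀ v, fderiv ℝ (fun x => Θ (Ψ x)) x v =
      fderiv ℝ Θ (Ψ x) (fderiv ℝ Ψ x v) := by
    intro x hx v
    have := ((hg.contDiffAt _ (hf.mapsTo hx)).differentiableAt (by simp)).hasFDerivAt.comp x
      ((hf.contDiffAt x hx).differentiableAt (by simp)).hasFDerivAt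
    rw [show (fun x => Θ (Ψ x)) = Θ ∘ Ψ from rfl, this.fderiv]
    rfl
  refine ⟨fun x hx => hg.mapsTo (hf.mapsTo hx),
    fun p x h hx => hg.rep _ _ (hf.rep p x h hx) (hf.mapsTo hx),
    fun x hx => (hg.contDiffAt _ (hf.mapsTo hx)).comp x (hf.contDiffAt x hx), ?_, ?_⟩
  · intro x hx v hv
    rw [hD x hx]
    exact hg.ker _ (hf.mapsTo hx) _ (hf.ker x hx v hv)
  · intro x hx v w hv hw
    rw [hD x hx, hD x hx, hg.symplectic _ (hf.mapsTo hx) _ _ (hf.ker x hx v hv) (hf.ker x hx w hw),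
      hf.symplectic x hx v w hv hw]

/-- A smooth inverse of a symplectic lift is a symplectic lift. -/
lemma IsSymplecticLift.symm {n k : ℕ} {t : ℝ} (ht : 0 ≤ t) {lam : ℝ}
    {P : MvPolynomial (Fin n) ℂ} {G H : Set (E n)} {f g : PSpace n → PSpace n} {Ψ Θ : E n → E n}
    (hf : IsSymplecticLift lam P (quad n k t) G H f Ψ)
    (hH : H ⊆ cone (quad n k t)) (hreg : ∀ y ∈ H, dPoly (quad n k t) y ≠ 0)
    (hopen : ∀ y ∈ H, ∀ᶠ z in 𝓝 y, z ∈ cone (quad n k t) → z ∈ H)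
    (hmaps : Set.MapsTo Θ H G)
    (hrep : ∀ p x, IsRep p x → x ∈ H → IsRep (g p) (Θ x))
    (hsmooth : ∀ y ∈ H, ContDiffAt ℝ ∞ Θ y)
    (hker : ∀ y ∈ H, ∀ v, dPoly (quad n k t) y v = 0 → dPoly P (Θ y) (fderiv ℝ Θ y v) = 0)
    (hinv : ∀ y ∈ H, Ψ (Θ y) = y) :
    IsSymplecticLift lam (quad n k t) P H G g Θ := by
  refine ⟨hmaps, hrep, hsmooth, hker, fun y hy v w hv hw => ?_⟩
  have key : ∀ u, dPoly (quad n k t) y u = 0 →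
      fderiv ℝ Ψ (Θ y) (fderiv ℝ Θ y u) = u := by
    intro u hu
    obtain ⟨γ, hγ0, hγ, hγc⟩ := exists_curve ht (hH hy) (hreg y hy) hu
    have h1 : HasFDerivAt (fun z => Ψ (Θ z)) ((fderiv ℝ Ψ (Θ y)).comp (fderiv ℝ Θ y)) (γ 0) := by
      rw [hγ0]
      exact ((hf.contDiffAt _ (hmaps hy)).differentiableAt (by simp)).hasFDerivAt.comp y
        ((hsmooth y hy).differentiableAt (by simp)).hasFDerivAt
    have h2 := h1.comp_hasDerivAt (0 : ℝ) hγ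
    have hev : ∀ᶠ s in 𝓝 (0 : ℝ), γ s ∈ H := by
      have := hγ.continuousAt.tendsto
      rw [hγ0] at this
      filter_upwards [hγc, this.eventually (hopen y hy)] with s h3 h4 using h4 h3
    have h3 : HasDerivAt γ (((fderiv ℝ Ψ (Θ y)).comp (fderiv ℝ Θ y)) u) 0 :=
      h2.congr_of_eventuallyEq (hev.mono fun s hs => (hinv _ hs).symm)
    exact h3.unique hγ
  have h := hf.symplectic (Θ y) (hmaps hy) _ _ (hker y hy v hv) (hker y hy w hw)
  rw [key v hv, key w hw, hinv y hy] at h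
  exact h.symm

/-- The punctured cone in `ℂⁿ` over a subset of projective space. -/
def coneOver {n : ℕ} (A : Set (PSpace n)) : Set (E n) := {x | ∃ p ∈ A, IsRep p x}

lemma IsRep.mem_coneOver_iff {n : ℕ} {A : Set (PSpace n)} {p : PSpace n} {x : E n}
    (h : IsRep p x) : x ∈ coneOver A ↔ p ∈ A :=
  ⟨fun ⟨_, hq, hx⟩ => h.eq hx ▸ hq, fun hp => ⟨p, hp, h⟩⟩

/-- Mutually inverse symplectic lifts between open subsets of the regular loci define a
symplectomorphism. -/
lemma IsSymplecticLift.isSymplectomorphism {n k l : ℕ} {t u : ℂ} {lam : ℝ}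
    {A B : Set (PSpace n)} {f g : PSpace n → PSpace n} {Ψ Θ : E n → E n}
    (hf : IsSymplecticLift lam (quad n k t) (quad n l u) (coneOver A) (coneOver B) f Ψ)
    (hg : IsSymplecticLift lam (quad n l u) (quad n k t) (coneOver B) (coneOver A) g Θ)
    (hgf : ∀ x ∈ coneOver A, Θ (Ψ x) = x) (hfg : ∀ x ∈ coneOver B, Ψ (Θ x) = x)
    (hA : A ⊆ regLocus (quad n k t)) (hB : B ⊆ regLocus (quad n l u))
    (hAo : ∃ O : Set (PSpace n), IsOpen O ∧ A = O ∩ zeroLocus (quad n k t))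
    (hBo : ∃ O : Set (PSpace n), IsOpen O ∧ B = O ∩ zeroLocus (quad n l u)) :
    IsSymplectomorphism lam (quad n k t) (quad n l u) A B f := by
  have hinv : ∀ {A B : Set (PSpace n)} {f g : PSpace n → PSpace n} {Ψ Θ : E n → E n}
      {P Q : MvPolynomial (Fin n) ℂ},
      IsSymplecticLift lam P Q (coneOver A) (coneOver B) f Ψ →
      IsSymplecticLift lam Q P (coneOver B) (coneOver A) g Θ →
      (∀ x ∈ coneOver A, Θ (Ψ x) = x) → Set.LeftInvOn g f A ∧ Set.MapsTo f A B := by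
    intro A B f g Ψ Θ P Q hf hg h
    have hA : ∀ p ∈ A, p.rep ∈ coneOver A := fun p hp => ⟨p, hp, isRep_rep p⟩
    constructor
    · intro p hp
      have := hg.rep _ _ (hf.rep p _ (isRep_rep p) (hA p hp)) (hf.mapsTo (hA p hp))
      rw [h _ (hA p hp)] at this
      exact this.eq (isRep_rep p)
    · intro p hp
      exact (hf.rep p _ (isRep_rep p) (hA p hp)).mem_coneOver_iff.1 (hf.mapsTo (hA p hp))
  have hlift : ∀ {A B : Set (PSpace n)} {f : PSpace n → PSpace n} {Ψ : E n → E n} {k : ℕ} {t : ℂ}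
      {Q : MvPolynomial (Fin n) ℂ},
      IsSymplecticLift lam (quad n k t) Q (coneOver A) (coneOver B) f Ψ →
      (∃ O : Set (PSpace n), IsOpen O ∧ A = O ∩ zeroLocus (quad n k t)) →
      ∀ p ∈ A, ∀ x, IsRep p x → IsSmoothLiftAt (quad n k t) f Ψ x := by
    rintro A B f Ψ k t Q hf ⟨O, hO, rfl⟩ p hp x hx
    refine ⟨(hf.contDiffAt x ⟨p, hp, hx⟩).contDiffWithinAt, ?_⟩
    filter_upwards [nhdsWithin_le_nhds (eventually_mem_of_isOpen hO hp.1 hx),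
      self_mem_nhdsWithin] with y hy hyc q hq
    exact hf.rep q y hq ⟨q, ⟨hy q hq, hq.mem_zeroLocus_iff.2 hyc⟩, hq⟩
  obtain ⟨h1, h2⟩ := hinv hf hg hgf
  obtain ⟨h3, h4⟩ := hinv hg hf hfg
  refine ⟨hA, hB, hAo, hBo, Set.InvOn.bijOn ⟨h1, h3⟩ h2 h4, ?_, g, ⟨h1, h3⟩,
    fun q hq y hy => ⟨Θ, hlift hg hBo q hq y hy⟩⟩
  intro p hp x hx
  refine ⟨Ψ, fderiv ℝ Ψ x, hlift hf hAo p hp x hx,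
    ((hf.contDiffAt x ⟨p, hp, hx⟩).differentiableAt (by simp)).hasFDerivAt.hasFDerivWithinAt, ?_⟩
  intro v hv w hw
  exact hf.symplectic x ⟨p, hp, hx⟩ v w (mem_tangent_iff.1 hv).2 (mem_tangent_iff.1 hw).2

/-! ### The coefficients of the gradient-Hamiltonian flow -/

/-- The norm of the differential of the equation along the flow, as a function of
`p = ∑_{i<m} |x_i|²` and `r = |x_m|²` at the starting point of the flow line. -/
def flowS (t p r : ℝ) : ℝ := √(p ^ 2 + t ^ 2 * (r * (2 * p + r)))

/-- The factor by which the flow multiplies the coordinate `x_m`. -/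
def flowK (t p r : ℝ) : ℝ := √((2 * p + r) / (p + r + flowS t p r))

/-- The value of `∑_{i<m} |x_i|²` along the flow. -/
def flowP (t p r : ℝ) : ℝ := p + r - flowK t p r ^ 2 * r

/-- The coefficient of `x_i` in the `i`-th coordinate of the flow, for `i < m`. -/
def flowC (t p r : ℝ) : ℝ := √((flowP t p r + p) / (2 * p))

/-- The coefficient of `-x_m² x̄_i` in the `i`-th coordinate of the flow, for `i < m`. -/
def flowH (t p r : ℝ) : ℝ := t * flowK t p r ^ 2 / (2 * p * flowC t p r)

section
variable {t p r : ℝ}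

lemma flowS_sq (hp : 0 < p) (hr : 0 ≤ r) :
    flowS t p r ^ 2 = p ^ 2 + t ^ 2 * (r * (2 * p + r)) := Real.sq_sqrt (by positivity)

lemma flowS_pos (hp : 0 < p) (hr : 0 ≤ r) : 0 < flowS t p r := Real.sqrt_pos.2 (by positivity)

lemma flowK_pos (hp : 0 < p) (hr : 0 ≤ r) : 0 < flowK t p r := by
  have := flowS_pos (t := t) hp hr
  exact Real.sqrt_pos.2 (by positivity)

lemma flowK_sq (hp : 0 < p) (hr : 0 ≤ r) :
    flowK t p r ^ 2 * (p + r + flowS t p r) = 2 * p + r := by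
  have := flowS_pos (t := t) hp hr
  rw [flowK, Real.sq_sqrt (by positivity)]
  field_simp

lemma flowP_add (hp : 0 < p) (hr : 0 ≤ r) :
    flowS t p r = flowP t p r + t ^ 2 * (flowK t p r ^ 2 * r) := by
  have h1 := flowK_sq (t := t) hp hr
  have h2 := flowS_sq (t := t) hp hr
  have h3 := flowS_pos (t := t) hp hr
  have : (flowS t p r - (flowP t p r + t ^ 2 * (flowK t p r ^ 2 * r))) *
      (p + r + flowS t p r) = 0 := by
    rw [flowP]
    linear_combination h2 + (r - t ^ 2 * r) * h1
  have := (mul_eq_zero.1 this).resolve_right (by positivity)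
  linarith

lemma flowP_pos (hp : 0 < p) (hr : 0 ≤ r) : 0 < flowP t p r := by
  have h1 := flowK_sq (t := t) hp hr
  have h3 := flowS_pos (t := t) hp hr
  have : flowP t p r * (p + r + flowS t p r) = p ^ 2 + (p + r) * flowS t p r := by
    rw [flowP]
    linear_combination -r * h1
  exact pos_of_mul_pos_left (b := p + r + flowS t p r) (by rw [this]; positivity) (by positivity)

lemma flowP_sq (hp : 0 < p) (hr : 0 ≤ r) :
    flowP t p r ^ 2 = p ^ 2 + t ^ 2 * (flowK t p r ^ 2 * r) ^ 2 := by
  have h1 := flowK_sq (t := t) hp hr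
  have h2 := flowP_add (t := t) hp hr
  rw [h2] at h1
  have h3 : flowP t p r = p + r - flowK t p r ^ 2 * r := rfl
  linear_combination (flowP t p r + p + r) * h3 - r * h1

lemma flowC_pos (hp : 0 < p) (hr : 0 ≤ r) : 0 < flowC t p r := by
  have := flowP_pos (t := t) hp hr
  exact Real.sqrt_pos.2 (by positivity)

lemma flowC_sq (hp : 0 < p) (hr : 0 ≤ r) : 2 * p * flowC t p r ^ 2 = flowP t p r + p := by
  have := flowP_pos (t := t) hp hr
  rw [flowC, Real.sq_sqrt (by positivity)]
  field_simp

lemma flowC_mul_flowH (hp : 0 < p) (hr : 0 ≤ r) :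
    2 * p * flowC t p r * flowH t p r = t * flowK t p r ^ 2 := by
  have := flowC_pos (t := t) hp hr
  rw [flowH]
  field_simp

lemma flowC_sq_sub (hp : 0 < p) (hr : 0 ≤ r) :
    flowC t p r ^ 2 - (flowH t p r * r) ^ 2 = 1 := by
  have h1 := flowC_sq (t := t) hp hr
  have h2 := flowC_mul_flowH (t := t) hp hr
  have h3 := flowP_sq (t := t) hp hr
  have h4 := flowP_pos (t := t) hp hr
  have : (flowC t p r ^ 2 - (flowH t p r * r) ^ 2 - 1) *
      (2 * p * (2 * p * flowC t p r ^ 2)) = 0 := by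
    have h5 : (2 * p * flowC t p r * flowH t p r) ^ 2 * r ^ 2 =
        (t * flowK t p r ^ 2) ^ 2 * r ^ 2 := by
      rw [h2]
    linear_combination (2 * p * flowC t p r ^ 2 + flowP t p r + p - 2 * p) * h1 - h5 + h3
  rw [h1] at this
  have := (mul_eq_zero.1 this).resolve_right (by positivity)
  linarith

lemma flow_zero (hp : 0 < p) (hr : 0 ≤ r) :
    flowK 0 p r = 1 ∧ flowC 0 p r = 1 ∧ flowH 0 p r = 0 := by
  have hS : flowS 0 p r = p := by simp [flowS, Real.sqrt_sq hp.le]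
  have hK : flowK 0 p r = 1 := by
    rw [flowK, hS, show (2 * p + r) / (p + r + p) = 1 from by
      rw [div_eq_one_iff_eq (by positivity)]; ring, Real.sqrt_one]
  refine ⟨hK, ?_, by simp [flowH]⟩
  have hP : flowP 0 p r = p := by simp [flowP, hK]
  rw [flowC, hP, show (p + p) / (2 * p) = 1 from by
      rw [div_eq_one_iff_eq (by positivity)]; ring, Real.sqrt_one]

lemma flowS_smul {a : ℝ} (ha : 0 < a) : flowS t (a * p) (a * r) = a * flowS t p r := by
  rw [flowS, flowS, show (a * p) ^ 2 + t ^ 2 * (a * r * (2 * (a * p) + a * r)) =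
    a ^ 2 * (p ^ 2 + t ^ 2 * (r * (2 * p + r))) by ring, Real.sqrt_mul (sq_nonneg a),
    Real.sqrt_sq ha.le]

lemma flow_smul {a : ℝ} (ha : 0 < a) : flowK t (a * p) (a * r) = flowK t p r ∧
    flowC t (a * p) (a * r) = flowC t p r ∧ flowH t (a * p) (a * r) = flowH t p r / a := by
  have hK : flowK t (a * p) (a * r) = flowK t p r := by
    rw [flowK, flowS_smul ha, flowK, show 2 * (a * p) + a * r = a * (2 * p + r) by ring,
      show a * p + a * r + a * flowS t p r = a * (p + r + flowS t p r) by ring,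
      mul_div_mul_left _ _ ha.ne']
  have hC : flowC t (a * p) (a * r) = flowC t p r := by
    rw [flowC, flowC, flowP, flowP, hK,
      show a * p + a * r - flowK t p r ^ 2 * (a * r) + a * p =
        a * (p + r - flowK t p r ^ 2 * r + p) by ring,
      show 2 * (a * p) = a * (2 * p) by ring, mul_div_mul_left _ _ ha.ne']
  refine ⟨hK, hC, ?_⟩
  rw [flowH, flowH, hK, hC]
  field_simp

lemma hasDerivAt_flowK (hp : 0 < p) (hr : 0 ≤ r) :
    HasDerivAt (fun t => flowK t p r) (-(t * flowK t p r ^ 3 * r / (2 * flowS t p r))) t := by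
  have hS := flowS_pos (t := t) hp hr
  have hK := flowK_pos (t := t) hp hr
  have hS' : HasDerivAt (fun t => flowS t p r) (t * (r * (2 * p + r)) / flowS t p r) t := by
    have h1 : HasDerivAt (fun t : ℝ => p ^ 2 + t ^ 2 * (r * (2 * p + r)))
        (2 * t * (r * (2 * p + r))) t := by
      have := (((hasDerivAt_id t).fun_pow 2).mul_const (r * (2 * p + r))).const_add (p ^ 2)
      simpa using this
    have := h1.sqrt (by positivity)
    refine this.congr_deriv ?_
    change _ / (2 * flowS t p r) = _
    ring
  have h2 := ((hS'.const_add (p + r)).fun_inv (by positivity)).const_mul (2 * p + r)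
  have h3 := h2.sqrt (by positivity)
  have h4 := flowK_sq (t := t) hp hr
  have h5 : √((2 * p + r) * (p + r + flowS t p r)⁻¹) = flowK t p r := rfl
  refine h3.congr_deriv ?_
  rw [h5]
  rw [← h4]
  field_simp

lemma hasDerivAt_flowC (hp : 0 < p) (hr : 0 ≤ r) :
    HasDerivAt (fun t => flowC t p r)
      (flowK t p r ^ 2 * flowH t p r * r ^ 2 / (2 * flowS t p r)) t := by
  have hS := flowS_pos (t := t) hp hr
  have hP := flowP_pos (t := t) hp hr
  have hC := flowC_pos (t := t) hp hr
  have h1 := (((((hasDerivAt_flowK (t := t) hp hr).fun_pow 2).mul_const r).const_sub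
    (p + r)).add_const p).div_const (2 * p)
  have h2 := h1.sqrt (by change (flowP t p r + p) / (2 * p) ≠ 0; positivity)
  have h5 : √((p + r - flowK t p r ^ 2 * r + p) / (2 * p)) = flowC t p r := rfl
  refine h2.congr_deriv ?_
  rw [h5, flowH]
  field_simp
  ring

lemma hasDerivAt_flowH (hp : 0 < p) (hr : 0 ≤ r) :
    HasDerivAt (fun t => flowH t p r) (flowK t p r ^ 2 * flowC t p r / (2 * flowS t p r)) t := by
  have hS := flowS_pos (t := t) hp hr
  have hC := flowC_pos (t := t) hp hr
  have h1 := ((hasDerivAt_id t).fun_mul ((hasDerivAt_flowK (t := t) hp hr).fun_pow 2)).fun_div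
    ((hasDerivAt_flowC (t := t) hp hr).const_mul (2 * p)) (by positivity)
  refine h1.congr_deriv ?_
  have e1 := flowC_sq (t := t) hp hr
  have e2 := flowC_mul_flowH (t := t) hp hr
  have e3 := flowP_add (t := t) hp hr
  have e4 := flowC_sq_sub (t := t) hp hr
  have e5 : 2 * flowC t p r * (flowS t p r - t ^ 2 * (flowK t p r ^ 2 * r)) -
      t * flowK t p r ^ 2 * flowH t p r * r ^ 2 = 2 * p * flowC t p r ^ 3 := by
    linear_combination 2 * flowC t p r * e3 + flowH t p r * r ^ 2 * e2 +
      2 * p * flowC t p r * e4 - 2 * flowC t p r * e1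
  rw [div_eq_div_iff (by positivity) (by positivity)]
  simp only [id]
  field_simp
  norm_num
  linear_combination flowK t p r ^ 2 * e5

end

/-! ### The coefficients of the inverse of the flow -/

/-- The factor by which the inverse of the flow multiplies the coordinate `x_m`, as a function of
`p = ∑_{i<m} |x_i|²`, `r = |x_m|²` and the value `d` of `∑_{i<m} |x_i|²` at the starting point of
the flow line. -/
def backK (t p d r : ℝ) : ℝ := √((p + r + (p + t ^ 2 * r)) / (p + r + d))

/-- The coefficient of `x_i` in the `i`-th coordinate of the inverse of the flow, for `i < m`. -/
def backC (p d : ℝ) : ℝ := √((p + d) / (2 * d))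

/-- The coefficient of `x_m² x̄_i` in the `i`-th coordinate of the inverse of the flow,
for `i < m`. -/
def backH (t p d : ℝ) : ℝ := t / (2 * d * backC p d)

section
variable {t p r d : ℝ}

lemma backK_pos (hp : 0 < p) (hr : 0 ≤ r) (hd : 0 < d) : 0 < backK t p d r :=
  Real.sqrt_pos.2 (by positivity)

lemma backK_sq (hp : 0 < p) (hr : 0 ≤ r) (hd : 0 < d) :
    backK t p d r ^ 2 = (p + r + (p + t ^ 2 * r)) / (p + r + d) := Real.sq_sqrt (by positivity)

lemma backC_pos (hp : 0 < p) (hd : 0 < d) : 0 < backC p d := Real.sqrt_pos.2 (by positivity)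

lemma backC_sq (hp : 0 < p) (hd : 0 < d) : 2 * d * backC p d ^ 2 = p + d := by
  rw [backC, Real.sq_sqrt (by positivity)]
  field_simp

lemma backH_mul (hp : 0 < p) (hd : 0 < d) : 2 * d * backC p d * backH t p d = t := by
  have := backC_pos hp hd
  rw [backH]
  field_simp

lemma backC_sq_sub (hp : 0 < p) (hd : 0 < d) (hdp : d ^ 2 = p ^ 2 - t ^ 2 * r ^ 2) :
    backC p d ^ 2 - (backH t p d * r) ^ 2 = 1 := by
  have h1 := backC_sq hp hd
  have h2 := backH_mul (t := t) hp hd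
  have : (backC p d ^ 2 - (backH t p d * r) ^ 2 - 1) * (2 * d * (2 * d * backC p d ^ 2)) = 0 := by
    have h5 : (2 * d * backC p d * backH t p d) ^ 2 * r ^ 2 = t ^ 2 * r ^ 2 := by rw [h2]
    linear_combination (2 * d * backC p d ^ 2 + p + d - 2 * d) * h1 - h5 - hdp
  rw [h1] at this
  have := (mul_eq_zero.1 this).resolve_right (by positivity)
  linarith

lemma backK_sq_mul (hp : 0 < p) (hr : 0 ≤ r) (hd : 0 < d) (hdp : d ^ 2 = p ^ 2 - t ^ 2 * r ^ 2) :
    d + backK t p d r ^ 2 * r = p + r := by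
  rw [backK_sq hp hr hd]
  field_simp
  linear_combination hdp

lemma back_smul {a : ℝ} (ha : 0 < a) : backK t (a * p) (a * d) (a * r) = backK t p d r ∧
    backC (a * p) (a * d) = backC p d ∧ backH t (a * p) (a * d) = backH t p d / a := by
  have hC : backC (a * p) (a * d) = backC p d := by
    rw [backC, backC, show a * p + a * d = a * (p + d) by ring,
      show 2 * (a * d) = a * (2 * d) by ring, mul_div_mul_left _ _ ha.ne']
  refine ⟨?_, hC, ?_⟩
  · rw [backK, backK, show a * p + a * r + (a * p + t ^ 2 * (a * r)) =
      a * (p + r + (p + t ^ 2 * r)) by ring, show a * p + a * r + a * d = a * (p + r + d) by ring,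
      mul_div_mul_left _ _ ha.ne']
  · rw [backH, backH, hC]
    field_simp

lemma backK_flow (hp : 0 < p) (hr : 0 ≤ r) :
    backK t (flowP t p r) p (flowK t p r ^ 2 * r) * flowK t p r = 1 := by
  have hS := flowS_pos (t := t) hp hr
  have hK := flowK_pos (t := t) hp hr
  have h1 := flowK_sq (t := t) hp hr
  have h2 := flowP_add (t := t) hp hr
  have h3 : flowP t p r + flowK t p r ^ 2 * r = p + r := by rw [flowP]; ring
  have h4 := backK_pos (t := t) (d := p) (flowP_pos (t := t) hp hr)
    (mul_nonneg (sq_nonneg (flowK t p r)) hr) hp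
  have h5 := backK_sq (t := t) (d := p) (flowP_pos (t := t) hp hr)
    (mul_nonneg (sq_nonneg (flowK t p r)) hr) hp
  rw [← h2, h3] at h5
  have h6 : (backK t (flowP t p r) p (flowK t p r ^ 2 * r) * flowK t p r) ^ 2 = 1 := by
    rw [mul_pow, h5, div_mul_eq_mul_div, div_eq_one_iff_eq (by positivity)]
    linear_combination h1
  exact (pow_eq_one_iff_of_nonneg (by positivity) two_ne_zero).1 h6

/-- The relations that make `flowMap` undo `backMap`: the arguments `d` and `backK ^ 2 * r` are the
values of `p` and `r` at the point that the inverse of the flow reaches. -/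
lemma flow_back (hp : 0 < p) (hr : 0 ≤ r) (hd : 0 < d) (hdp : d ^ 2 = p ^ 2 - t ^ 2 * r ^ 2) :
    flowK t d (backK t p d r ^ 2 * r) * backK t p d r = 1 ∧
    flowC t d (backK t p d r ^ 2 * r) = backC p d ∧
    flowH t d (backK t p d r ^ 2 * r) * backK t p d r ^ 2 = backH t p d := by
  set r' := backK t p d r ^ 2 * r with hr'
  have hr0 : 0 ≤ r' := by positivity
  have h1 : d + r' = p + r := backK_sq_mul hp hr hd hdp
  have hS : flowS t d r' = p + t ^ 2 * r := by
    rw [flowS, show d ^ 2 + t ^ 2 * (r' * (2 * d + r')) = (p + t ^ 2 * r) ^ 2 by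
      linear_combination t ^ 2 * (d + r' + p + r) * h1 + (1 - t ^ 2) * hdp,
      Real.sqrt_sq (by positivity)]
  have hK : flowK t d r' * backK t p d r = 1 := by
    have h2 := flowK_pos (t := t) hd hr0
    have h3 := backK_pos (t := t) hp hr hd
    have h4 := flowK_sq (t := t) hd hr0
    rw [hS, h1] at h4
    have h6 : (flowK t d r' * backK t p d r) ^ 2 = 1 := by
      rw [mul_pow, backK_sq hp hr hd, ← mul_div_assoc, div_eq_one_iff_eq (by positivity)]
      linear_combination h4 + h1
    exact (pow_eq_one_iff_of_nonneg (by positivity) two_ne_zero).1 h6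
  have hP : flowP t d r' = p := by
    rw [flowP, h1, hr']
    linear_combination (-r * (flowK t d r' * backK t p d r + 1)) * hK
  have hC : flowC t d r' = backC p d := by rw [flowC, hP, backC]
  refine ⟨hK, hC, ?_⟩
  have h3 := backC_pos hp hd
  rw [flowH, hC, backH]
  field_simp
  linear_combination t * (flowK t d r' * backK t p d r + 1) * hK

end

/-! ### The gradient-Hamiltonian flow in homogeneous coordinates -/

/-- The real linear map `x_i ↦ C x_i + e x̄_i` (`i < m`), `x_m ↦ K x_m`, `x_i ↦ x_i` (`i > m`). -/
def twist {n : ℕ} (m : ℕ) (C : ℝ) (e : ℂ) (K : ℝ) (x : E n) : E n :=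
  WithLp.toLp 2 fun i => if (i : ℕ) < m then C * x i + e * star (x i)
    else if (i : ℕ) = m then K * x i else x i

@[simp] lemma twist_apply {n : ℕ} (m : ℕ) (C : ℝ) (e : ℂ) (K : ℝ) (x : E n) (i : Fin n) :
    twist m C e K x i = if (i : ℕ) < m then C * x i + e * star (x i)
      else if (i : ℕ) = m then K * x i else x i := rfl

lemma twist_smul {n m : ℕ} {C : ℝ} {e e' : ℂ} {K : ℝ} {c : ℂ} (x : E n)
    (h : e' * star c = c * e) : twist m C e' K (c • x) = c • twist m C e K x := by
  ext i
  simp only [twist_apply, PiLp.smul_apply, smul_eq_mul, star_mul']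
  split_ifs
  · linear_combination star (x i) * h
  · ring
  · rfl

/-- In the plane spanned by a vector and its conjugate, `twist` acts through the matrix with rows
`(C, e)` and `(ē, C)`, which has determinant `C ^ 2 - ‖e‖ ^ 2`. -/
lemma twist_twist {n m : ℕ} {C C' : ℝ} {e e' : ℂ} {K K' : ℝ} (x : E n)
    (hC : C' = C) (he : e' = -e) (h : C ^ 2 - ‖e‖ ^ 2 = 1) (hK : K' * K = 1) :
    twist m C' e' K' (twist m C e K x) = x := by
  have h1 : (C : ℂ) ^ 2 - e * star e = 1 := by
    rw [Complex.star_def, Complex.mul_conj']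
    exact_mod_cast congrArg (Complex.ofReal) h
  have h2 : (K' : ℂ) * K = 1 := by exact_mod_cast congrArg (Complex.ofReal) hK
  ext i
  simp only [twist_apply]
  split_ifs
  · simp only [star_add, star_mul', Complex.star_def, Complex.conj_ofReal, Complex.conj_conj,
      hC, he]
    rw [Complex.star_def] at h1
    linear_combination x i * h1
  · linear_combination x i * h2
  · rfl

lemma coord_twist_last {n m : ℕ} (hm : m < n) (C : ℝ) (e : ℂ) (K : ℝ) (x : E n) :
    coord (twist m C e K x) m = K * coord x m := by
  rw [coord_of_lt _ hm, coord_of_lt _ hm]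
  simp

lemma wt_succ {n m : ℕ} (t : ℂ) (i : Fin n) :
    wt (m + 1) t i = if (i : ℕ) < m then 1 else if (i : ℕ) = m then t else 0 := by
  simp [wt]

lemma bil_succ {n m : ℕ} (hm : m < n) (t : ℂ) (x y : E n) :
    bil (m + 1) t x y = bil (m + 1) 0 x y + t * (coord x m * coord y m) := by
  rw [bil, bil, coord_of_lt _ hm, coord_of_lt _ hm, ← sub_eq_iff_eq_add', ← Finset.sum_sub_distrib,
    Finset.sum_eq_single ⟨m, hm⟩]
  · simp [wt_succ]
  · intro i _ hi
    have : (i : ℕ) ≠ m := fun h => hi (Fin.ext h)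
    simp [wt_succ, this]
  · simp

lemma sqs_twist {n m : ℕ} (C : ℝ) (e : ℂ) (K : ℝ) (x : E n) :
    sqs m (twist m C e K x) = C ^ 2 * sqs m x + 2 * C * e * nsq m x + e ^ 2 * star (sqs m x) := by
  rw [nsq_eq_bil, sqs, sqs, ← bil_zero_cj_cj]
  simp only [bil, Finset.mul_sum, ← Finset.sum_add_distrib]
  refine Finset.sum_congr rfl fun i _ => ?_
  rw [wt_zero]
  by_cases h : (i : ℕ) < m
  · simp [h]
    ring
  · simp [h]

lemma nsq_twist {n m : ℕ} (C : ℝ) (e : ℂ) (K : ℝ) (x : E n) :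
    nsq m (twist m C e K x) =
      (C ^ 2 + ‖e‖ ^ 2) * nsq m x + 2 * C * (star e * sqs m x).re := by
  have h : (nsq m (twist m C e K x) : ℂ) = (C ^ 2 + e * star e) * nsq m x +
      C * (star e * sqs m x + e * star (sqs m x)) := by
    rw [nsq_eq_bil, nsq_eq_bil, sqs, ← bil_zero_cj_cj]
    simp only [bil, Finset.mul_sum, ← Finset.sum_add_distrib]
    refine Finset.sum_congr rfl fun i _ => ?_
    rw [wt_zero]
    by_cases h : (i : ℕ) < m
    · simp [h]
      ring
    · simp [h]
  have h2 : star e * sqs m x + e * star (sqs m x) = ((2 * (star e * sqs m x).re : ℝ) : ℂ) := by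
    have := Complex.add_conj (star e * sqs m x)
    rw [map_mul, Complex.star_def, Complex.conj_conj] at this
    rw [Complex.star_def, this]
  rw [h2, Complex.star_def, Complex.mul_conj'] at h
  have h3 : nsq m (twist m C e K x) = (C ^ 2 + ‖e‖ ^ 2) * nsq m x +
      C * (2 * (star e * sqs m x).re) := by exact_mod_cast h
  rw [h3]; ring

lemma nsq_succ {n m : ℕ} (hm : m < n) (x : E n) :
    nsq (m + 1) x = nsq m x + ‖coord x m‖ ^ 2 := by
  rw [nsq, nsq, coord_of_lt _ hm, ← sub_eq_iff_eq_add', ← Finset.sum_sub_distrib,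
    Finset.sum_eq_single ⟨m, hm⟩]
  · simp
  · intro i _ hi
    have : (i : ℕ) ≠ m := fun h => hi (Fin.ext h)
    by_cases h : (i : ℕ) < m
    · simp [h, h.le.trans_lt (Nat.lt_succ_self m)]
    · simp [h, show ¬ (i : ℕ) < m + 1 by omega]
  · simp

lemma nsq_twist_of_lt {n m j : ℕ} (hm : m < n) (hj : m < j) (C : ℝ) (e : ℂ) (K : ℝ) (x : E n)
    (h : nsq m (twist m C e K x) + K ^ 2 * ‖coord x m‖ ^ 2 = nsq m x + ‖coord x m‖ ^ 2) :
    nsq j (twist m C e K x) = nsq j x := by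
  have hb : nsq (m + 1) (twist m C e K x) = nsq (m + 1) x := by
    rw [nsq_succ hm, nsq_succ hm, coord_twist_last hm, norm_mul, mul_pow, Complex.norm_real,
      Real.norm_eq_abs, sq_abs, h]
  have hsub : nsq j (twist m C e K x) - nsq j x =
      nsq (m + 1) (twist m C e K x) - nsq (m + 1) x := by
    simp only [nsq, ← Finset.sum_sub_distrib]
    refine Finset.sum_congr rfl fun i _ => ?_
    rcases Nat.lt_or_ge m i with hi | hi
    · have h1 : ¬ (i : ℕ) < m := by omega
      have h2 : ¬ (i : ℕ) = m := by omega
      simp [h1, h2]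
    · simp [show (i : ℕ) < m + 1 by omega, show (i : ℕ) < j by omega]
  linarith

lemma norm_sq_eq_nsq {n : ℕ} (x : E n) : ‖x‖ ^ 2 = nsq n x := by
  rw [norm_sq_eq, nsq]
  exact Finset.sum_congr rfl fun i _ => by rw [if_pos i.2]

lemma im_twist {n m : ℕ} {C : ℝ} {e : ℂ} {K : ℝ} (h : C ^ 2 - ‖e‖ ^ 2 = 1) (x : E n) {i j : Fin n}
    (hi : (i : ℕ) < m) (hj : (j : ℕ) < m) :
    (star (twist m C e K x i) * twist m C e K x j).im = (star (x i) * x j).im := by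
  rw [← Complex.normSq_eq_norm_sq, Complex.normSq_apply] at h
  simp [hi, hj]
  linear_combination ((x i).re * (x j).im - (x i).im * (x j).re) * h

lemma disc_twist {n m j : ℕ} (hj : j ≤ m) {C : ℝ} {e : ℂ} {K : ℝ} (h : C ^ 2 - ‖e‖ ^ 2 = 1)
    (x : E n) : disc j (twist m C e K x) = disc j x := by
  rw [disc_eq_sum, disc_eq_sum]
  congr 1
  refine Finset.sum_congr rfl fun i _ => Finset.sum_congr rfl fun l _ => ?_
  split_ifs with hil
  · rw [im_twist h x (hil.1.trans_le hj) (hil.2.trans_le hj)]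
  · rfl

lemma num_twist {n m j : ℕ} (h2 : 2 ≤ m) (hm : m < n) {C : ℝ} {e : ℂ} {K : ℝ}
    (h : C ^ 2 - ‖e‖ ^ 2 = 1) (x : E n)
    (hP : nsq m (twist m C e K x) + K ^ 2 * ‖coord x m‖ ^ 2 = nsq m x + ‖coord x m‖ ^ 2) :
    num (m + 1) j (twist m C e K x) = num (m + 1) j x := by
  rw [num, num]
  split_ifs with hj
  · rw [ell, ell, disc_twist (by omega) h, coord_of_lt _ (by omega : 0 < n),
      coord_of_lt _ (by omega : 1 < n), im_twist h x (by simp; omega) (by simp; omega),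
      coord_of_lt _ (by omega : 0 < n), coord_of_lt _ (by omega : 1 < n)]
  · exact nsq_twist_of_lt hm (by omega) C e K x hP

/-- The map of homogeneous coordinates that carries the regular points of `X_{m+1,0}` along the
gradient-Hamiltonian flow, backwards in time, to `X_{m+1,t}`. -/
def flowMap {n : ℕ} (m : ℕ) (t : ℝ) (x : E n) : E n :=
  twist m (flowC t (nsq m x) (‖coord x m‖ ^ 2))
    (-(flowH t (nsq m x) (‖coord x m‖ ^ 2) * coord x m ^ 2))
    (flowK t (nsq m x) (‖coord x m‖ ^ 2)) x

/-- The inverse of `flowMap`, on the points of `X_{m+1,t}` where `disc m` does not vanish. -/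
def backMap {n : ℕ} (m : ℕ) (t : ℝ) (x : E n) : E n :=
  twist m (backC (nsq m x) √(disc m x))
    (backH t (nsq m x) √(disc m x) * coord x m ^ 2)
    (backK t (nsq m x) √(disc m x) (‖coord x m‖ ^ 2)) x

section
variable {n m : ℕ} {t : ℝ} {x : E n}

lemma flow_norm_sq (hp : 0 < nsq m x) :
    flowC t (nsq m x) (‖coord x m‖ ^ 2) ^ 2 -
      ‖-((flowH t (nsq m x) (‖coord x m‖ ^ 2) : ℂ) * coord x m ^ 2)‖ ^ 2 = 1 := by
  rw [norm_neg, norm_mul, norm_pow, Complex.norm_real, Real.norm_eq_abs, mul_pow, sq_abs,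
    ← mul_pow, flowC_sq_sub hp (sq_nonneg _)]

lemma bil_flowMap (hm : m < n) (hp : 0 < nsq m x) :
    bil (m + 1) t (flowMap m t x) (flowMap m t x) =
      flowC t (nsq m x) (‖coord x m‖ ^ 2) ^ 2 * sqs m x +
      (flowH t (nsq m x) (‖coord x m‖ ^ 2) * coord x m ^ 2) ^ 2 * star (sqs m x) := by
  have h := congrArg Complex.ofReal
    (flowC_mul_flowH (t := t) hp (sq_nonneg ‖coord x m‖))
  push_cast at h
  rw [bil_succ hm]
  change sqs m _ + _ = _
  rw [flowMap, sqs_twist, coord_twist_last hm]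
  linear_combination (-coord x m ^ 2) * h

lemma nsq_flowMap (hp : 0 < nsq m x) (hq : sqs m x = 0) :
    nsq m (flowMap m t x) = flowP t (nsq m x) (‖coord x m‖ ^ 2) := by
  have h1 := flow_norm_sq (t := t) hp
  have h2 := flowC_sq (t := t) hp (sq_nonneg ‖coord x m‖)
  rw [flowMap, nsq_twist, hq]
  simp only [mul_zero, Complex.zero_re, add_zero]
  linear_combination h2 - nsq m x * h1

lemma nsq_flowMap_add (hp : 0 < nsq m x) (hq : sqs m x = 0) :
    nsq m (flowMap m t x) + flowK t (nsq m x) (‖coord x m‖ ^ 2) ^ 2 * ‖coord x m‖ ^ 2 =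
      nsq m x + ‖coord x m‖ ^ 2 := by
  rw [nsq_flowMap hp hq, flowP]; ring

lemma norm_flowMap (hm : m < n) (hp : 0 < nsq m x) (hq : sqs m x = 0) :
    ‖flowMap m t x‖ = ‖x‖ := by
  rw [← pow_left_inj₀ (norm_nonneg _) (norm_nonneg _) two_ne_zero, norm_sq_eq_nsq, norm_sq_eq_nsq]
  exact nsq_twist_of_lt hm hm _ _ _ _ (nsq_flowMap_add hp hq)

lemma disc_flowMap {j : ℕ} (hj : j ≤ m) (hp : 0 < nsq m x) :
    disc j (flowMap m t x) = disc j x := disc_twist hj (flow_norm_sq hp) x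

lemma num_flowMap {j : ℕ} (h2 : 2 ≤ m) (hm : m < n) (hp : 0 < nsq m x) (hq : sqs m x = 0) :
    num (m + 1) j (flowMap m t x) = num (m + 1) j x :=
  num_twist h2 hm (flow_norm_sq hp) x (nsq_flowMap_add hp hq)

lemma flowMap_smul {c : ℂ} (hc : c ≠ 0) : flowMap m t (c • x) = c • flowMap m t x := by
  have ha : 0 < ‖c‖ ^ 2 := by positivity
  obtain ⟨h1, h2, h3⟩ := flow_smul (t := t) (p := nsq m x) (r := ‖coord x m‖ ^ 2) ha
  rw [flowMap, nsq_smul, coord_smul, norm_mul, mul_pow, h1, h2, h3]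
  refine twist_smul x ?_
  have h4 : c * star c = ((‖c‖ ^ 2 : ℝ) : ℂ) := by
    rw [Complex.star_def, Complex.mul_conj']; push_cast; rfl
  have h5 : ((‖c‖ ^ 2 : ℝ) : ℂ) ≠ 0 := by exact_mod_cast ha.ne'
  rw [Complex.ofReal_div]
  field_simp
  linear_combination (-coord x m ^ 2 * flowH t (nsq m x) (‖coord x m‖ ^ 2)) * h4

lemma flowMap_zero (hp : 0 < nsq m x) : flowMap m 0 x = x := by
  obtain ⟨h1, h2, h3⟩ := flow_zero hp (sq_nonneg ‖coord x m‖)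
  rw [flowMap, h1, h2, h3]
  ext i
  simp

lemma backMap_smul {c : ℂ} (hc : c ≠ 0) : backMap m t (c • x) = c • backMap m t x := by
  have ha : 0 < ‖c‖ ^ 2 := by positivity
  obtain ⟨h1, h2, h3⟩ := back_smul (t := t) (p := nsq m x) (d := √(disc m x))
    (r := ‖coord x m‖ ^ 2) ha
  have hs : √(disc m (c • x)) = ‖c‖ ^ 2 * √(disc m x) := by
    rw [disc_smul, Real.sqrt_mul (by positivity), show ‖c‖ ^ 4 = (‖c‖ ^ 2) ^ 2 by ring,
      Real.sqrt_sq ha.le]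
  rw [backMap, hs, nsq_smul, coord_smul, norm_mul, mul_pow ‖c‖, h1, h2, h3]
  refine twist_smul x ?_
  have h4 : c * star c = ((‖c‖ ^ 2 : ℝ) : ℂ) := by
    rw [Complex.star_def, Complex.mul_conj']; push_cast; rfl
  have h5 : ((‖c‖ ^ 2 : ℝ) : ℂ) ≠ 0 := by exact_mod_cast ha.ne'
  rw [Complex.ofReal_div]
  field_simp
  linear_combination (coord x m ^ 2 * backH t (nsq m x) √(disc m x)) * h4

/-- On the punctured cone of `X_{m+1,t}`, `disc m` is `p² - t² r²`. -/
lemma sq_sqrt_disc (hm : m < n) (hx : bil (m + 1) t x x = 0) :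
    √(disc m x) ^ 2 = nsq m x ^ 2 - t ^ 2 * (‖coord x m‖ ^ 2) ^ 2 := by
  rw [bil_succ hm] at hx
  have h : sqs m x = -(t * coord x m ^ 2) := by
    rw [sqs]; linear_combination hx
  rw [Real.sq_sqrt (disc_nonneg m x), disc, h, norm_neg, norm_mul, norm_pow, Complex.norm_real,
    mul_pow, Real.norm_eq_abs, sq_abs]

lemma back_norm_sq (hm : m < n) (hx : bil (m + 1) t x x = 0) (hd : 0 < disc m x) :
    backC (nsq m x) √(disc m x) ^ 2 -
      ‖(backH t (nsq m x) √(disc m x) : ℂ) * coord x m ^ 2‖ ^ 2 = 1 := by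
  rw [norm_mul, norm_pow, Complex.norm_real, Real.norm_eq_abs, mul_pow, sq_abs,
    ← mul_pow, backC_sq_sub (nsq_pos_of_disc_pos hd) (Real.sqrt_pos.2 hd) (sq_sqrt_disc hm hx)]

/-- The factor by which `backMap` multiplies the equation of `X_{m+1,t}`. -/
def backFactor {n : ℕ} (m : ℕ) (t : ℝ) (x : E n) : ℂ :=
  (nsq m x : ℂ) / √(disc m x) + (bil (m + 1) t x x - 2 * sqs m x) * star (sqs m x) /
    (2 * √(disc m x) * (nsq m x + √(disc m x)))

/-- `backMap` carries the equation of `X_{m+1,t}` to a multiple of the equation of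
`X_{m+1,0}`. -/
lemma sqs_backMap (hm : m < n) (hd : 0 < disc m x) :
    sqs m (backMap m t x) = bil (m + 1) t x x * backFactor m t x := by
  have hp := nsq_pos_of_disc_pos hd
  have hd' := Real.sqrt_pos.2 hd
  have h1 := congrArg Complex.ofReal (backC_sq hp hd')
  have h2 := congrArg Complex.ofReal (backH_mul (t := t) hp hd')
  have h3 : (√(disc m x) : ℂ) ^ 2 = nsq m x ^ 2 - sqs m x * star (sqs m x) := by
    rw [Complex.star_def, Complex.mul_conj']
    exact_mod_cast congrArg Complex.ofReal (Real.sq_sqrt hd.le)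
  have h4 := bil_succ hm t x x
  change _ = sqs m x + _ at h4
  push_cast at h1 h2
  have hC : (backC (nsq m x) √(disc m x) : ℂ) ≠ 0 := by exact_mod_cast (backC_pos hp hd').ne'
  have hd0 : (√(disc m x) : ℂ) ≠ 0 := by exact_mod_cast hd'.ne'
  have hpd : (nsq m x + √(disc m x) : ℂ) ≠ 0 := by
    exact_mod_cast (add_pos hp hd').ne'
  have h5 : (2 * √(disc m x) * (nsq m x + √(disc m x)) : ℂ) *
      (backH t (nsq m x) √(disc m x)) ^ 2 = t ^ 2 := by
    rw [← h1, ← h2]; ring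
  have h6 : (2 * √(disc m x) * (nsq m x + √(disc m x)) : ℂ) ≠ 0 := by simp [hd0, hpd]
  rw [backFactor, h4, backMap, sqs_twist]
  refine mul_left_cancel₀ h6 ?_
  field_simp
  linear_combination (nsq m x + √(disc m x) : ℂ) * sqs m x * h1 +
    coord x m ^ 4 * star (sqs m x) * h5 +
    2 * nsq m x * (nsq m x + √(disc m x) : ℂ) * coord x m ^ 2 * h2 + sqs m x * h3

lemma nsq_backMap (hm : m < n) (hx : bil (m + 1) t x x = 0) (hd : 0 < disc m x) :
    nsq m (backMap m t x) = √(disc m x) := by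
  have hp := nsq_pos_of_disc_pos hd
  have hd' := Real.sqrt_pos.2 hd
  have h1 := back_norm_sq hm hx hd
  have h2 := backC_sq hp hd'
  have h3 := backH_mul (t := t) hp hd'
  have h4 := sq_sqrt_disc hm hx
  have hs : sqs m x = -(t * coord x m ^ 2) := by
    rw [bil_succ hm] at hx
    rw [sqs]; linear_combination hx
  have h5 : (star ((backH t (nsq m x) √(disc m x) : ℂ) * coord x m ^ 2) * sqs m x).re =
      -(t * backH t (nsq m x) √(disc m x) * (‖coord x m‖ ^ 2) ^ 2) := by
    have h6 := Complex.conj_mul' (coord x m ^ 2)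
    rw [norm_pow] at h6
    push_cast at h6
    have : star ((backH t (nsq m x) √(disc m x) : ℂ) * coord x m ^ 2) * sqs m x =
        ((-(t * backH t (nsq m x) √(disc m x) * (‖coord x m‖ ^ 2) ^ 2) : ℝ) : ℂ) := by
      rw [star_mul', hs, Complex.star_def, Complex.conj_ofReal]
      push_cast
      linear_combination (-(t : ℂ) * backH t (nsq m x) √(disc m x)) * h6
    rw [this, Complex.ofReal_re]
  rw [backMap, nsq_twist, h5]
  refine mul_left_cancel₀ hd'.ne' ?_
  linear_combination (-√(disc m x) * nsq m x) * h1 + nsq m x * h2 -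
    t * (‖coord x m‖ ^ 2) ^ 2 * h3 - h4

lemma norm_coord_backMap (hm : m < n) : ‖coord (backMap m t x) m‖ ^ 2 =
    backK t (nsq m x) √(disc m x) (‖coord x m‖ ^ 2) ^ 2 * ‖coord x m‖ ^ 2 := by
  rw [backMap, coord_twist_last hm, norm_mul, mul_pow, Complex.norm_real, Real.norm_eq_abs, sq_abs]

lemma norm_coord_flowMap (hm : m < n) : ‖coord (flowMap m t x) m‖ ^ 2 =
    flowK t (nsq m x) (‖coord x m‖ ^ 2) ^ 2 * ‖coord x m‖ ^ 2 := by
  rw [flowMap, coord_twist_last hm, norm_mul, mul_pow, Complex.norm_real, Real.norm_eq_abs, sq_abs]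

lemma disc_backMap {j : ℕ} (hm : m < n) (hj : j ≤ m) (hx : bil (m + 1) t x x = 0)
    (hd : 0 < disc m x) : disc j (backMap m t x) = disc j x :=
  disc_twist hj (back_norm_sq hm hx hd) x

lemma flowMap_backMap (hm : m < n) (hx : bil (m + 1) t x x = 0) (hd : 0 < disc m x) :
    flowMap m t (backMap m t x) = x := by
  obtain ⟨h1, h2, h3⟩ := flow_back (nsq_pos_of_disc_pos hd) (sq_nonneg ‖coord x m‖)
    (Real.sqrt_pos.2 hd) (sq_sqrt_disc hm hx)
  rw [flowMap, nsq_backMap hm hx hd, norm_coord_backMap hm, backMap, coord_twist_last hm]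
  refine twist_twist x h2 ?_ (back_norm_sq hm hx hd) h1
  rw [← h3]
  push_cast
  ring

lemma backMap_flowMap (hm : m < n) (hp : 0 < nsq m x) (hq : sqs m x = 0) :
    backMap m t (flowMap m t x) = x := by
  have hd : √(disc m (flowMap m t x)) = nsq m x := by
    rw [disc_flowMap le_rfl hp, disc, hq, norm_zero]
    simp [Real.sqrt_sq hp.le]
  rw [backMap, hd, nsq_flowMap hp hq, norm_coord_flowMap hm, flowMap, coord_twist_last hm]
  refine twist_twist x rfl ?_ (flow_norm_sq hp) (backK_flow hp (sq_nonneg _))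
  rw [neg_neg, backH, flowH, flowC, backC]
  push_cast
  ring

end

/-! ### Smoothness of the flow and its differential equation -/

section
variable {F : Type*} [NormedAddCommGroup F] [NormedSpace ℝ F] {z : F}

lemma ContDiffAt.ofReal_comp {f : F → ℝ} (h : ContDiffAt ℝ ∞ f z) :
    ContDiffAt ℝ ∞ (fun y => (f y : ℂ)) z := Complex.ofRealCLM.contDiff.contDiffAt.comp z h

lemma ContDiffAt.star_comp {f : F → ℂ} (h : ContDiffAt ℝ ∞ f z) :
    ContDiffAt ℝ ∞ (fun y => star (f y)) z := Complex.conjCLE.contDiff.contDiffAt.comp z h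

lemma contDiffAt_twist {n : ℕ} (m : ℕ) {C K : F → ℝ} {e : F → ℂ} {x : F → E n}
    (hC : ContDiffAt ℝ ∞ C z) (he : ContDiffAt ℝ ∞ e z) (hK : ContDiffAt ℝ ∞ K z)
    (hx : ContDiffAt ℝ ∞ x z) : ContDiffAt ℝ ∞ (fun y => twist m (C y) (e y) (K y) (x y)) z := by
  rw [contDiffAt_piLp]
  intro i
  have hi : ContDiffAt ℝ ∞ (fun y => x y i) z := (contDiffAt_piLp 2).1 hx i
  simp only [twist_apply]
  split_ifs
  · exact (hC.ofReal_comp.mul hi).add (he.mul hi.star_comp)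
  · exact hK.ofReal_comp.mul hi
  · exact hi

variable {t p r d : F → ℝ}

lemma contDiffAt_flowS (ht : ContDiffAt ℝ ∞ t z) (hp : ContDiffAt ℝ ∞ p z)
    (hr : ContDiffAt ℝ ∞ r z) (hp0 : 0 < p z) (hr0 : 0 ≤ r z) :
    ContDiffAt ℝ ∞ (fun y => flowS (t y) (p y) (r y)) z :=
  ((hp.pow 2).add ((ht.pow 2).mul (hr.mul ((contDiffAt_const.mul hp).add hr)))).sqrt
    (by positivity)

lemma contDiffAt_flowK (ht : ContDiffAt ℝ ∞ t z) (hp : ContDiffAt ℝ ∞ p z)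
    (hr : ContDiffAt ℝ ∞ r z) (hp0 : 0 < p z) (hr0 : 0 ≤ r z) :
    ContDiffAt ℝ ∞ (fun y => flowK (t y) (p y) (r y)) z := by
  have := flowS_pos (t := t z) hp0 hr0
  exact (((contDiffAt_const.mul hp).add hr).div
    ((hp.add hr).add (contDiffAt_flowS ht hp hr hp0 hr0)) (by positivity)).sqrt
    (by change (2 * p z + r z) / (p z + r z + flowS (t z) (p z) (r z)) ≠ 0; positivity)

lemma contDiffAt_flowC (ht : ContDiffAt ℝ ∞ t z) (hp : ContDiffAt ℝ ∞ p z)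
    (hr : ContDiffAt ℝ ∞ r z) (hp0 : 0 < p z) (hr0 : 0 ≤ r z) :
    ContDiffAt ℝ ∞ (fun y => flowC (t y) (p y) (r y)) z := by
  have := flowP_pos (t := t z) hp0 hr0
  exact ((((hp.add hr).sub (((contDiffAt_flowK ht hp hr hp0 hr0).pow 2).mul hr)).add hp).div
    (contDiffAt_const.mul hp) (by positivity)).sqrt
    (by change (flowP (t z) (p z) (r z) + p z) / (2 * p z) ≠ 0; positivity)

lemma contDiffAt_flowH (ht : ContDiffAt ℝ ∞ t z) (hp : ContDiffAt ℝ ∞ p z)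
    (hr : ContDiffAt ℝ ∞ r z) (hp0 : 0 < p z) (hr0 : 0 ≤ r z) :
    ContDiffAt ℝ ∞ (fun y => flowH (t y) (p y) (r y)) z := by
  have := flowC_pos (t := t z) hp0 hr0
  exact (ht.mul ((contDiffAt_flowK ht hp hr hp0 hr0).pow 2)).div
    ((contDiffAt_const.mul hp).mul (contDiffAt_flowC ht hp hr hp0 hr0)) (by positivity)

lemma contDiffAt_backC (hp : ContDiffAt ℝ ∞ p z) (hd : ContDiffAt ℝ ∞ d z)
    (hp0 : 0 < p z) (hd0 : 0 < d z) :
    ContDiffAt ℝ ∞ (fun y => backC (p y) (d y)) z :=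
  ((hp.add hd).div (contDiffAt_const.mul hd) (by positivity)).sqrt
    (by change (p z + d z) / (2 * d z) ≠ 0; positivity)

end

section
variable {n m : ℕ} {t : ℝ} {x : E n}

lemma contDiff_norm_sq_coord (m : ℕ) : ContDiff ℝ ∞ fun x : E n => ‖coord x m‖ ^ 2 :=
  (contDiff_coord m).norm_sq ℝ

lemma contDiffAt_flowMap (hp : 0 < nsq m x) :
    ContDiffAt ℝ ∞ (fun z : ℝ × E n => flowMap m z.1 z.2) (t, x) := by
  have ht : ContDiffAt ℝ ∞ (fun z : ℝ × E n => z.1) (t, x) := contDiffAt_fst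
  have hP : ContDiffAt ℝ ∞ (fun z : ℝ × E n => nsq m z.2) (t, x) :=
    (contDiff_nsq m).contDiffAt.comp _ contDiffAt_snd
  have hR : ContDiffAt ℝ ∞ (fun z : ℝ × E n => ‖coord z.2 m‖ ^ 2) (t, x) :=
    (contDiff_norm_sq_coord m).contDiffAt.comp _ contDiffAt_snd
  have hc : ContDiffAt ℝ ∞ (fun z : ℝ × E n => coord z.2 m) (t, x) :=
    (contDiff_coord m).contDiffAt.comp _ contDiffAt_snd
  exact contDiffAt_twist m (contDiffAt_flowC ht hP hR hp (sq_nonneg _))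
    (((contDiffAt_flowH ht hP hR hp (sq_nonneg _)).ofReal_comp.mul (hc.pow 2)).neg)
    (contDiffAt_flowK ht hP hR hp (sq_nonneg _)) contDiffAt_snd

lemma contDiffAt_flowMap_right (hp : 0 < nsq m x) : ContDiffAt ℝ ∞ (flowMap m t) x :=
  (contDiffAt_flowMap (t := t) hp).comp x (contDiffAt_const.prodMk contDiffAt_id)

lemma contDiffAt_backMap (hd : 0 < disc m x) : ContDiffAt ℝ ∞ (backMap m t) x := by
  have hd' := Real.sqrt_pos.2 hd
  have hp := nsq_pos_of_disc_pos hd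
  have hP : ContDiffAt ℝ ∞ (fun z : E n => nsq m z) x := (contDiff_nsq m).contDiffAt
  have hR : ContDiffAt ℝ ∞ (fun z : E n => ‖coord z m‖ ^ 2) x :=
    (contDiff_norm_sq_coord m).contDiffAt
  have hD : ContDiffAt ℝ ∞ (fun z : E n => √(disc m z)) x :=
    (contDiff_disc m).contDiffAt.sqrt hd.ne'
  have hC := contDiffAt_backC hP hD hp hd'
  have hC0 := backC_pos hp hd'
  have hH : ContDiffAt ℝ ∞ (fun z : E n => backH t (nsq m z) √(disc m z)) x :=
    contDiffAt_const.div ((contDiffAt_const.mul hD).mul hC) (by positivity)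
  have hK : ContDiffAt ℝ ∞
      (fun z : E n => backK t (nsq m z) √(disc m z) (‖coord z m‖ ^ 2)) x :=
    (((hP.add hR).add (hP.add (contDiffAt_const.mul hR))).div ((hP.add hR).add hD)
      (by positivity)).sqrt (by
        change (nsq m x + ‖coord x m‖ ^ 2 + (nsq m x + t ^ 2 * ‖coord x m‖ ^ 2)) /
          (nsq m x + ‖coord x m‖ ^ 2 + √(disc m x)) ≠ 0
        positivity)
  exact contDiffAt_twist m hC (hH.ofReal_comp.mul ((contDiff_coord m).contDiffAt.pow 2)) hK
    contDiffAt_id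

lemma contDiffAt_backFactor (hd : 0 < disc m x) : ContDiffAt ℝ ∞ (backFactor m t) x := by
  have hd' := Real.sqrt_pos.2 hd
  have hp := nsq_pos_of_disc_pos hd
  have hP : ContDiffAt ℝ ∞ (fun z : E n => (nsq m z : ℂ)) x :=
    (contDiff_nsq m).contDiffAt.ofReal_comp
  have hD : ContDiffAt ℝ ∞ (fun z : E n => (√(disc m z) : ℂ)) x :=
    ((contDiff_disc m).contDiffAt.sqrt hd.ne').ofReal_comp
  have hq : ContDiffAt ℝ ∞ (fun z : E n => sqs m z) x := (contDiff_sqs m).contDiffAt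
  have h1 : (√(disc m x) : ℂ) ≠ 0 := by exact_mod_cast hd'.ne'
  have h2 : (nsq m x + √(disc m x) : ℂ) ≠ 0 := by exact_mod_cast (add_pos hp hd').ne'
  unfold backFactor
  simp only [div_eq_mul_inv]
  exact (hP.mul (hD.inv h1)).add ((((contDiff_bil (m + 1) t).contDiffAt.sub
    (contDiffAt_const.mul hq)).mul hq.star_comp).mul
    (((contDiffAt_const.mul hD).mul (hP.add hD)).inv (by simp [h1, h2])))

/-- The vector representing the differential of the equation: `⟨dualVec k t y, w⟩` is the value
at `y, w` of the bilinear form of `X_{k,t}`. -/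
def dualVec {n : ℕ} (k : ℕ) (t : ℂ) (y : E n) : E n := WithLp.toLp 2 fun i => star (wt k t i * y i)

lemma inner_dualVec {k : ℕ} (t : ℂ) (y w : E n) : inner ℂ (dualVec k t y) w = bil k t y w := by
  rw [inner_eq_sum, bil]
  refine Finset.sum_congr rfl fun i _ => ?_
  simp [dualVec, mul_assoc]

/-- The coefficient of the velocity of `flowMap` along the dual vector. -/
def speed {n : ℕ} (m : ℕ) (t : ℝ) (x : E n) : ℂ :=
  -(coord (flowMap m t x) m ^ 2 / (2 * flowS t (nsq m x) (‖coord x m‖ ^ 2)))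

lemma dualVec_apply {k : ℕ} (t : ℂ) (y : E n) (i : Fin n) :
    dualVec k t y i = star (wt k t i * y i) := rfl

lemma hasDerivAt_of_coord {f : ℝ → E n} {f' : E n} {t : ℝ}
    (h : ∀ i, HasDerivAt (fun s => f s i) (f' i) t) : HasDerivAt f f' t := by
  rw [hasDerivAt_iff_hasFDerivAt, ← hasFDerivWithinAt_univ, hasFDerivWithinAt_piLp]
  intro i
  rw [hasFDerivWithinAt_univ]
  refine (h i).hasFDerivAt.congr_fderiv ?_
  ext
  simp

/-- `flowMap` solves the differential equation of the gradient-Hamiltonian flow. -/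
lemma hasDerivAt_flowMap (hm : m < n) (hp : 0 < nsq m x) :
    HasDerivAt (fun t => flowMap m t x)
      (speed m t x • dualVec (m + 1) t (flowMap m t x)) t := by
  have hr := sq_nonneg ‖coord x m‖
  have hC := (hasDerivAt_flowC (t := t) hp hr).ofReal_comp
  have hH := (hasDerivAt_flowH (t := t) hp hr).ofReal_comp
  have hK := (hasDerivAt_flowK (t := t) hp hr).ofReal_comp
  have hS : (flowS t (nsq m x) (‖coord x m‖ ^ 2) : ℂ) ≠ 0 := by
    exact_mod_cast (flowS_pos (t := t) hp hr).ne'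
  have hcc : star (coord x m) * coord x m = (‖coord x m‖ : ℂ) ^ 2 := Complex.conj_mul' _
  refine hasDerivAt_of_coord fun i => ?_
  rw [PiLp.smul_apply, smul_eq_mul, speed, dualVec_apply, wt_succ]
  simp only [flowMap, twist_apply, coord_twist_last hm]
  split_ifs with h1 h2
  · refine ((hC.mul_const (x i)).fun_add
      ((hH.mul_const (coord x m ^ 2)).fun_neg.mul_const (star (x i)))).congr_deriv ?_
    push_cast
    simp only [one_mul, star_add, star_mul', star_neg, star_pow, Complex.star_def,
      Complex.conj_ofReal, Complex.conj_conj] at hcc ⊢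
    field_simp
    linear_combination (-(flowK t (nsq m x) (‖coord x m‖ ^ 2) : ℂ) ^ 2 *
      flowH t (nsq m x) (‖coord x m‖ ^ 2) * x i *
      ((starRingEnd ℂ) (coord x m) * coord x m + ‖coord x m‖ ^ 2)) * hcc
  · refine (hK.mul_const (x i)).congr_deriv ?_
    have hx : coord x m = x i := by
      rw [coord_of_lt _ hm, show (⟨m, hm⟩ : Fin n) = i from Fin.ext h2.symm]
    rw [hx] at hcc ⊢
    push_cast
    simp only [star_mul', Complex.star_def, Complex.conj_ofReal] at hcc ⊢
    field_simp
    linear_combination (t * (flowK t (nsq m x) (‖x i‖ ^ 2) : ℂ) ^ 3 * x i /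
      flowS t (nsq m x) (‖x i‖ ^ 2)) * hcc
  · exact (hasDerivAt_const _ _).congr_deriv (by simp)

lemma isOpen_nsq_pos (m : ℕ) : IsOpen {x : E n | 0 < nsq m x} :=
  isOpen_lt continuous_const (contDiff_nsq m).continuous

lemma contDiffAt_speed (hp : 0 < nsq m x) :
    ContDiffAt ℝ ∞ (fun z : ℝ × E n => speed m z.1 z.2) (t, x) := by
  have hS : ContDiffAt ℝ ∞
      (fun z : ℝ × E n => flowS z.1 (nsq m z.2) (‖coord z.2 m‖ ^ 2)) (t, x) :=
    contDiffAt_flowS contDiffAt_fst ((contDiff_nsq m).contDiffAt.comp _ contDiffAt_snd)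
      ((contDiff_norm_sq_coord m).contDiffAt.comp _ contDiffAt_snd) hp (sq_nonneg _)
  have hS0 : (flowS t (nsq m x) (‖coord x m‖ ^ 2) : ℂ) ≠ 0 := by
    exact_mod_cast (flowS_pos (t := t) hp (sq_nonneg ‖coord x m‖)).ne'
  have hc : ContDiffAt ℝ ∞ (fun z : ℝ × E n => coord (flowMap m z.1 z.2) m) (t, x) :=
    (contDiff_coord m).contDiffAt.comp (t, x) (contDiffAt_flowMap hp)
  unfold speed
  simp only [div_eq_mul_inv]
  exact ((hc.pow 2).mul ((contDiffAt_const.mul hS.ofReal_comp).inv (by simp [hS0]))).neg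

lemma hasFDerivAt_flowMap_right (hp : 0 < nsq m x) :
    HasFDerivAt (flowMap m t) (fderiv ℝ (flowMap m t) x) x :=
  ((contDiffAt_flowMap_right hp).differentiableAt (by simp)).hasFDerivAt

lemma hasDerivAt_line {F : Type*} [NormedAddCommGroup F] [NormedSpace ℝ F] (x v : F) :
    HasDerivAt (fun s : ℝ => x + s • v) v 0 := by
  have := ((hasDerivAt_id (0 : ℝ)).smul_const v).const_add x
  simpa using this

lemma hasDerivAt_fderiv_apply {F G : Type*} [NormedAddCommGroup F] [NormedSpace ℝ F]
    [NormedAddCommGroup G] [NormedSpace ℝ G] {f : F → G} {z : F} {f2 : F →L[ℝ] F →L[ℝ] G}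
    (h : HasFDerivAt (fderiv ℝ f) f2 z) {γ : ℝ → F} {s : ℝ} {u : F} (hγ : HasDerivAt γ u s)
    (hz : γ s = z) (w : F) : HasDerivAt (fun r => fderiv ℝ f (γ r) w) (f2 u w) s := by
  subst hz
  exact ((ContinuousLinearMap.apply ℝ G w).hasFDerivAt.comp_hasDerivAt s
    (h.comp_hasDerivAt s hγ))

/-- The variational equation: if `∂_t f = T`, then the derivative of `f` in a direction `v` has
time derivative `∂_v T`, by the symmetry of the second derivative. -/
lemma hasDerivAt_fderiv_of_time_deriv {F G : Type*} [NormedAddCommGroup F] [NormedSpace ℝ F]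
    [NormedAddCommGroup G] [NormedSpace ℝ G] {f T : ℝ × F → G} {t : ℝ} {x v : F}
    (hf : ∀ s, ContDiffAt ℝ ∞ f (s, x))
    (hT : ∀ᶠ y in 𝓝 x, HasDerivAt (fun s => f (s, y)) (T (t, y)) t) {T' : G}
    (hT' : HasDerivAt (fun s : ℝ => T (t, x + s • v)) T' 0) :
    HasDerivAt (fun s => fderiv ℝ (fun y => f (s, y)) x v) T' t := by
  have hV : ∀ s, fderiv ℝ (fun y => f (s, y)) x v = fderiv ℝ f (s, x) (0, v) := by
    intro s
    have h2 := ((hf s).differentiableAt (by simp)).hasFDerivAt.comp x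
      (hasFDerivAt_prodMk_right (𝕜 := ℝ) s x)
    rw [show (fun y => f (s, y)) = f ∘ fun y => (s, y) from rfl, h2.fderiv]
    simp
  have hf2 : HasFDerivAt (fderiv ℝ f) (fderiv ℝ (fderiv ℝ f) (t, x)) (t, x) :=
    (((hf t).fderiv_right (m := 1) (by norm_cast)).differentiableAt (by simp)).hasFDerivAt
  have hsymm : IsSymmSndFDerivAt ℝ f (t, x) :=
    (hf t).isSymmSndFDerivAt (by
      simp only [minSmoothness_of_isRCLikeNormedField]
      exact WithTop.coe_le_coe.2 (le_top : (2 : ℕ∞) ≤ ⊤))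
  have h1 := hasDerivAt_fderiv_apply hf2
    ((hasDerivAt_id t).prodMk (hasDerivAt_const t x)) rfl ((0 : ℝ), v)
  have hline : HasDerivAt (fun s : ℝ => (t, x + s • v)) ((0 : ℝ), v) 0 := by
    exact (hasDerivAt_const _ _).prodMk (hasDerivAt_line x v)
  have h4 := hasDerivAt_fderiv_apply hf2 hline (by simp) ((1 : ℝ), (0 : F))
  have hc : Filter.Tendsto (fun s : ℝ => x + s • v) (𝓝 0) (𝓝 x) := by
    have : ContinuousAt (fun s : ℝ => x + s • v) 0 := by fun_prop
    simpa [ContinuousAt] using this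
  have hc2 : Filter.Tendsto (fun s : ℝ => (t, x + s • v)) (𝓝 0) (𝓝 (t, x)) := by
    simpa using hline.continuousAt.tendsto
  have hev : (fun s : ℝ => fderiv ℝ f (t, x + s • v) (1, 0)) =ᶠ[𝓝 0]
      fun s : ℝ => T (t, x + s • v) := by
    have h5 : ∀ᶠ z in 𝓝 (t, x), DifferentiableAt ℝ f z :=
      (((hf t).of_le (m := 1) (by norm_cast)).eventually (by simp)).mono
        fun z hz => hz.differentiableAt (by simp)
    filter_upwards [hc.eventually hT, hc2.eventually h5] with s hs hs'
    have h6 := hs'.hasFDerivAt.comp t (hasFDerivAt_prodMk_left (𝕜 := ℝ) t (x + s • v))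
    have h7 := h6.hasDerivAt.unique hs
    simpa using h7
  have h8 := (hT'.congr_of_eventuallyEq hev).unique h4
  simp only [hV]
  rw [h8, ← hsymm]
  exact h1

/-- The variational equation: differentiating `hasDerivAt_flowMap` in the direction `v`, with the
derivative of the speed collected into `β`. -/
lemma hasDerivAt_fderiv_flowMap (hm : m < n) (hp : 0 < nsq m x) (v : E n) :
    ∃ β : ℂ, HasDerivAt (fun t => fderiv ℝ (flowMap m t) x v)
      (speed m t x • dualVec (m + 1) t (fderiv ℝ (flowMap m t) x v) +
        β • dualVec (m + 1) t (flowMap m t x)) t := by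
  have hline := hasDerivAt_line x v
  have h0 : x + (0 : ℝ) • v = x := by simp
  have hspeed : ∃ β, HasDerivAt (fun s : ℝ => speed m t (x + s • v)) β 0 := by
    have h1 : ContDiffAt ℝ ∞ (speed m t) x :=
      (contDiffAt_speed (t := t) hp).comp x (contDiffAt_const.prodMk contDiffAt_id)
    have h2 := (h1.differentiableAt (by simp)).hasFDerivAt
    rw [← h0] at h2
    have h3 : HasDerivAt (speed m t ∘ fun s : ℝ => x + s • v) (fderiv ℝ (speed m t) _ v) 0 :=
      h2.comp_hasDerivAt 0 hline
    exact ⟨_, h3⟩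
  obtain ⟨β, hβ⟩ := hspeed
  have hcurve : HasDerivAt (fun s : ℝ => flowMap m t (x + s • v))
      (fderiv ℝ (flowMap m t) x v) 0 := by
    have h3 := hasFDerivAt_flowMap_right (t := t) hp
    have h4 : HasFDerivAt (flowMap m t) (fderiv ℝ (flowMap m t) x) (x + (0 : ℝ) • v) := by rwa [h0]
    exact h4.comp_hasDerivAt 0 hline
  have hdual : HasDerivAt (fun s : ℝ => dualVec (m + 1) t (flowMap m t (x + s • v)))
      (dualVec (m + 1) t (fderiv ℝ (flowMap m t) x v)) 0 := by
    refine hasDerivAt_of_coord fun i => ?_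
    have h5 : HasDerivAt (fun s : ℝ => flowMap m t (x + s • v) i)
        (fderiv ℝ (flowMap m t) x v i) 0 :=
      ((EuclideanSpace.proj (𝕜 := ℂ) i).restrictScalars ℝ : E n →L[ℝ] ℂ).hasFDerivAt.comp_hasDerivAt
        0 hcurve
    exact Complex.conjCLE.toContinuousLinearMap.hasFDerivAt.comp_hasDerivAt 0
      (h5.const_mul (wt (m + 1) (t : ℂ) i))
  have h6 := hβ.fun_smul hdual
  rw [h0] at h6
  refine ⟨β, hasDerivAt_fderiv_of_time_deriv (f := fun z : ℝ × E n => flowMap m z.1 z.2)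
    (T := fun z => speed m z.1 z.2 • dualVec (m + 1) z.1 (flowMap m z.1 z.2))
    (fun s => contDiffAt_flowMap hp) ?_ h6⟩
  filter_upwards [(isOpen_nsq_pos m).mem_nhds hp] with y hy using hasDerivAt_flowMap hm hy

end

/-! ### The flow is symplectic -/

section
variable {n m : ℕ} {t : ℝ} {x : E n}

/-- If the equation of `X_{k,t}`, composed with `Ψ`, is `a q + b q̄` with `q` the equation of
`X_{l,u}`, then the derivative of `Ψ` maps tangent vectors to tangent vectors. -/
lemma bil_fderiv_eq_zero {k l : ℕ} {t u : ℂ} {Ψ : E n → E n} {a b : E n → ℂ}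
    (hΨ : ContDiffAt ℝ ∞ Ψ x) (ha : ContDiffAt ℝ ∞ a x) (hb : ContDiffAt ℝ ∞ b x)
    (h : ∀ᶠ y in 𝓝 x, bil k t (Ψ y) (Ψ y) = a y * bil l u y y + b y * star (bil l u y y))
    (hx : bil l u x x = 0) {v : E n} (hv : bil l u x v = 0) :
    bil k t (Ψ x) (fderiv ℝ Ψ x v) = 0 := by
  obtain ⟨L, hL, hL'⟩ := hasFDerivAt_bil k t (Ψ x)
  obtain ⟨M, hM, hM'⟩ := hasFDerivAt_bil l u x
  have h1 := hL.comp x (hΨ.differentiableAt (by simp)).hasFDerivAt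
  have h2 := ((ha.differentiableAt (by simp)).hasFDerivAt.mul hM).add
    ((hb.differentiableAt (by simp)).hasFDerivAt.mul
      (Complex.conjCLE.toContinuousLinearMap.hasFDerivAt.comp x hM))
  have h3 := h1.unique (h2.congr_of_eventuallyEq h)
  have h4 := congrArg (fun f => f v) h3
  simp [hL', hM', hx, hv] at h4
  exact h4

lemma bil_fderiv_flowMap (hm : m < n) (hp : 0 < nsq m x) (hq : sqs m x = 0) {v : E n}
    (hv : bil (m + 1) 0 x v = 0) :
    bil (m + 1) t (flowMap m t x) (fderiv ℝ (flowMap m t) x v) = 0 := by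
  have hP := (contDiff_nsq m).contDiffAt (x := x)
  have hR := (contDiff_norm_sq_coord m).contDiffAt (x := x)
  have ht : ContDiffAt ℝ ∞ (fun _ : E n => t) x := contDiffAt_const
  refine bil_fderiv_eq_zero (contDiffAt_flowMap_right hp)
    ((contDiffAt_flowC ht hP hR hp (sq_nonneg _)).ofReal_comp.pow 2)
    (((contDiffAt_flowH ht hP hR hp (sq_nonneg _)).ofReal_comp.mul
      ((contDiff_coord m).contDiffAt.pow 2)).pow 2) ?_ hq hv
  filter_upwards [(isOpen_nsq_pos m).mem_nhds hp] with y hy using bil_flowMap hm hy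

lemma isOpen_disc_pos (m : ℕ) : IsOpen {x : E n | 0 < disc m x} :=
  isOpen_lt continuous_const (contDiff_disc m).continuous

lemma bil_fderiv_backMap (hm : m < n) (hd : 0 < disc m x) (hx : bil (m + 1) t x x = 0) {v : E n}
    (hv : bil (m + 1) t x v = 0) :
    bil (m + 1) 0 (backMap m t x) (fderiv ℝ (backMap m t) x v) = 0 := by
  refine bil_fderiv_eq_zero (contDiffAt_backMap hd) (contDiffAt_backFactor (t := t) hd)
    (b := fun _ => 0) contDiffAt_const ?_ hx hv
  filter_upwards [(isOpen_disc_pos m).mem_nhds hd] with y hy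
  have := sqs_backMap (t := t) hm hy
  rw [sqs] at this
  rw [this]
  ring

lemma inner_dualVec_right {k : ℕ} (t : ℂ) (y w : E n) :
    inner ℂ w (dualVec k t y) = star (bil k t y w) := by
  rw [← inner_dualVec, Complex.star_def, inner_conj_symm]

lemma fderiv_flowMap_zero (hp : 0 < nsq m x) (v : E n) : fderiv ℝ (flowMap m 0) x v = v := by
  have h : flowMap m 0 =ᶠ[𝓝 x] id := by
    filter_upwards [(isOpen_nsq_pos m).mem_nhds hp] with y hy using flowMap_zero hy
  rw [h.fderiv_eq, fderiv_id]
  rfl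

lemma bil_flowMap_self (hm : m < n) (hp : 0 < nsq m x) (hq : sqs m x = 0) :
    bil (m + 1) t (flowMap m t x) (flowMap m t x) = 0 := by
  rw [bil_flowMap hm hp, hq]; simp

/-- The Hermitian product of a transported tangent vector with the position is constant. -/
lemma inner_fderiv_flowMap (hm : m < n) (hp : 0 < nsq m x) (hq : sqs m x = 0) {v : E n}
    (hv : bil (m + 1) 0 x v = 0) (t : ℝ) :
    inner ℂ (fderiv ℝ (flowMap m t) x v) (flowMap m t x) = inner ℂ v x := by
  have hder : ∀ s, HasDerivAt
      (fun s => inner ℂ (fderiv ℝ (flowMap m s) x v) (flowMap m s x)) 0 s := by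
    intro s
    obtain ⟨β, hβ⟩ := hasDerivAt_fderiv_flowMap (t := s) hm hp v
    refine (hβ.inner ℂ (hasDerivAt_flowMap (t := s) hm hp)).congr_deriv ?_
    have h1 := bil_fderiv_flowMap (t := s) hm hp hq hv
    have h2 := bil_flowMap_self (t := s) hm hp hq
    rw [inner_smul_right, inner_dualVec_right, inner_add_left, inner_smul_left, inner_smul_left,
      inner_dualVec, inner_dualVec, bil_comm _ _ (fderiv ℝ (flowMap m s) x v), h1, h2]
    simp
  have := is_const_of_deriv_eq_zero (fun s => (hder s).differentiableAt)
    (fun s => (hder s).deriv) t 0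
  rw [this, fderiv_flowMap_zero hp, flowMap_zero hp]

/-- The imaginary part of the Hermitian product of two transported tangent vectors is
constant. -/
lemma im_inner_fderiv_flowMap (hm : m < n) (hp : 0 < nsq m x) (hq : sqs m x = 0) {v w : E n}
    (hv : bil (m + 1) 0 x v = 0) (hw : bil (m + 1) 0 x w = 0) (t : ℝ) :
    (inner ℂ (fderiv ℝ (flowMap m t) x v) (fderiv ℝ (flowMap m t) x w)).im =
      (inner ℂ v w).im := by
  have hder : ∀ s, HasDerivAt (fun s =>
      (inner ℂ (fderiv ℝ (flowMap m s) x v) (fderiv ℝ (flowMap m s) x w)).im) 0 s := by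
    intro s
    obtain ⟨β, hβ⟩ := hasDerivAt_fderiv_flowMap (t := s) hm hp v
    obtain ⟨γ, hγ⟩ := hasDerivAt_fderiv_flowMap (t := s) hm hp w
    refine (Complex.imCLM.hasFDerivAt.comp_hasDerivAt s (hβ.inner ℂ hγ)).congr_deriv ?_
    have h1 := bil_fderiv_flowMap (t := s) hm hp hq hv
    have h2 := bil_fderiv_flowMap (t := s) hm hp hq hw
    rw [inner_add_right, inner_smul_right, inner_smul_right, inner_dualVec_right,
      inner_dualVec_right, inner_add_left, inner_smul_left, inner_smul_left,
      inner_dualVec, inner_dualVec, h1, h2, bil_comm _ _ (fderiv ℝ (flowMap m s) x w)]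
    simp
    ring
  have := is_const_of_deriv_eq_zero (fun s => (hder s).differentiableAt)
    (fun s => (hder s).deriv) t 0
  rw [this, fderiv_flowMap_zero hp, fderiv_flowMap_zero hp]

lemma fsForm_fderiv_flowMap (lam : ℝ) (hm : m < n) (hp : 0 < nsq m x) (hq : sqs m x = 0)
    {v w : E n} (hv : bil (m + 1) 0 x v = 0) (hw : bil (m + 1) 0 x w = 0) :
    fsForm lam (flowMap m t x) (fderiv ℝ (flowMap m t) x v) (fderiv ℝ (flowMap m t) x w) =
      fsForm lam x v w := by
  have h1 := inner_fderiv_flowMap hm hp hq hv t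
  have h2 := inner_fderiv_flowMap hm hp hq hw t
  have h3 := im_inner_fderiv_flowMap hm hp hq hv hw t
  have h4 : inner ℂ (flowMap m t x) (fderiv ℝ (flowMap m t) x w) = inner ℂ x w := by
    rw [← inner_conj_symm, h2, inner_conj_symm]
  rw [fsForm, fsForm, norm_flowMap hm hp hq, h1, h4, Complex.sub_im, Complex.sub_im,
    ← Complex.ofReal_pow, Complex.im_ofReal_mul, Complex.im_ofReal_mul, h3]

end

/-! ### The stages of the degeneration as symplectomorphisms -/

/-- The map of projective space induced by a homogeneous map of homogeneous coordinates. -/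
def projMap {n : ℕ} (Ψ : E n → E n) (p : PSpace n) : PSpace n :=
  open Classical in if h : Ψ p.rep ≠ 0 then Projectivization.mk ℂ (Ψ p.rep) h else p

lemma IsRep.projMap {n : ℕ} {Ψ : E n → E n} (hΨ : ∀ (c : ℂ) x, c ≠ 0 → Ψ (c • x) = c • Ψ x)
    {p : PSpace n} {x : E n} (hx : IsRep p x) (h : Ψ x ≠ 0) : IsRep (projMap Ψ p) (Ψ x) := by
  obtain ⟨c, hc, hcx⟩ := (isRep_rep p).exists_smul hx
  have h0 : Ψ p.rep ≠ 0 := by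
    intro h1
    rw [hcx, hΨ c _ hc, h1, smul_zero] at h
    exact h rfl
  rw [hcx, hΨ c _ hc]
  refine IsRep.smul ?_ hc
  rw [QuadricGC.projMap, dif_pos h0]
  exact isRep_mk h0

/-- The points of `X_{k,t}` where `λ_1^{(j)}` does not vanish. -/
def discLocus (n j k : ℕ) (t : ℂ) : Set (PSpace n) :=
  {p | p ∈ zeroLocus (quad n k t) ∧ 0 < disc j p.rep}

lemma disc_pos_smul {n j : ℕ} (c : ℂ) (x : E n) (hc : c ≠ 0) :
    (0 < disc j (c • x)) = (0 < disc j x) := by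
  rw [disc_smul, mul_pos_iff_of_pos_left (by positivity)]

lemma IsRep.mem_discLocus_iff {n j k : ℕ} {t : ℂ} {p : PSpace n} {x : E n} (h : IsRep p x) :
    p ∈ discLocus n j k t ↔ bil k t x x = 0 ∧ 0 < disc j x := by
  rw [discLocus, Set.mem_ofPred_eq, h.mem_zeroLocus_iff, mem_cone_quad,
    h.apply_rep (F := fun x : E n => 0 < disc j x) disc_pos_smul]
  exact and_congr_left fun _ => and_iff_right h.ne_zero

lemma mem_coneOver_discLocus {n j k : ℕ} {t : ℂ} {x : E n} :
    x ∈ coneOver (discLocus n j k t) ↔ bil k t x x = 0 ∧ 0 < disc j x := by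
  constructor
  · rintro ⟨p, hp, hx⟩
    exact hx.mem_discLocus_iff.1 hp
  · intro h
    have hx : x ≠ 0 := by
      rintro rfl
      have := nsq_pos_of_disc_pos h.2
      simp [nsq] at this
    exact ⟨_, (isRep_mk hx).mem_discLocus_iff.2 h, isRep_mk hx⟩

lemma isOpenDenseIn_discLocus {n j k : ℕ} {t : ℂ} (hj : 2 ≤ j) (hk : 3 ≤ k) (hkn : k ≤ n) :
    IsOpenDenseIn (zeroLocus (quad n k t)) (discLocus n j k t) :=
  isOpenDenseIn_of_generic hk hkn disc_pos_smul (isOpen_disc_pos j)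
    fun _ _ hx => hx.disc_pos hj (by omega)

lemma dPoly_ne_zero_of_nsq_pos {n m : ℕ} {t : ℂ} {x : E n} (h : 0 < nsq m x) :
    dPoly (quad n (m + 1) t) x ≠ 0 := by
  obtain ⟨i, -, hi⟩ := Finset.exists_ne_zero_of_sum_ne_zero h.ne'
  have him : (i : ℕ) < m := by
    by_contra h'
    simp [h'] at hi
  refine dPoly_quad_ne_zero i (by simp [wt_succ, him]) fun h' => ?_
  simp [h'] at hi

lemma nsq_pos_of_disc_pos_of_le {n j m : ℕ} (hj : j ≤ m) {x : E n} (h : 0 < disc j x) :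
    0 < nsq m x := nsq_pos_of_disc_pos (h.trans_le (disc_mono hj x))

lemma discLocus_subset_regLocus {n j m : ℕ} {t : ℂ} (hj : j ≤ m) :
    discLocus n j (m + 1) t ⊆ regLocus (quad n (m + 1) t) := fun p hp =>
  (isRep_rep p).mem_regLocus_iff.2 ⟨hp.1 _ (isRep_rep p),
    dPoly_ne_zero_of_nsq_pos (nsq_pos_of_disc_pos_of_le hj hp.2)⟩

/-- On the cone `X_{m+1,0}` the function `disc m` vanishes at the singular points only. -/
lemma regLocus_eq_discLocus {n m : ℕ} :
    regLocus (quad n (m + 1) 0) = discLocus n m (m + 1) 0 := by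
  refine Set.Subset.antisymm (fun p hp => ⟨hp.1, ?_⟩) (discLocus_subset_regLocus le_rfl)
  obtain ⟨h1, h2⟩ := (isRep_rep p).mem_regLocus_iff.1 hp
  have h3 : sqs m p.rep = 0 := (mem_cone_quad.1 h1).2
  have h4 : nsq m p.rep ≠ 0 := by
    intro h0
    refine h2 (LinearMap.ext fun v => ?_)
    rw [dPoly_quad, bil, LinearMap.zero_apply]
    refine mul_eq_zero_of_right _ (Finset.sum_eq_zero fun i _ => ?_)
    have h5 := (Finset.sum_eq_zero_iff_of_nonneg fun i _ => by split_ifs <;> positivity).1 h0 i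
      (Finset.mem_univ i)
    rw [wt_zero]
    split_ifs at h5 ⊢ with hi
    · have : p.rep i = 0 := by simpa using h5
      simp [this]
    · simp
  have := (nsq_nonneg m p.rep).lt_of_ne' h4
  rw [disc, h3, norm_zero, zero_pow two_ne_zero, sub_zero]
  positivity

lemma isSymplecticLift_flowMap {n j m : ℕ} (lam t : ℝ) (hm : m < n) (hj : j ≤ m) :
    IsSymplecticLift lam (quad n (m + 1) 0) (quad n (m + 1) t)
      (coneOver (discLocus n j (m + 1) 0)) (coneOver (discLocus n j (m + 1) t))
      (projMap (flowMap m t)) (flowMap m t) := by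
  have hG : ∀ x ∈ coneOver (discLocus n j (m + 1) 0), sqs m x = 0 ∧ 0 < nsq m x ∧ 0 < disc j x := by
    intro x hx
    rw [mem_coneOver_discLocus] at hx
    exact ⟨hx.1, nsq_pos_of_disc_pos_of_le hj hx.2, hx.2⟩
  have hz : ∀ {v x : E n}, dPoly (quad n (m + 1) 0) x v = 0 → bil (m + 1) 0 x v = 0 := by
    intro v x h
    simpa [dPoly_quad] using h
  refine ⟨fun x hx => ?_, fun p x hx hxG => ?_, fun x hx => ?_, fun x hx v hv => ?_,
    fun x hx v w hv hw => ?_⟩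
  · obtain ⟨h1, h2, h3⟩ := hG x hx
    rw [mem_coneOver_discLocus, disc_flowMap hj h2]
    exact ⟨bil_flowMap_self hm h2 h1, h3⟩
  · obtain ⟨h1, h2, h3⟩ := hG x hxG
    refine hx.projMap (fun c x hc => flowMap_smul hc) ?_
    rw [← norm_ne_zero_iff, norm_flowMap hm h2 h1, norm_ne_zero_iff]
    exact hx.ne_zero
  · exact contDiffAt_flowMap_right (hG x hx).2.1
  · obtain ⟨h1, h2, h3⟩ := hG x hx
    rw [dPoly_quad, bil_fderiv_flowMap hm h2 h1 (hz hv), mul_zero]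
  · obtain ⟨h1, h2, h3⟩ := hG x hx
    exact fsForm_fderiv_flowMap lam hm h2 h1 (hz hv) (hz hw)

/-- The inverse of the flow is symplectic because the flow is. -/
lemma isSymplecticLift_backMap {n j m : ℕ} (lam : ℝ) {t : ℝ} (ht : 0 ≤ t) (hm : m < n)
    (hj : j ≤ m) :
    IsSymplecticLift lam (quad n (m + 1) t) (quad n (m + 1) 0)
      (coneOver (discLocus n j (m + 1) t)) (coneOver (discLocus n j (m + 1) 0))
      (projMap (backMap m t)) (backMap m t) := by
  have hG : ∀ x ∈ coneOver (discLocus n j (m + 1) t),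
      bil (m + 1) t x x = 0 ∧ 0 < disc m x ∧ 0 < disc j x := by
    intro x hx
    rw [mem_coneOver_discLocus] at hx
    exact ⟨hx.1, hx.2.trans_le (disc_mono hj x), hx.2⟩
  have hne : ∀ x ∈ coneOver (discLocus n j (m + 1) t), x ≠ 0 := by
    rintro x ⟨p, -, hx⟩
    exact hx.ne_zero
  have hmaps : Set.MapsTo (backMap m t) (coneOver (discLocus n j (m + 1) t))
      (coneOver (discLocus n j (m + 1) 0)) := by
    intro x hx
    obtain ⟨h1, h2, h3⟩ := hG x hx
    rw [mem_coneOver_discLocus, disc_backMap hm hj h1 h2]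
    refine ⟨?_, h3⟩
    have := sqs_backMap (t := t) hm h2
    rwa [h1, zero_mul] at this
  refine (isSymplecticLift_flowMap lam t hm hj).symm ht
    (fun x hx => mem_cone_quad.2 ⟨hne x hx, (hG x hx).1⟩)
    (fun x hx => dPoly_ne_zero_of_nsq_pos (nsq_pos_of_disc_pos (hG x hx).2.1)) ?_ hmaps ?_ ?_ ?_ ?_
  · intro x hx
    filter_upwards [(isOpen_disc_pos j).mem_nhds (hG x hx).2.2] with y hy hyc
    exact mem_coneOver_discLocus.2 ⟨(mem_cone_quad.1 hyc).2, hy⟩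
  · intro p x hx hxG
    refine hx.projMap (fun c x hc => backMap_smul hc) ?_
    obtain ⟨q, -, hq⟩ := hmaps hxG
    exact hq.ne_zero
  · exact fun x hx => contDiffAt_backMap (hG x hx).2.1
  · intro x hx v hv
    obtain ⟨h1, h2, h3⟩ := hG x hx
    rw [dPoly_quad] at hv ⊢
    rw [bil_fderiv_backMap hm h2 h1 (by simpa using hv), mul_zero]
  · intro x hx
    obtain ⟨h1, h2, h3⟩ := hG x hx
    exact flowMap_backMap hm h1 h2

/-! ### The stages as gradient-Hamiltonian flows -/

lemma totalMetric_of_inner_eq_zero {n : ℕ} (lam : ℝ) {x : E n} (hx : x ≠ 0) {V : E n × ℂ}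
    (hV : inner ℂ x V.1 = 0) (W : E n × ℂ) :
    totalMetric lam x V W = 2 * lam / ‖x‖ ^ 2 * (inner ℂ V.1 W.1).re + (star V.2 * W.2).re := by
  have h : inner ℂ V.1 x = 0 := by rw [← inner_conj_symm, hV, map_zero]
  have hx' : ‖x‖ ≠ 0 := norm_ne_zero_iff.2 hx
  rw [totalMetric, fsMetric, fsForm, h, zero_mul, sub_zero, inner_smul_right, ← Complex.ofReal_pow,
    Complex.im_ofReal_mul, Complex.I_mul_im]
  field_simp

/-- The gradient-Hamiltonian vector is proportional to the dual vector of the equation in the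
directions of the fibre. -/
lemma isGradHam_dualVec {n k : ℕ} {lam : ℝ} (hlam : 0 < lam) {t : ℂ} {y : E n} (hy : y ≠ 0)
    (hyy : bil k t y y = 0) (hu : dualVec k t y ≠ 0) :
    IsGradHam lam k y t
      ((coord y (k - 1) ^ 2 / (2 * (‖dualVec k t y‖ : ℂ) ^ 2)) • dualVec k t y, -1) := by
  set u := dualVec k t y with hudef
  set c := coord y (k - 1) with hc
  set ζ : ℂ := c ^ 2 / (2 * (‖u‖ : ℂ) ^ 2) with hζ
  have hS : (‖u‖ : ℂ) ≠ 0 := by exact_mod_cast norm_ne_zero_iff.2 hu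
  have hS' : 0 < ‖u‖ := norm_pos_iff.2 hu
  have hy' : 0 < ‖y‖ := norm_pos_iff.2 hy
  set V : E n × ℂ := (ζ • u, -1) with hVdef
  have hyV : inner ℂ y V.1 = 0 := by
    rw [inner_smul_right, inner_dualVec_right, hyy, star_zero, mul_zero]
  have huu : bil k t y u = (‖u‖ : ℂ) ^ 2 := by rw [← inner_dualVec, inner_self_eq]
  -- the squared length of the gradient-Hamiltonian vector
  set M : ℝ := 1 + lam * ‖c‖ ^ 4 / (2 * ‖u‖ ^ 2 * ‖y‖ ^ 2) with hM
  have hM0 : 0 < M := by positivity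
  have key : ∀ W ∈ totalTangent k y t, totalMetric lam y V W = -(M * W.2.re) := by
    rintro W ⟨hW1, hW2⟩
    rw [totalMetric_of_inner_eq_zero lam hy hyV]
    rw [dPoly_quad] at hW2
    have h1 : inner ℂ V.1 W.1 = ((-(‖c‖ ^ 4 / (4 * ‖u‖ ^ 2)) : ℝ) : ℂ) * W.2 := by
      have h2 : bil k t y W.1 = -(W.2 * c ^ 2) / 2 := by linear_combination hW2 / 2
      have h3 := Complex.conj_mul' c
      rw [inner_smul_left, inner_dualVec, h2, hζ]
      simp only [map_div₀, map_mul, map_pow, Complex.conj_ofReal, map_ofNat]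
      push_cast
      field_simp
      linear_combination (-4 * W.2 * ((starRingEnd ℂ) c * c + ‖c‖ ^ 2)) * h3
    rw [h1, Complex.re_ofReal_mul]
    simp only [hVdef, star_neg, star_one, neg_mul, one_mul, Complex.neg_re, hM]
    field_simp
    ring
  have hVT : V ∈ totalTangent k y t := by
    refine ⟨hyV, ?_⟩
    rw [dPoly_quad, hVdef, bil_smul_right, huu, hζ]
    field_simp
    ring
  have hneg : ∀ (a : ℝ) (W : E n × ℂ), totalMetric lam y (a • V) W = a * totalMetric lam y V W := by
    intro a W
    have h1 : inner ℂ y (a • V).1 = 0 := by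
      rw [Prod.smul_fst, inner_smul_right_eq_smul, hyV, smul_zero]
    rw [totalMetric_of_inner_eq_zero lam hy h1, totalMetric_of_inner_eq_zero lam hy hyV]
    simp [inner_smul_left_eq_smul]
    ring
  have hT : (-M⁻¹) • V ∈ totalTangent k y t := by
    refine ⟨?_, ?_⟩
    · rw [Prod.smul_fst, inner_smul_right_eq_smul, hyV, smul_zero]
    · have h2 := hVT.2
      rw [Prod.smul_fst, Prod.smul_snd, ← Complex.coe_smul, map_smul]
      simp only [smul_eq_mul, Complex.real_smul]
      linear_combination ((-M⁻¹ : ℝ) : ℂ) * h2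
  have hgrad : ∀ W ∈ totalTangent k y t, totalMetric lam y ((-M⁻¹) • V) W = W.2.re := by
    intro W hW
    rw [hneg, key W hW]
    field_simp
  refine ⟨(-M⁻¹) • V, ⟨hT, hgrad⟩, ?_, ?_⟩
  · intro h
    have := congrArg Prod.snd h
    simp [hVdef, hM0.ne'] at this
  · rw [hgrad _ hT, smul_smul]
    have : (((-M⁻¹) • V).2).re = M⁻¹ := by simp [hVdef]
    rw [this, inv_inv, neg_mul_neg, mul_inv_cancel₀ hM0.ne', one_smul]

lemma norm_dualVec_flowMap {n m : ℕ} {t : ℝ} {x : E n} (hm : m < n) (hp : 0 < nsq m x)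
    (hq : sqs m x = 0) : ‖dualVec (m + 1) t (flowMap m t x)‖ ^ 2 =
      flowS t (nsq m x) (‖coord x m‖ ^ 2) := by
  have h : ∀ y : E n, ‖dualVec (m + 1) (t : ℂ) y‖ ^ 2 = nsq m y + t ^ 2 * ‖coord y m‖ ^ 2 := by
    intro y
    rw [norm_sq_eq, nsq, coord_of_lt _ hm, ← sub_eq_iff_eq_add', ← Finset.sum_sub_distrib,
      Finset.sum_eq_single ⟨m, hm⟩]
    · simp [dualVec_apply, wt_succ, mul_pow]
    · intro i _ hi
      have : (i : ℕ) ≠ m := fun h => hi (Fin.ext h)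
      by_cases h : (i : ℕ) < m <;> simp [dualVec_apply, wt_succ, this, h]
    · simp
  rw [h, nsq_flowMap hp hq, norm_coord_flowMap hm, ← flowP_add hp (sq_nonneg _)]

/-- The curve `s ↦ B_{1-s}(x)` integrates the gradient-Hamiltonian vector field. -/
lemma isGradHamCurve_flowMap {n m : ℕ} {lam : ℝ} (hlam : 0 < lam) (hm : m < n) {x : E n}
    (hp : 0 < nsq m x) (hq : sqs m x = 0) {c : ℝ → PSpace n}
    (hc : ∀ s, IsRep (c s) (flowMap m (1 - s) x)) : IsGradHamCurve lam (m + 1) c := by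
  refine ⟨fun s => flowMap m (1 - s) x, fun s => -(speed m (1 - s) x •
    dualVec (m + 1) (((1 - s : ℝ)) : ℂ) (flowMap m (1 - s) x)), fun s hs => ?_⟩
  have hyy := bil_flowMap_self (t := 1 - s) hm hp hq
  have hS := flowS_pos (t := 1 - s) hp (sq_nonneg ‖coord x m‖)
  have hnorm := norm_dualVec_flowMap (t := 1 - s) hm hp hq
  have hu : dualVec (m + 1) ((1 - s : ℝ) : ℂ) (flowMap m (1 - s) x) ≠ 0 := by
    intro h
    rw [h, norm_zero, zero_pow two_ne_zero] at hnorm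
    exact hS.ne hnorm
  refine ⟨hc s, ?_, ?_, ?_⟩
  · refine (hc s).mem_regLocus_iff.2 ⟨mem_cone_quad.2 ⟨(hc s).ne_zero, hyy⟩, ?_⟩
    refine dPoly_ne_zero_of_nsq_pos ?_
    rw [nsq_flowMap hp hq]
    exact flowP_pos hp (sq_nonneg _)
  · have h1 := (hasDerivAt_flowMap (t := 1 - s) hm hp).scomp s ((hasDerivAt_id s).const_sub 1)
    rw [neg_one_smul] at h1
    exact h1.hasDerivWithinAt
  · have h1 := isGradHam_dualVec hlam (hc s).ne_zero hyy hu
    have h2 : inner ℂ (flowMap m (1 - s) x) (-(speed m (1 - s) x •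
        dualVec (m + 1) (((1 - s : ℝ)) : ℂ) (flowMap m (1 - s) x))) = 0 := by
      rw [inner_neg_right, inner_smul_right, inner_dualVec_right, hyy, star_zero, mul_zero,
        neg_zero]
    have h3 : (‖dualVec (m + 1) ((1 - s : ℝ) : ℂ) (flowMap m (1 - s) x)‖ : ℂ) ^ 2 =
        flowS (1 - s) (nsq m x) (‖coord x m‖ ^ 2) := by exact_mod_cast congrArg Complex.ofReal hnorm
    rw [h3] at h1
    rw [h2, zero_div, zero_smul, sub_zero]
    beta_reduce
    rw [← neg_smul, speed, neg_neg]
    exact h1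

/-- `f` and its inverse, from `A ⊆ {P = 0}` to `B ⊆ {Q = 0}`, have symplectic lifts to the cones
that are inverse to each other. -/
def IsSymplecticEquiv {n : ℕ} (lam : ℝ) (P Q : MvPolynomial (Fin n) ℂ) (A B : Set (PSpace n))
    (f : PSpace n → PSpace n) : Prop :=
  ∃ (g : PSpace n → PSpace n) (Ψ Θ : E n → E n),
    IsSymplecticLift lam P Q (coneOver A) (coneOver B) f Ψ ∧
    IsSymplecticLift lam Q P (coneOver B) (coneOver A) g Θ ∧
    (∀ x ∈ coneOver A, Θ (Ψ x) = x) ∧ ∀ x ∈ coneOver B, Ψ (Θ x) = x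

lemma IsSymplecticEquiv.comp {n : ℕ} {lam : ℝ} {P Q R : MvPolynomial (Fin n) ℂ}
    {A B C : Set (PSpace n)} {f f' : PSpace n → PSpace n}
    (h' : IsSymplecticEquiv lam Q R B C f') (h : IsSymplecticEquiv lam P Q A B f) :
    IsSymplecticEquiv lam P R A C fun p => f' (f p) := by
  obtain ⟨g, Ψ, Θ, h1, h2, h3, h4⟩ := h
  obtain ⟨g', Ψ', Θ', h1', h2', h3', h4'⟩ := h'
  refine ⟨fun p => g (g' p), fun x => Ψ' (Ψ x), fun x => Θ (Θ' x), h1'.comp h1, h2.comp h2',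
    fun x hx => ?_, fun x hx => ?_⟩
  · beta_reduce
    rw [h3' _ (h1.mapsTo hx), h3 x hx]
  · beta_reduce
    rw [h4 _ (h2'.mapsTo hx), h4' x hx]

lemma IsSymplecticEquiv.refl {n : ℕ} (lam : ℝ) (P : MvPolynomial (Fin n) ℂ) (A : Set (PSpace n)) :
    IsSymplecticEquiv lam P P A A id := by
  have h : IsSymplecticLift lam P P (coneOver A) (coneOver A) id id :=
    ⟨fun x hx => hx, fun p x hx _ => hx, fun x _ => contDiffAt_id,
      fun x _ v hv => by simpa using hv, fun x _ v w _ _ => by simp⟩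
  exact ⟨id, id, id, h, h, fun _ _ => rfl, fun _ _ => rfl⟩

lemma IsSymplecticEquiv.isSymplectomorphism {n k l : ℕ} {t u : ℂ} {lam : ℝ}
    {A B : Set (PSpace n)} {f : PSpace n → PSpace n}
    (h : IsSymplecticEquiv lam (quad n k t) (quad n l u) A B f)
    (hA : A ⊆ regLocus (quad n k t)) (hB : B ⊆ regLocus (quad n l u))
    (hAo : IsOpenDenseIn (zeroLocus (quad n k t)) A)
    (hBo : IsOpenDenseIn (zeroLocus (quad n l u)) B) :
    IsSymplectomorphism lam (quad n k t) (quad n l u) A B f := by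
  obtain ⟨g, Ψ, Θ, h1, h2, h3, h4⟩ := h
  exact h1.isSymplectomorphism h2 h3 h4 hA hB hAo.2.1 hBo.2.1

lemma isSymplecticEquiv_flowMap {n j m : ℕ} (lam : ℝ) {t : ℝ} (ht : 0 ≤ t) (hm : m < n)
    (hj : j ≤ m) : IsSymplecticEquiv lam (quad n (m + 1) 0) (quad n (m + 1) t)
      (discLocus n j (m + 1) 0) (discLocus n j (m + 1) t) (projMap (flowMap m t)) ∧
    IsSymplecticEquiv lam (quad n (m + 1) t) (quad n (m + 1) 0)
      (discLocus n j (m + 1) t) (discLocus n j (m + 1) 0) (projMap (backMap m t)) := by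
  have h1 := isSymplecticLift_flowMap lam t hm hj
  have h2 := isSymplecticLift_backMap lam ht hm hj
  have h3 : ∀ x ∈ coneOver (discLocus n j (m + 1) 0), backMap m t (flowMap m t x) = x := by
    intro x hx
    rw [mem_coneOver_discLocus] at hx
    exact backMap_flowMap hm (nsq_pos_of_disc_pos_of_le hj hx.2) hx.1
  have h4 : ∀ x ∈ coneOver (discLocus n j (m + 1) t), flowMap m t (backMap m t x) = x := by
    intro x hx
    rw [mem_coneOver_discLocus] at hx
    exact flowMap_backMap hm hx.1 (hx.2.trans_le (disc_mono hj x))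
  exact ⟨⟨_, _, _, h1, h2, h3, h4⟩, ⟨_, _, _, h2, h1, h4, h3⟩⟩

/-- The gradient-Hamiltonian flow of the family `𝔛_{m+1}`, from `X_{m+1,1}` to `X_{m+1,1-s}`: the
flow lines are followed from `X_{m+1,1}` to `X_{m+1,0}` and back. -/
def stageMap {n : ℕ} (m : ℕ) (s : ℝ) (p : PSpace n) : PSpace n :=
  projMap (flowMap m (1 - s)) (projMap (backMap m 1) p)

section
variable {n j m : ℕ} {lam : ℝ}

lemma isSymplecticEquiv_stageMap (lam : ℝ) {s : ℝ} (hs : s ≤ 1) (hm : m < n) (hj : j ≤ m) :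
    IsSymplecticEquiv lam (quad n (m + 1) 1) (quad n (m + 1) ((1 - s : ℝ) : ℂ))
      (discLocus n j (m + 1) 1) (discLocus n j (m + 1) ((1 - s : ℝ) : ℂ)) (stageMap m s) := by
  have h1 := (isSymplecticEquiv_flowMap lam zero_le_one hm hj).2
  rw [Complex.ofReal_one] at h1
  exact (isSymplecticEquiv_flowMap lam (sub_nonneg.2 hs) hm hj).1.comp h1

lemma backMap_one_mem (hm : m < n) (hj : j ≤ m) {x : E n}
    (hx : x ∈ coneOver (discLocus n j (m + 1) 1)) :
    backMap m 1 x ∈ coneOver (discLocus n j (m + 1) 0) := by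
  have := (isSymplecticLift_backMap (j := j) 1 zero_le_one hm hj).mapsTo
  rw [Complex.ofReal_one] at this
  exact this hx

lemma isRep_stageMap (hm : m < n) (hj : j ≤ m) {p : PSpace n} (hp : p ∈ discLocus n j (m + 1) 1)
    {x : E n} (hx : IsRep p x) (s : ℝ) :
    IsRep (stageMap m s p) (flowMap m (1 - s) (backMap m 1 x)) := by
  have hxG : x ∈ coneOver (discLocus n j (m + 1) 1) := ⟨p, hp, hx⟩
  have h1 := (isSymplecticLift_backMap (j := j) 1 zero_le_one hm hj).rep
  rw [Complex.ofReal_one] at h1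
  exact (isSymplecticLift_flowMap (j := j) 1 (1 - s) hm hj).rep _ _ (h1 p x hx hxG)
    (backMap_one_mem hm hj hxG)

lemma sqs_nsq_of_mem (hj : j ≤ m) {x : E n} (hx : x ∈ coneOver (discLocus n j (m + 1) 0)) :
    sqs m x = 0 ∧ 0 < nsq m x := by
  rw [mem_coneOver_discLocus] at hx
  exact ⟨hx.1, nsq_pos_of_disc_pos_of_le hj hx.2⟩

lemma flowMap_backMap_one (hm : m < n) (hj : j ≤ m) {x : E n}
    (hx : x ∈ coneOver (discLocus n j (m + 1) 1)) : flowMap m 1 (backMap m 1 x) = x := by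
  rw [mem_coneOver_discLocus] at hx
  exact flowMap_backMap hm (by rw [Complex.ofReal_one]; exact hx.1)
    (hx.2.trans_le (disc_mono hj x))

lemma stageMap_zero (hm : m < n) (hj : j ≤ m) {p : PSpace n}
    (hp : p ∈ discLocus n j (m + 1) 1) : stageMap m 0 p = p := by
  have h := isRep_stageMap hm hj hp (isRep_rep p) 0
  rw [sub_zero, flowMap_backMap_one hm hj ⟨p, hp, isRep_rep p⟩] at h
  exact h.eq (isRep_rep p)

lemma Phi_stageMap (hlam : 0 < lam) (h2 : 2 ≤ m) (hm : m < n) (hj : j ≤ m) {p : PSpace n}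
    (hp : p ∈ discLocus n j (m + 1) 1) (s : ℝ) :
    Phi lam (m + 1) (stageMap m s p) = Phi lam (m + 1) p := by
  have hx := isRep_rep p
  have hxG : p.rep ∈ coneOver (discLocus n j (m + 1) 1) := ⟨p, hp, hx⟩
  obtain ⟨h3, h4⟩ := sqs_nsq_of_mem hj (backMap_one_mem hm hj hxG)
  have h5 := flowMap_backMap_one hm hj hxG
  ext i
  have h6 := num_flowMap (t := 1) (j := i + 2) h2 hm h4 h3
  have h7 := norm_flowMap (t := 1) hm h4 h3
  rw [h5] at h6 h7
  rw [Phi_apply hlam (isRep_stageMap hm hj hp hx s), Phi_apply hlam hx, num_flowMap h2 hm h4 h3,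
    norm_flowMap hm h4 h3, h6, h7]

lemma image_stageMap (hj2 : 2 ≤ j) (hm : m < n) (hj : j ≤ m) {s : ℝ} (hs : s ≤ 1) :
    stageMap m s '' discLocus n j (m + 1) 1 = discLocus n j (m + 1) ((1 - s : ℝ) : ℂ) :=
  ((isSymplecticEquiv_stageMap 1 hs hm hj).isSymplectomorphism (discLocus_subset_regLocus hj)
    (discLocus_subset_regLocus hj) (isOpenDenseIn_discLocus hj2 (by omega) (by omega))
    (isOpenDenseIn_discLocus hj2 (by omega) (by omega))).bijOn.image_eq

lemma isStageFlow_stageMap (hlam : 0 < lam) (h2 : 2 ≤ m) (hm : m < n) :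
    IsStageFlow lam (m + 1) (discLocus n m (m + 1) 1) (stageMap m) := by
  have hod : ∀ t : ℂ, IsOpenDenseIn (zeroLocus (quad n (m + 1) t)) (discLocus n m (m + 1) t) :=
    fun t => isOpenDenseIn_discLocus h2 (by omega) (by omega)
  refine ⟨hod 1, fun p hp => stageMap_zero hm le_rfl hp, fun p hp => ?_, fun s hs => ?_,
    fun s hs => ?_, ?_, fun s _ p hp => Phi_stageMap hlam h2 hm le_rfl hp s⟩
  · obtain ⟨h3, h4⟩ := sqs_nsq_of_mem le_rfl (backMap_one_mem hm le_rfl ⟨p, hp, isRep_rep p⟩)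
    exact isGradHamCurve_flowMap hlam hm h4 h3 fun s =>
      isRep_stageMap hm le_rfl hp (isRep_rep p) s
  · rw [image_stageMap h2 hm le_rfl hs.2]
    exact (isSymplecticEquiv_stageMap lam hs.2 hm le_rfl).isSymplectomorphism
      (discLocus_subset_regLocus le_rfl) (discLocus_subset_regLocus le_rfl) (hod _) (hod _)
  · rw [image_stageMap h2 hm le_rfl hs.2]
    exact hod _
  · rw [image_stageMap h2 hm le_rfl le_rfl, sub_self, Complex.ofReal_zero, regLocus_eq_discLocus]

end

/-! ### The composition of the stages -/

lemma quad_self (n : ℕ) : quad n n 1 = ∑ i : Fin n, MvPolynomial.X i ^ 2 := by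
  rw [quad_eq]
  refine Finset.sum_congr rfl fun i _ => ?_
  have h := i.2
  have : wt n (1 : ℂ) i = 1 := by
    rw [wt]
    split_ifs
    · rfl
    · rfl
    · omega
  rw [this, map_one, one_mul]

lemma quad_succ_zero (n k : ℕ) : quad n (k + 1) 0 = quad n k 1 := by
  rw [quad_eq, quad_eq]
  refine Finset.sum_congr rfl fun i _ => ?_
  congr 2
  rw [wt_zero, wt]
  split_ifs <;> first | rfl | omega

lemma discLocus_succ_zero (n j k : ℕ) : discLocus n j (k + 1) 0 = discLocus n j k 1 := by
  rw [discLocus, discLocus, quad_succ_zero]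

lemma discLocus_one_subset_regLocus {n j k : ℕ} (hj : j ≤ k) :
    discLocus n j k 1 ⊆ regLocus (quad n k 1) := by
  rw [← discLocus_succ_zero, ← quad_succ_zero]
  exact discLocus_subset_regLocus hj

/-- On `X_{k+1,0}` the functions `λ_1^{(k)}` and `ν_k` agree. -/
lemma Phi_succ_eq {n k : ℕ} (hk : 3 ≤ k) {lam : ℝ} (hlam : 0 < lam) {p : PSpace n}
    (hp : p ∈ zeroLocus (quad n (k + 1) 0)) : Phi lam (k + 1) p = Phi lam k p := by
  have hx := isRep_rep p
  have hq : sqs k p.rep = 0 := (mem_cone_quad.1 (hp _ hx)).2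
  ext i
  rw [Phi_apply hlam hx, Phi_apply hlam hx]
  congr 2
  rw [num, num]
  rcases lt_trichotomy ((i : ℕ) + 2) k with h | h | h
  · rw [if_pos h, if_pos (by omega)]
  · rw [if_pos (by omega), if_neg (by omega), h, ell, if_neg (by omega), disc, hq, norm_zero,
      zero_pow two_ne_zero, sub_zero, Real.sqrt_sq (nsq_nonneg k _)]
  · rw [if_neg (by omega), if_neg (by omega)]

section
variable {n : ℕ} {lam : ℝ}

lemma composedFlow_succ_apply (l : ℕ) (p : PSpace n) :
    composedFlow (fun k => stageMap (k - 1)) (l + 1) p =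
      stageMap (n - l - 1) 1 (composedFlow (fun k => stageMap (k - 1)) l p) := rfl

lemma isSymplecticEquiv_composedFlow (lam : ℝ) {l : ℕ} (hl : l ≤ n - 3) :
    IsSymplecticEquiv lam (quad n n 1) (quad n (n - l) 1) (discLocus n 3 n 1)
      (discLocus n 3 (n - l) 1) (composedFlow (fun k => stageMap (k - 1)) l) := by
  induction l with
  | zero => exact IsSymplecticEquiv.refl lam _ _
  | succ l ih =>
    have h1 := isSymplecticEquiv_stageMap (n := n) (j := 3) (m := n - l - 1) lam le_rfl
      (by omega) (by omega)
    rw [sub_self, Complex.ofReal_zero, quad_succ_zero, discLocus_succ_zero,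
      show n - l - 1 + 1 = n - l by omega] at h1
    exact h1.comp (ih (by omega))

lemma composedFlow_mem {l : ℕ} (hl : l ≤ n - 3) {p : PSpace n} (hp : p ∈ discLocus n 3 n 1) :
    composedFlow (fun k => stageMap (k - 1)) l p ∈ discLocus n 3 (n - l) 1 := by
  obtain ⟨g, Ψ, Θ, h1, -⟩ := isSymplecticEquiv_composedFlow 1 hl
  have hx : p.rep ∈ coneOver (discLocus n 3 n 1) := ⟨p, hp, isRep_rep p⟩
  exact (h1.rep p _ (isRep_rep p) hx).mem_coneOver_iff.1 (h1.mapsTo hx)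

lemma Phi_composedFlow (hlam : 0 < lam) {l : ℕ} (hl : l ≤ n - 3) {p : PSpace n}
    (hp : p ∈ discLocus n 3 n 1) :
    Phi lam (n - l) (composedFlow (fun k => stageMap (k - 1)) l p) = Phi lam n p := by
  induction l with
  | zero => rfl
  | succ l ih =>
    have h1 := composedFlow_mem (n := n) hl hp
    have h2 := composedFlow_mem (n := n) (l := l) (by omega) hp
    rw [← ih (by omega)]
    obtain ⟨m, hm⟩ : ∃ m, n - l = m + 1 := ⟨n - l - 1, by omega⟩
    rw [show n - (l + 1) = m by omega] at h1 ⊢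
    rw [composedFlow_succ_apply, hm, Nat.add_sub_cancel] at h1 ⊢
    rw [hm] at h2
    rw [← Phi_succ_eq (by omega) hlam (by rw [quad_succ_zero]; exact h1.1),
      Phi_stageMap hlam (by omega) (by omega) (show 3 ≤ m by omega) h2]

end

end

end QuadricGC

theorem mainTheorem3 (n : ℕ) (hn : 3 ≤ n) (lam : ℝ) (hlam : 0 < lam) :
    -- `μ_{SO(k)}` is the moment map; on `ℙⁿ⁻¹` the functions `λ_i^{(k)}` are well defined and
    -- vanish for `i ≥ 2`, so that `Φ_n` consists of the nonzero Gelfand-Cetlin functions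
    (∀ k, 2 ≤ k → k ≤ n →
      IsMomentMapSO (n := n) lam k (muSO lam k) ∧
      ∀ p : PSpace n, (∃! l, IsChamberPoint k (muSO lam k p) l) ∧
        ∀ i, 2 ≤ i → gcFun lam k i p = 0) ∧
    -- the stages start at `X`, and each one starts where the preceding one ends
    quad n n 1 = ∑ i : Fin n, MvPolynomial.X i ^ 2 ∧
    (∀ k, 4 ≤ k → k ≤ n → quad n k 0 = quad n (k - 1) 1 ∧
      ∀ p ∈ zeroLocus (quad n k 0), Phi lam k p = Phi lam (k - 1) p) ∧
    -- each stage is a flat family carrying the integrable systems `Φ_k`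
    (∀ k, 3 ≤ k → k ≤ n →
      Module.Flat (Polynomial ℂ)
        (MvPolynomial (Fin n) (Polynomial ℂ) ⧸ Ideal.span {famPoly n k}) ∧
      Continuous (Phi (n := n) lam k) ∧
      ∀ t : ℂ, IsIntegrableSystem lam (quad n k t) (Phi lam k)) ∧
    -- the end `X_{3,1}` (which is `X_{4,0}` if `n ≥ 4`) is toric with moment map `Φ_3`
    IsToricMomentMap lam (quad n 3 1) (Phi lam 3) ∧
    -- the gradient-Hamiltonian flows of the stages, and their composition
    ∃ (U : ℕ → Set (PSpace n)) (φ : ℕ → ℝ → PSpace n → PSpace n),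
      (∀ k, 3 ≤ k → k ≤ n → IsStageFlow lam k (U k) (φ k)) ∧
      ∃ W : Set (PSpace n), IsOpenDenseIn (zeroLocus (quad n n 1)) W ∧
        (∀ m, m < n - 3 → composedFlow φ m '' W ⊆ U (n - m) ∧
          ∀ s ∈ Set.Icc (0 : ℝ) 1,
            IsSymplectomorphism lam (quad n n 1) (quad n (n - m) ((1 - s : ℝ) : ℂ)) W
              ((fun p => φ (n - m) s (composedFlow φ m p)) '' W)
              (fun p => φ (n - m) s (composedFlow φ m p)) ∧
            IsOpenDenseIn (zeroLocus (quad n (n - m) ((1 - s : ℝ) : ℂ)))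
              ((fun p => φ (n - m) s (composedFlow φ m p)) '' W) ∧
            ∀ p ∈ W, Phi lam (n - m) (φ (n - m) s (composedFlow φ m p)) = Phi lam n p) ∧
        IsSymplectomorphism lam (quad n n 1) (quad n 3 1) W (regLocus (quad n 3 1))
          (composedFlow φ (n - 3)) ∧
        ∀ p ∈ W, Phi lam 3 (composedFlow φ (n - 3) p) = Phi lam n p := by
  refine ⟨fun k hk hkn => ⟨isMomentMapSO_muSO lam hkn, fun p =>
    ⟨existsUnique_isChamberPoint lam hk p, fun i hi => gcFun_eq_zero lam hk hi p⟩⟩,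
    quad_self n, fun k hk hkn => ?_, fun k hk hkn => ⟨flat_famPoly hk hkn, continuous_Phi hlam k,
      fun t => isIntegrableSystem_quad hk hkn hlam t⟩, isToricMomentMap_quad hn hlam,
    fun k => discLocus n (k - 1) k 1, fun k => stageMap (k - 1), fun k hk hkn => ?_,
    discLocus n 3 n 1, isOpenDenseIn_discLocus (by norm_num) hn le_rfl, fun m hm => ?_, ?_,
    fun p hp => ?_⟩
  · obtain ⟨k, rfl⟩ := Nat.exists_eq_add_of_le' (by omega : 1 ≤ k)
    exact ⟨quad_succ_zero n k, fun p hp => Phi_succ_eq (by omega) hlam hp⟩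
  · obtain ⟨m, rfl⟩ := Nat.exists_eq_add_of_le' (by omega : 1 ≤ k)
    exact isStageFlow_stageMap hlam (by omega) (by omega)
  · obtain ⟨k, hk⟩ : ∃ k, n - m = k + 1 := ⟨n - m - 1, by omega⟩
    have h3 : 3 ≤ k := by omega
    have hequiv := isSymplecticEquiv_composedFlow (n := n) lam hm.le
    have hmem : ∀ p ∈ discLocus n 3 n 1,
        composedFlow (fun k => stageMap (k - 1)) m p ∈ discLocus n 3 (n - m) 1 :=
      fun p hp => composedFlow_mem hm.le hp
    have hPhi : ∀ p ∈ discLocus n 3 n 1,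
        Phi lam (n - m) (composedFlow (fun k => stageMap (k - 1)) m p) = Phi lam n p :=
      fun p hp => Phi_composedFlow hlam hm.le hp
    simp only [hk, Nat.add_sub_cancel] at hequiv hmem hPhi ⊢
    refine ⟨?_, fun s hs => ?_⟩
    · rintro _ ⟨p, hp, rfl⟩
      exact ⟨(hmem p hp).1, (hmem p hp).2.trans_le (disc_mono h3 _)⟩
    · have hod : ∀ k t, 3 ≤ k → k ≤ n → IsOpenDenseIn (zeroLocus (quad n k t))
          (discLocus n 3 k t) := fun k t h h' => isOpenDenseIn_discLocus (by norm_num) h h'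
      have h1 := ((isSymplecticEquiv_stageMap lam hs.2 (by omega) h3).comp
        hequiv).isSymplectomorphism (discLocus_one_subset_regLocus hn)
        (discLocus_subset_regLocus h3) (hod _ _ hn le_rfl) (hod _ _ (by omega) (by omega))
      rw [h1.bijOn.image_eq]
      exact ⟨h1, hod _ _ (by omega) (by omega), fun p hp => by
        rw [Phi_stageMap hlam (by omega) (by omega) h3 (hmem p hp), hPhi p hp]⟩
  · have hequiv := isSymplecticEquiv_composedFlow (n := n) lam le_rfl
    rw [show n - (n - 3) = 3 by omega] at hequiv
    have hreg : regLocus (quad n 3 1) = discLocus n 3 3 1 := by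
      rw [← quad_succ_zero, regLocus_eq_discLocus, discLocus_succ_zero]
    rw [hreg]
    exact hequiv.isSymplectomorphism (discLocus_one_subset_regLocus hn) hreg.ge
      (isOpenDenseIn_discLocus (by norm_num) hn le_rfl)
      (isOpenDenseIn_discLocus (by norm_num) le_rfl hn)
  · have := Phi_composedFlow hlam le_rfl hp
    rwa [show n - (n - 3) = 3 by omega] at this
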